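/- Let $n\ge 2$ and let $(M,Q,g)$ be a compact connected quaternionic-Kähler manifold of dimension $4n$. That is, $Q\subset\mathrm{End}(TM)$ is a rank three subbundle locally generated by smooth almost complex structures $J_1,J_2,J_3$ satisfying the quaternionic relations $J_i^2=-\mathrm{Id}$, $J_1J_2=J_3=-J_2J_1$ (an admissible basis of $Q$), and $g$ is a Riemannian metric whose Levi-Civita connection $D^g$ preserves $Q$ and for which all elements of $Q$ are skew-symmetric. A quaternionic connection is a torsion-free linear connection on $M$ that preserves $Q$. For a $1$-form $\alpha$ put $$S^\alpha_X=\alpha(X)\,\mathrm{Id}_{TM}+\alpha\otimes X-\sum_{i=1}^3\bigl[\alpha(J_iX)J_i+(\alpha\circ J_i)\otimes J_iX\bigr],\qquad X\in TM,$$ which does not depend on the admissible basis. Locally $TM\otimes\mathbb C\cong \mathbf E\otimes\mathbf H$ and $Q\otimes\mathbb C\cong S^2(\mathbf H)$, with $\mathbf E$, $\mathbf H$ of complex rank $2n$ and $2$, so that $T^*M\otimes Q\cong(\mathbf E^*\otimes S^3(\mathbf H))\oplus(\mathbf E^*\otimes\mathbf H)$. In real terms the first summand is the kernel of the contraction $T^*M\otimes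 Q\to T^*M$, $\beta\otimes A\mapsto\beta\circ A$, and the second consists of all $\sum_i(\beta\circ J_i)\otimes J_i$ with $\beta\in T^*M$. For a quaternionic connection $D$, the Penrose operator $P^D:\Gamma(Q)\to\Gamma(\mathbf E^*\otimes S^3(\mathbf H))$ is the composition of $D:\Gamma(Q)\to\Gamma(T^*M\otimes Q)$ with the projection onto the first summand. Let $D=D^g+S^\alpha$ be a quaternionic connection on $(M,Q)$, where $\alpha$ is a smooth co-closed $1$-form. Assume that either $\mathrm{Scal}^g<0$, or $\mathrm{Scal}^g=0$ and $\alpha\ne0$ at every point of a dense subset of $M$. Then the only smooth global section $A\in\Gamma(Q)$ with $P^DA=0$ is $A=0$. -/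

import Mathlib

open Bundle
open scoped Manifold ContDiff Topology

noncomputable section

namespace QuatGeom

set_option linter.unusedSectionVars false

section LinearAlgebra

variable {V : Type*} [AddCommGroup V] [Module ℝ V] [TopologicalSpace V]
  [IsTopologicalAddGroup V] [ContinuousSMul ℝ V]

/-- `J` is an *admissible basis* of the space `Q` of endomorphisms of `V`: three complex structures
that satisfy the quaternionic relations (the remaining ones, such as `J₁ J₀ = - J₂`, follow from
those listed) and span `Q`. -/
structure IsAdmissibleBasis (Q : Submodule ℝ (V →L[ℝ] V)) (J : Fin 3 → V →L[ℝ] V) : Prop where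
  sq : ∀ i, J i * J i = -1
  mul : J 0 * J 1 = J 2
  span : Q = Submodule.span ℝ (Set.range J)

/-- The natural Euclidean product `⟨A, B⟩ = - tr (A B) / dim V`, for which every admissible basis is
orthonormal. -/
def qInner (A B : V →L[ℝ] V) : ℝ :=
  -(LinearMap.trace ℝ V ((A * B : V →L[ℝ] V) : V →ₗ[ℝ] V)) / Module.finrank ℝ V

/-- The endomorphism `S^a_X = a(X) Id + a ⊗ X - ∑ᵢ [a(Jᵢ X) Jᵢ + (a ∘ Jᵢ) ⊗ Jᵢ X]` of `V`. -/
def sTensor (J : Fin 3 → V →L[ℝ] V) (a : V →L[ℝ] ℝ) (X : V) : V →L[ℝ] V :=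
  a X • 1 + a.smulRight X - ∑ i, (a (J i X) • J i + (a ∘L J i).smulRight (J i X))

/-- Evaluation at `X`, as a linear map on a space of endomorphisms. -/
def evalAt (Q : Submodule ℝ (V →L[ℝ] V)) (X : V) : Q →ₗ[ℝ] V where
  toFun A := A.1 X
  map_add' _ _ := rfl
  map_smul' _ _ := rfl

/-- The contraction `V* ⊗ Q → V*`, `α ⊗ A ↦ α ∘ A`; in terms of `γ : V → Q` it is
`X ↦ tr (Z ↦ γ(Z) X)`. Writing `V = E ⊗ H`, `Q = S²H`, it is the identity of `E*` tensored with the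
natural map `H ⊗ S²H → H`. -/
def contraction (Q : Submodule ℝ (V →L[ℝ] V)) : (V →ₗ[ℝ] Q) →ₗ[ℝ] Module.Dual ℝ V where
  toFun γ :=
    { toFun := fun X => LinearMap.trace ℝ V (evalAt Q X ∘ₗ γ)
      map_add' := fun X Y => by
        rw [← map_add]; congr 1; ext Z; simp [evalAt]
      map_smul' := fun c X => by
        rw [RingHom.id_apply, ← map_smul]; congr 1; ext Z; simp [evalAt] }
  map_add' γ γ' := by
    ext X
    simp only [LinearMap.coe_mk, AddHom.coe_mk, LinearMap.add_apply]
    rw [← map_add]; congr 1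
  map_smul' c γ := by
    ext X
    simp only [LinearMap.coe_mk, AddHom.coe_mk, LinearMap.smul_apply, RingHom.id_apply]
    rw [← map_smul]; congr 1

/-- The summand `E* ⊗ S³H` of `V* ⊗ Q = Hom(V, Q)`: the kernel of the contraction. -/
def partES3 (Q : Submodule ℝ (V →L[ℝ] V)) : Submodule ℝ (V →ₗ[ℝ] Q) :=
  LinearMap.ker (contraction Q)

/-- The summand `E* ⊗ H` of `V* ⊗ Q = Hom(V, Q)`: the image of `V*` under the transpose of the
contraction, that is, all `γ` for which there is a `β ∈ V*` with `⟨γ(X), A⟩ = β(A X)`; in terms of an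
admissible basis, `γ(X) = ∑ᵢ β(Jᵢ X) Jᵢ`. -/
def partEH (Q : Submodule ℝ (V →L[ℝ] V)) : Submodule ℝ (V →ₗ[ℝ] Q) where
  carrier := {γ | ∃ β : Module.Dual ℝ V, ∀ X, ∀ A ∈ Q, qInner (γ X : V →L[ℝ] V) A = β (A X)}
  zero_mem' := ⟨0, fun X A _ => by simp [qInner]⟩
  add_mem' := by
    rintro γ γ' ⟨β, h⟩ ⟨β', h'⟩
    refine ⟨β + β', fun X A hA => ?_⟩
    rw [LinearMap.add_apply, LinearMap.add_apply, ← h X A hA, ← h' X A hA]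
    simp only [qInner, Submodule.coe_add, add_mul, ContinuousLinearMap.toLinearMap_add, map_add]
    ring
  smul_mem' := by
    rintro c γ ⟨β, h⟩
    refine ⟨c • β, fun X A hA => ?_⟩
    rw [LinearMap.smul_apply, LinearMap.smul_apply, ← h X A hA]
    simp only [qInner, Submodule.coe_smul, smul_mul_assoc, ContinuousLinearMap.toLinearMap_smul,
      map_smul, smul_eq_mul]
    ring

variable {Q : Submodule ℝ (V →L[ℝ] V)} {J J' : Fin 3 → V →L[ℝ] V}

namespace IsAdmissibleBasis

lemma mem (h : IsAdmissibleBasis Q J) (i : Fin 3) : J i ∈ Q := by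
  rw [h.span]; exact Submodule.subset_span ⟨i, rfl⟩

lemma anticomm (h : IsAdmissibleBasis Q J) {i j : Fin 3} (hij : i ≠ j) :
    J i * J j = -(J j * J i) := by
  have h0 := h.sq 0
  have h1 := h.sq 1
  have h2 := h.sq 2
  have h01 := h.mul
  have h10 : J 1 * J 0 = -J 2 := by
    have e : J 0 * (J 2 * J 2) * J 1 = J 0 * J 0 * J 1 * J 0 * (J 1 * J 1) := by
      rw [← h01]; noncomm_ring
    rw [h2, h0, h1] at e
    have e' : -(J 0 * J 1) = J 1 * J 0 := by
      calc -(J 0 * J 1) = J 0 * -1 * J 1 := by noncomm_ring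
        _ = -1 * J 1 * J 0 * -1 := e
        _ = _ := by noncomm_ring
    rw [← e', h01]
  have h02 : J 0 * J 2 = -J 1 := by
    rw [← h01, ← mul_assoc, h0]; noncomm_ring
  have h20 : J 2 * J 0 = J 1 := by
    rw [← h01, mul_assoc, h10, mul_neg, h02, neg_neg]
  have h21 : J 2 * J 1 = -J 0 := by
    rw [← h01, mul_assoc, h1]; noncomm_ring
  have h12 : J 1 * J 2 = J 0 := by
    have : J 1 * J 2 = - (J 1 * (J 1 * J 0)) := by rw [h10]; noncomm_ring
    rw [this, ← mul_assoc, h1]; noncomm_ring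
  fin_cases i <;> fin_cases j <;> simp_all

lemma qInner_self [Nontrivial V] [FiniteDimensional ℝ V] (h : IsAdmissibleBasis Q J) (i : Fin 3) :
    qInner (J i) (J i) = 1 := by
  have : ((-1 : V →L[ℝ] V) : V →ₗ[ℝ] V) = -1 := rfl
  have hne : (Module.finrank ℝ V : ℝ) ≠ 0 := by
    exact_mod_cast (Module.finrank_pos (R := ℝ) (M := V)).ne'
  rw [qInner, h.sq, this, map_neg, LinearMap.trace_one, neg_neg, div_self hne]

lemma _root_.QuatGeom.qInner_comm [FiniteDimensional ℝ V] (A B : V →L[ℝ] V) :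
    qInner A B = qInner B A := by
  unfold qInner
  rw [show ((A * B : V →L[ℝ] V) : V →ₗ[ℝ] V) = (A : V →ₗ[ℝ] V) * (B : V →ₗ[ℝ] V) from rfl,
    LinearMap.trace_mul_comm]; rfl

lemma qInner_ne [FiniteDimensional ℝ V] (h : IsAdmissibleBasis Q J) {i j : Fin 3}
    (hij : i ≠ j) : qInner (J i) (J j) = 0 := by
  have h1 := qInner_comm (J i) (J j)
  have h2 : qInner (J i) (J j) = - qInner (J j) (J i) := by
    unfold qInner
    rw [h.anticomm hij]
    have : ((-(J j * J i) : V →L[ℝ] V) : V →ₗ[ℝ] V) = -((J j * J i : V →L[ℝ] V) : V →ₗ[ℝ] V) := rfl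
    rw [this, map_neg]; ring
  linarith

lemma qInner_eq [Nontrivial V] [FiniteDimensional ℝ V] (h : IsAdmissibleBasis Q J) (i j : Fin 3) :
    qInner (J i) (J j) = if i = j then 1 else 0 := by
  split_ifs with hij
  · subst hij; exact h.qInner_self i
  · exact h.qInner_ne hij

lemma _root_.QuatGeom.qInner_sum_left (c : Fin 3 → ℝ) (J : Fin 3 → V →L[ℝ] V) (B : V →L[ℝ] V) :
    qInner (∑ i, c i • J i) B = ∑ i, c i * qInner (J i) B := by
  simp only [qInner, Fin.sum_univ_three, add_mul, smul_mul_assoc,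
    ContinuousLinearMap.toLinearMap_add, ContinuousLinearMap.toLinearMap_smul, map_add, map_smul,
    smul_eq_mul]
  ring

lemma eq_sum [Nontrivial V] [FiniteDimensional ℝ V] (h : IsAdmissibleBasis Q J)
    {A : V →L[ℝ] V} (hA : A ∈ Q) : A = ∑ i, qInner A (J i) • J i := by
  rw [h.span, Submodule.mem_span_range_iff_exists_fun] at hA
  obtain ⟨c, rfl⟩ := hA
  refine Finset.sum_congr rfl fun i _ => ?_
  rw [qInner_sum_left]
  simp [h.qInner_eq]

/-- The canonical element `∑ᵢ Jᵢ ⊗ Jᵢ` does not depend on the admissible basis. -/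
lemma sum_eq [Nontrivial V] [FiniteDimensional ℝ V] {W : Type*} [AddCommGroup W] [Module ℝ W]
    (h : IsAdmissibleBasis Q J) (h' : IsAdmissibleBasis Q J')
    (b : (V →L[ℝ] V) →ₗ[ℝ] (V →L[ℝ] V) →ₗ[ℝ] W) : ∑ i, b (J i) (J i) = ∑ i, b (J' i) (J' i) := by
  calc ∑ i, b (J i) (J i) = ∑ i, ∑ j, b (J i) (qInner (J i) (J' j) • J' j) := by
        refine Finset.sum_congr rfl fun i _ => ?_
        rw [← map_sum, ← h'.eq_sum (h.mem i)]
    _ = ∑ j, ∑ i, b (qInner (J' j) (J i) • J i) (J' j) := by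
        rw [Finset.sum_comm]
        simp only [map_smul, LinearMap.smul_apply, qInner_comm]
    _ = _ := by
        refine Finset.sum_congr rfl fun j _ => ?_
        rw [← LinearMap.sum_apply, ← map_sum, ← h.eq_sum (h'.mem j)]

/-- `S^a_X` does not depend on the admissible basis. -/
lemma sTensor_eq [FiniteDimensional ℝ V] (h : IsAdmissibleBasis Q J) (h' : IsAdmissibleBasis Q J')
    (a : V →L[ℝ] ℝ) (X : V) : sTensor J a X = sTensor J' a X := by
  cases subsingleton_or_nontrivial V with
  | inl _ => ext Z; exact Subsingleton.elim _ _
  | inr _ =>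
    ext Z
    have key := h.sum_eq h' (LinearMap.mk₂ ℝ
      (fun A B : V →L[ℝ] V => a (A X) • B Z + a (A Z) • B X)
      (fun A A' B => by simp only [add_apply, map_add]; module)
      (fun c A B => by
        simp only [smul_apply, map_smul, smul_eq_mul]; module)
      (fun A B B' => by simp only [add_apply]; module)
      (fun c A B => by simp only [smul_apply]; module))
    simp only [LinearMap.mk₂_apply] at key
    simpa [sTensor] using key

/-- The element `X ↦ ∑ᵢ β(Jᵢ X) Jᵢ` of `V* ⊗ Q`. -/
def embed (h : IsAdmissibleBasis Q J) (β : Module.Dual ℝ V) : V →ₗ[ℝ] Q where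
  toFun X := ∑ i, β (J i X) • ⟨J i, h.mem i⟩
  map_add' X Y := by simp only [map_add, add_smul, Finset.sum_add_distrib]
  map_smul' c X := by
    simp only [map_smul, smul_eq_mul, mul_smul, Finset.smul_sum, RingHom.id_apply]

lemma coe_embed (h : IsAdmissibleBasis Q J) (β : Module.Dual ℝ V) (X : V) :
    (h.embed β X : V →L[ℝ] V) = ∑ i, β (J i X) • J i := by
  simp [embed]

lemma contraction_embed [FiniteDimensional ℝ V] (h : IsAdmissibleBasis Q J)
    (β : Module.Dual ℝ V) : contraction Q (h.embed β) = (-3 : ℝ) • β := by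
  ext X
  have e : evalAt Q X ∘ₗ h.embed β =
      ∑ i, (β ∘ₗ (J i : V →ₗ[ℝ] V)).smulRight (J i X) := by
    ext Z
    simp [evalAt, coe_embed]
  have hs : ∀ i, J i (J i X) = -X := fun i => by
    have := congrArg (fun T : V →L[ℝ] V => T X) (h.sq i)
    simpa using this
  change LinearMap.trace ℝ V (evalAt Q X ∘ₗ h.embed β) = _
  rw [e, map_sum]
  simp only [LinearMap.trace_smulRight, LinearMap.comp_apply, ContinuousLinearMap.coe_coe, hs,
    map_neg, Fin.sum_univ_three, LinearMap.smul_apply, smul_eq_mul]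
  ring

lemma mem_partEH_iff [Nontrivial V] [FiniteDimensional ℝ V] (h : IsAdmissibleBasis Q J)
    (γ : V →ₗ[ℝ] Q) : γ ∈ partEH Q ↔ ∃ β, γ = h.embed β := by
  constructor
  · rintro ⟨β, hβ⟩
    refine ⟨β, LinearMap.ext fun X => Subtype.ext ?_⟩
    rw [coe_embed, h.eq_sum (γ X).2]
    exact Finset.sum_congr rfl fun i _ => by rw [hβ X _ (h.mem i)]
  · rintro ⟨β, rfl⟩
    refine ⟨β, fun X A hA => ?_⟩
    rw [coe_embed, qInner_sum_left]
    conv_rhs => rw [h.eq_sum hA]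
    simp [qInner_comm A, mul_comm]

/-- The decomposition `V* ⊗ Q = (E* ⊗ S³H) ⊕ (E* ⊗ H)`. -/
lemma isCompl [FiniteDimensional ℝ V] (h : IsAdmissibleBasis Q J) :
    IsCompl (partES3 Q) (partEH Q) := by
  cases subsingleton_or_nontrivial V with
  | inl _ =>
    have : Subsingleton (V →ₗ[ℝ] Q) := ⟨fun a b => LinearMap.ext fun X => by
      rw [Subsingleton.elim X 0, map_zero, map_zero]⟩
    refine ⟨Submodule.disjoint_def.2 fun γ _ _ => Subsingleton.elim _ _,
      codisjoint_iff.2 (Subsingleton.elim _ _)⟩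
  | inr _ =>
    refine ⟨Submodule.disjoint_def.2 fun γ h1 h2 => ?_, codisjoint_iff.2 (eq_top_iff.2 ?_)⟩
    · obtain ⟨β, rfl⟩ := (h.mem_partEH_iff γ).1 h2
      have h3 : contraction Q (h.embed β) = 0 := h1
      rw [h.contraction_embed] at h3
      have hβ : β = 0 := by simpa using h3
      ext X : 1
      exact Subtype.ext (by rw [coe_embed]; simp [hβ])
    · intro γ _
      let β : Module.Dual ℝ V := (-(1 / 3) : ℝ) • contraction Q γ
      refine Submodule.mem_sup.2 ⟨γ + h.embed (-β), ?_, h.embed β,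
        (h.mem_partEH_iff _).2 ⟨β, rfl⟩, ?_⟩
      · change contraction Q (γ + h.embed (-β)) = 0
        rw [map_add, h.contraction_embed, smul_neg, smul_smul]
        norm_num
      · ext X : 1
        exact Subtype.ext (by simp [coe_embed])

end IsAdmissibleBasis

/-- The projection of `V* ⊗ Q` onto `E* ⊗ S³H` along `E* ⊗ H`. -/
def projES3 [FiniteDimensional ℝ V] (h : ∃ J, IsAdmissibleBasis Q J) :
    (V →ₗ[ℝ] Q) →ₗ[ℝ] partES3 Q :=
  Submodule.projectionOnto (E := V →ₗ[ℝ] Q) (partES3 Q) (partEH Q) h.choose_spec.isCompl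

end LinearAlgebra

section Manifold

variable {E : Type*} [NormedAddCommGroup E] [NormedSpace ℝ E] [FiniteDimensional ℝ E]
  {H : Type*} [TopologicalSpace H] {I : ModelWithCorners ℝ E H}
  {M : Type*} [TopologicalSpace M] [ChartedSpace H M]

instance (x : M) : FiniteDimensional ℝ (TangentSpace I x) :=
  inferInstanceAs (FiniteDimensional ℝ E)

variable [IsManifold I ∞ M]

variable (I M) in
/-- Smooth sections of `End(TM)`. -/
abbrev EndField : Type _ :=
  ContMDiffSection I (E →L[ℝ] E) ∞ (fun x : M => TangentSpace I x →L[ℝ] TangentSpace I x)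

variable (I M) in
/-- Smooth real-valued `1`-forms. -/
abbrev OneForm : Type _ :=
  ContMDiffSection I (E →L[ℝ] ℝ) ∞ (fun x : M => TangentSpace I x →L[ℝ] Bundle.Trivial M ℝ x)

variable (I M) in
/-- Linear connections on `M`; for a connection `D`, a vector field `Y` and `X ∈ T_x M`, the vector
`D_X Y` is `D Y x X`. -/
abbrev Connection : Type _ := CovariantDerivative I E (TangentSpace I : M → Type _)

variable (I M) in
/-- An almost quaternionic structure on `M`: a subbundle of `End(TM)` that is locally generated by
three smooth almost complex structures satisfying the quaternionic relations. -/
structure AlmostQuaternionicStructure where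
  fiber (x : M) : Submodule ℝ (TangentSpace I x →L[ℝ] TangentSpace I x)
  exists_frame (p : M) : ∃ U ∈ 𝓝 p,
    ∃ J : Fin 3 → (x : M) → (TangentSpace I x →L[ℝ] TangentSpace I x),
      (∀ i, ContMDiffOn I (I.prod 𝓘(ℝ, E →L[ℝ] E)) ∞
        (fun x => TotalSpace.mk' (E →L[ℝ] E)
          (E := fun x : M => TangentSpace I x →L[ℝ] TangentSpace I x) x (J i x)) U) ∧
      ∀ x ∈ U, IsAdmissibleBasis (fiber x) (fun i => J i x)

theorem EndField.mdifferentiableAt_apply (A : EndField I M) {x : M}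
    {σ : (x : M) → TangentSpace I x} (hσ : MDiffAt (T% σ) x) :
    MDiffAt (T% (fun y => A y (σ y))) x :=
  MDifferentiableAt.clm_bundle_apply (F₁ := E) (F₂ := E)
    (A.contMDiff.contMDiffAt.mdifferentiableAt (by simp)) hσ

theorem OneForm.mdifferentiableAt_apply (α : OneForm I M) {x : M}
    {σ : (x : M) → TangentSpace I x} (hσ : MDiffAt (T% σ) x) :
    MDifferentiableAt I 𝓘(ℝ, ℝ) (fun y => (α y (σ y) : ℝ)) x := by
  have h : MDifferentiableAt I (I.prod 𝓘(ℝ, ℝ))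
      (fun y => TotalSpace.mk' ℝ (E := Bundle.Trivial M ℝ) y (α y (σ y))) x :=
    MDifferentiableAt.clm_bundle_apply (F₁ := E) (F₂ := ℝ)
      (α.contMDiff.contMDiffAt.mdifferentiableAt (by simp)) hσ
  exact (mdifferentiableAt_totalSpace _ _).1 h |>.2

namespace Connection

variable (D : Connection I M)

theorem tensorial_end (A : EndField I M) (x : M) (X : TangentSpace I x) :
    TensorialAt I E (fun σ : (x : M) → TangentSpace I x =>
      D (fun y => A y (σ y)) x X - A x (D σ x X)) x where
  smul {f σ} hf hσ := by
    have e : (fun y => A y ((f • σ) y)) = f • fun y => A y (σ y) := by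
      funext y; simp
    rw [e, D.isCovariantDerivativeOn.leibniz (A.mdifferentiableAt_apply hσ) hf,
      D.isCovariantDerivativeOn.leibniz hσ hf]
    simp
    module
  add {σ σ'} hσ hσ' := by
    have e : (fun y => A y ((σ + σ') y)) = (fun y => A y (σ y)) + fun y => A y (σ' y) := by
      funext y; simp
    rw [e, D.isCovariantDerivativeOn.add (A.mdifferentiableAt_apply hσ)
      (A.mdifferentiableAt_apply hσ'), D.isCovariantDerivativeOn.add hσ hσ']
    simp
    module

/-- The induced connection on `End(TM)`: `(D_X A)(Y) = D_X (A Y) - A (D_X Y)`. -/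
def onEnd (A : EndField I M) (x : M) :
    TangentSpace I x →ₗ[ℝ] (TangentSpace I x →L[ℝ] TangentSpace I x) where
  toFun X := TensorialAt.mkHom _ x (D.tensorial_end A x X)
  map_add' X X' := by
    ext Y
    simp only [TensorialAt.mkHom_apply_eq_extend, map_add, add_apply]
    abel
  map_smul' c X := by
    ext Y
    simp only [TensorialAt.mkHom_apply_eq_extend, map_smul, smul_apply, RingHom.id_apply, smul_sub]

theorem tensorial_form (α : OneForm I M) (x : M) (X : TangentSpace I x) :
    TensorialAt I E (fun σ : (x : M) → TangentSpace I x =>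
      (mvfderiv I (fun y => (α y (σ y) : ℝ)) x X - α x (D σ x X) : ℝ)) x where
  smul {f σ} hf hσ := by
    have e : (fun y => (α y ((f • σ) y) : ℝ)) = fun y => f y * (α y (σ y) : ℝ) := by
      funext y; simp
    rw [e, D.isCovariantDerivativeOn.leibniz hσ hf,
      mvfderiv_fun_mul hf (α.mdifferentiableAt_apply hσ)]
    simp
    ring
  add {σ σ'} hσ hσ' := by
    have e : (fun y => (α y ((σ + σ') y) : ℝ)) = fun y => (α y (σ y) : ℝ) + (α y (σ' y) : ℝ) := by
      funext y; simp
    rw [e, D.isCovariantDerivativeOn.add hσ hσ', mvfderiv_fun_add (α.mdifferentiableAt_apply hσ)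
      (α.mdifferentiableAt_apply hσ')]
    simp
    ring

/-- The induced connection on `T*M`: `(D_X α)(Y) = X (α(Y)) - α (D_X Y)`. -/
def onForm (α : OneForm I M) (x : M) (X : TangentSpace I x) : TangentSpace I x →L[ℝ] ℝ :=
  TensorialAt.mkHom _ x (D.tensorial_form α x X)

/-- The curvature `R_{X,Y} Z = D_X D_Y Z - D_Y D_X Z - D_{[X,Y]} Z` on vector fields. -/
def curvatureField (X Y Z : (x : M) → TangentSpace I x) (x : M) : TangentSpace I x :=
  D (fun y => D Z y (Y y)) x (X x) - D (fun y => D Z y (X y)) x (Y x)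
    - D Z x (VectorField.mlieBracket I X Y x)

/-- The curvature tensor of a smooth connection at a point; it is evaluated on local smooth
extensions of the given tangent vectors, the choice of which is irrelevant by tensoriality. -/
def curvature (x : M) (X Y Z : TangentSpace I x) : TangentSpace I x :=
  D.curvatureField (FiberBundle.extend E X) (FiberBundle.extend E Y) (FiberBundle.extend E Z) x

end Connection

section Quaternionic

namespace AlmostQuaternionicStructure

variable (Q : AlmostQuaternionicStructure I M)

theorem exists_admissible (x : M) : ∃ J, IsAdmissibleBasis (Q.fiber x) J := by
  obtain ⟨U, hU, J, -, hJ⟩ := Q.exists_frame x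
  exact ⟨_, hJ x (mem_of_mem_nhds hU)⟩

/-- An admissible basis of `Q` at the point `x`. -/
def basisAt (x : M) : Fin 3 → TangentSpace I x →L[ℝ] TangentSpace I x :=
  (Q.exists_admissible x).choose

theorem basisAt_spec (x : M) : IsAdmissibleBasis (Q.fiber x) (Q.basisAt x) :=
  (Q.exists_admissible x).choose_spec

/-- The tensor `S^a_X` of the almost quaternionic structure at the point `x`. -/
def S (x : M) (a : TangentSpace I x →L[ℝ] ℝ) (X : TangentSpace I x) :
    TangentSpace I x →L[ℝ] TangentSpace I x :=
  sTensor (Q.basisAt x) a X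

theorem S_eq {x : M} {J : Fin 3 → TangentSpace I x →L[ℝ] TangentSpace I x}
    (hJ : IsAdmissibleBasis (Q.fiber x) J) (a : TangentSpace I x →L[ℝ] ℝ) (X : TangentSpace I x) :
    Q.S x a X = sTensor J a X :=
  (Q.basisAt_spec x).sTensor_eq hJ a X

/-- The space `Γ(Q)` of smooth sections of `Q`. -/
def Sections : Type _ := {A : EndField I M // ∀ x, A x ∈ Q.fiber x}

/-- `D` is a quaternionic connection: smooth, torsion-free and preserving `Q`. -/
structure IsQuaternionicConnection (D : Connection I M) : Prop where
  smooth : CovariantDerivative.ContMDiffCovariantDerivative D ∞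
  torsionFree : D.torsion = 0
  preserves : ∀ A : Q.Sections, ∀ x X, D.onEnd A.1 x X ∈ Q.fiber x

variable {Q} in
/-- The connection `D : Γ(Q) → Γ(T*M ⊗ Q)` induced by a quaternionic connection. -/
def IsQuaternionicConnection.onQ {D : Connection I M} (hD : Q.IsQuaternionicConnection D)
    (A : Q.Sections) (x : M) : TangentSpace I x →ₗ[ℝ] Q.fiber x :=
  (D.onEnd A.1 x).codRestrict (Q.fiber x) (hD.preserves A x)

variable {Q} in
/-- The Penrose operator `P^D : Γ(Q) → Γ(E* ⊗ S³H)`: the composition of `D : Γ(Q) → Γ(T*M ⊗ Q)` with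
the projection onto the first summand of `T*M ⊗ Q = (E* ⊗ S³H) ⊕ (E* ⊗ H)`. -/
def IsQuaternionicConnection.penrose {D : Connection I M} (hD : Q.IsQuaternionicConnection D)
    (A : Q.Sections) (x : M) : partES3 (Q.fiber x) :=
  projES3 (Q.exists_admissible x) (hD.onQ A x)

/-- The relation `D' = D + S^α`, that is `D'_X Y = D_X Y + S^α_X Y`. -/
def IsShift (D' D : Connection I M) (α : OneForm I M) : Prop :=
  ∀ (x : M) (Y : (x : M) → TangentSpace I x), MDiffAt (T% Y) x →
    ∀ X : TangentSpace I x, D' Y x X = D Y x X + Q.S x (α x) X (Y x)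

end AlmostQuaternionicStructure

end Quaternionic

section Riemannian

variable [RiemannianBundle (fun x : M => TangentSpace I x)]
  [IsContMDiffRiemannianBundle I ∞ E (fun x : M => TangentSpace I x)]

/-- `D` is the Levi-Civita connection of the Riemannian metric of `M`: it is torsion-free, and
`X ⟨Y, Z⟩ = ⟨D_X Y, Z⟩ + ⟨Y, D_X Z⟩` for all differentiable vector fields `Y`, `Z`. -/
structure Connection.IsLeviCivita (D : Connection I M) : Prop where
  torsionFree : D.torsion = 0
  metric : ∀ (x : M) (Y Z : (x : M) → TangentSpace I x), MDiffAt (T% Y) x → MDiffAt (T% Z) x →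
    ∀ X : TangentSpace I x, mvfderiv I (fun y => inner ℝ (Y y) (Z y)) x X =
      inner ℝ (D Y x X) (Z x) + inner ℝ (Y x) (D Z x X)

/-- The Ricci tensor `Ricci(X, Y) = tr (Z ↦ R_{Z,X} Y)` of a connection, the trace being computed in
an orthonormal basis. -/
def Connection.ricci (D : Connection I M) (x : M) (X Y : TangentSpace I x) : ℝ :=
  ∑ i, inner ℝ (D.curvature x (stdOrthonormalBasis ℝ (TangentSpace I x) i) X Y)
    (stdOrthonormalBasis ℝ (TangentSpace I x) i)

/-- The scalar curvature: the metric trace of the Ricci tensor. -/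
def Connection.scal (D : Connection I M) (x : M) : ℝ :=
  ∑ i, D.ricci x (stdOrthonormalBasis ℝ (TangentSpace I x) i)
    (stdOrthonormalBasis ℝ (TangentSpace I x) i)

/-- The codifferential `δα = - ∑ᵢ (D_{eᵢ} α)(eᵢ)` with respect to the Levi-Civita connection `D`. -/
def Connection.codifferential (D : Connection I M) (α : OneForm I M) (x : M) : ℝ :=
  -∑ i, D.onForm α x (stdOrthonormalBasis ℝ (TangentSpace I x) i)
    (stdOrthonormalBasis ℝ (TangentSpace I x) i)

/-- The Riemannian metric of `M`, with Levi-Civita connection `D`, is a quaternionic-Kähler metric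
compatible with `Q`: `D` is a quaternionic connection and the endomorphisms in `Q` are
skew-symmetric. -/
structure AlmostQuaternionicStructure.IsQuaternionicKahler (Q : AlmostQuaternionicStructure I M)
    (D : Connection I M) : Prop where
  leviCivita : D.IsLeviCivita
  quaternionic : Q.IsQuaternionicConnection D
  skew : ∀ x, ∀ A ∈ Q.fiber x, ∀ X Y : TangentSpace I x, inner ℝ (A X) Y = -inner ℝ X (A Y)

end Riemannian

end Manifold
end QuatGeom

end

open QuatGeom

/-! Vanishing of the Penrose operator of `D = D^g + S^α` on `A` is a twistor equation for `D^g`.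
Since `[S^α_X, A] = -2α(X)A - 2 ∑ α(A Jᵢ X) Jᵢ`, it reads `D^g A = 2α ⊗ A + ∑ (β ∘ Jᵢ) ⊗ Jᵢ` for
some 1-form `β` (`exists_onEnd_eq`). The proof is a Bochner argument for `f = |A|²`, followed by the
strong maximum principle.

Write `N = 4n`. Pairing the equation with `A` gives `df = 4fα + 2β ∘ A`, and `A² = -f` gives `|β ∘
A|² = f|β|²`, so `|β|²` is expressed through `f`, `df` and `α`. The trace of the Hessian of `f` also
contains `W = ∑ ((∇_{eᵢ}β)(A eᵢ) - 2α(eᵢ)β(A eᵢ))`. The Ricci identity for `A` controls `W`: the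
failure of `B(u,w) = (∇_uβ)(w) - 2α(u)β(w)` to be symmetric, after composition with `J_k`, is a
component of `[R, A]` plus a multiple of `dα`. In the traces over `Y = J_l X` the `dα` terms cancel
cyclically, and `(N + 8) W = -2 Scal f` remains (`IsQuaternionicCurvature.sum_apply`). The input is
`(N + 8)⟨R(X,Y), Jᵢ⟩ = 2 Ric(X, Jᵢ Y)` (`qInner_eq_ricciForm`), whose proof divides by `N - 4`, so
`n ≥ 2` enters there. Only the symmetry of `Ric` is needed, not the Einstein property.

For co-closed `α` the result (`IsTwistorOn.bochner`), with `Δ` the trace of the Hessian, is `f (Δf +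
4⟨α, df⟩) = 8|α|² f² + (3/2)|df|² - 4 Scal f² / (N + 8)`. If `Scal ≤ 0`, then `Δf + 4⟨α, df⟩ ≥ 0`
wherever `f > 0`. A positive maximum of `f` is therefore attained on an open set
(`eventually_eq_of_subsolution`), which is also closed, so `f` is constant. The formula then becomes
`Scal = 2(N + 8)|α|²`, which is impossible if `Scal < 0`, or if `Scal = 0` and `α` is nonzero
somewhere.

The calculus is done in charts: a connection becomes Christoffel symbols `Γ` on an open subset of
`E`, and `covEnd` is the induced derivative of endomorphism fields. -/

noncomputable section
namespace QuatGeom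
set_option linter.unusedSectionVars false

/-! ### Coordinates on tangent spaces -/

section Chart

variable {E : Type*} [NormedAddCommGroup E] [NormedSpace ℝ E] [FiniteDimensional ℝ E]
  {H : Type*} [TopologicalSpace H] {I : ModelWithCorners ℝ E H}
  {M : Type*} [TopologicalSpace M] [ChartedSpace H M] [IsManifold I ∞ M]

variable (I) in
/-- The coordinate expression `T_y M → E` of a tangent vector in the chart at `p`. -/
def toCoord (p y : M) : TangentSpace I y →L[ℝ] E :=
  (trivializationAt E (TangentSpace I) p).continuousLinearMapAt ℝ y

variable (I) in
/-- The inverse of `toCoord`. -/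
def ofCoord (p y : M) : E →L[ℝ] TangentSpace I y :=
  (trivializationAt E (TangentSpace I) p).symmL ℝ y

variable (I) in
/-- The vector field with constant coordinates `w` in the chart at `p`. -/
def coordField (p : M) (w : E) (y : M) : TangentSpace I y := ofCoord I p y w

variable (I) in
/-- The point with coordinates `x` in the chart at `p`. -/
def chartPt (p : M) (x : E) : M := (extChartAt I p).symm x

/-- The coordinate expression of a vector field in the chart at `p`. -/
def coordRep (p : M) (Y : (y : M) → TangentSpace I y) (x : E) : E :=
  toCoord I p (chartPt I p x) (Y (chartPt I p x))

variable {p y : M}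

lemma mem_baseSet_of_mem_source (hy : y ∈ (extChartAt I p).source) :
    y ∈ (trivializationAt E (TangentSpace I) p).baseSet := by
  simpa using hy

lemma toCoord_ofCoord (hy : y ∈ (extChartAt I p).source) (w : E) :
    toCoord I p y (ofCoord I p y w) = w :=
  (trivializationAt E (TangentSpace I) p).continuousLinearMapAt_symmL
    (mem_baseSet_of_mem_source hy) w

lemma ofCoord_toCoord (hy : y ∈ (extChartAt I p).source) (X : TangentSpace I y) :
    ofCoord I p y (toCoord I p y X) = X :=
  (trivializationAt E (TangentSpace I) p).symmL_continuousLinearMapAt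
    (mem_baseSet_of_mem_source hy) X

lemma chartPt_mem_source {x : E} (hx : x ∈ (extChartAt I p).target) :
    chartPt I p x ∈ (extChartAt I p).source :=
  (extChartAt I p).map_target hx

lemma contMDiffAt_coordField (hy : y ∈ (extChartAt I p).source) (w : E) :
    CMDiffAt ∞ (T% (coordField I p w)) y := by
  have hb := mem_baseSet_of_mem_source hy
  rw [(trivializationAt E (TangentSpace I) p).contMDiffAt_section_iff hb]
  refine (contMDiffAt_const (c := w)).congr_of_eventuallyEq ?_
  filter_upwards [(trivializationAt E (TangentSpace I) p).open_baseSet.mem_nhds hb] with z hz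
  have h := (trivializationAt E (TangentSpace I) p).continuousLinearMapAt_symmL (R := ℝ) hz w
  rwa [Trivialization.continuousLinearMapAt_apply, Trivialization.linearMapAt_apply,
    if_pos hz] at h

lemma mdifferentiableAt_coordField (hy : y ∈ (extChartAt I p).source) (w : E) :
    MDiffAt (T% (coordField I p w)) y :=
  (contMDiffAt_coordField hy w).mdifferentiableAt (by simp)

section

lemma toCoord_eq_mfderiv (hy : y ∈ (extChartAt I p).source) :
    toCoord I p y = mfderiv I 𝓘(ℝ, E) (extChartAt I p) y := by
  have : IsManifold I 1 M := .of_le (n := ∞) (by simp)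
  exact TangentBundle.continuousLinearMapAt_trivializationAt (by simpa using hy)

end

end Chart

/-! ### Connections, curvature and forms in a chart -/

section BoundarylessChart
variable {E : Type*} [NormedAddCommGroup E] [NormedSpace ℝ E] [FiniteDimensional ℝ E]
  {H : Type*} [TopologicalSpace H] {I : ModelWithCorners ℝ E H} [I.Boundaryless]
  {M : Type*} [TopologicalSpace M] [ChartedSpace H M] [IsManifold I ∞ M]
variable {p : M} {x : E}

lemma contMDiffAt_chartPt (hx : x ∈ (extChartAt I p).target) :
    ContMDiffAt 𝓘(ℝ, E) I ∞ (chartPt I p) x :=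
  (contMDiffOn_extChartAt_symm p).contMDiffAt ((isOpen_extChartAt_target p).mem_nhds hx)

variable {F : Type*} [NormedAddCommGroup F] [NormedSpace ℝ F]

lemma contDiffAt_comp_chartPt {f : M → F} {k : ℕ∞ω} (hk : k ≤ ∞)
    (hx : x ∈ (extChartAt I p).target)
    (hf : ContMDiffAt I 𝓘(ℝ, F) k f (chartPt I p x)) :
    ContDiffAt ℝ k (fun x => f (chartPt I p x)) x := by
  rw [← contMDiffAt_iff_contDiffAt]
  exact ContMDiffAt.comp x (I' := I) hf ((contMDiffAt_chartPt hx).of_le hk)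

lemma ofCoord_eq_mfderiv (hx : x ∈ (extChartAt I p).target) :
    ofCoord I p (chartPt I p x) = mfderiv 𝓘(ℝ, E) I (chartPt I p) x := by
  have : IsManifold I 1 M := .of_le (n := ∞) (by simp)
  have h4 := TangentBundle.symmL_trivializationAt (I := I) (x₀ := p)
    (x := chartPt I p x) (by simpa using chartPt_mem_source hx)
  unfold ofCoord
  have h5 : (extChartAt I p) (chartPt I p x) = x := (extChartAt I p).right_inv hx
  rw [h4, h5, I.range_eq_univ, mfderivWithin_univ]
  rfl

lemma hasFDerivAt_comp_chartPt {f : M → F} (hx : x ∈ (extChartAt I p).target)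
    (hf : MDifferentiableAt I 𝓘(ℝ, F) f (chartPt I p x)) :
    HasFDerivAt (fun x => f (chartPt I p x))
      (mvfderiv I f (chartPt I p x) ∘L ofCoord I p (chartPt I p x)) x := by
  have h1 := ((contMDiffAt_chartPt hx).mdifferentiableAt (by simp)).hasMFDerivAt
  rw [ofCoord_eq_mfderiv hx]
  exact (hf.hasMFDerivAt.comp _ h1).hasFDerivAt

lemma mvfderiv_eq_fderiv {f : M → F} (hx : x ∈ (extChartAt I p).target)
    (hf : MDifferentiableAt I 𝓘(ℝ, F) f (chartPt I p x))
    (X : TangentSpace I (chartPt I p x)) :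
    mvfderiv I f (chartPt I p x) X =
      fderiv ℝ (fun x => f (chartPt I p x)) x (toCoord I p _ X) := by
  rw [(hasFDerivAt_comp_chartPt hx hf).fderiv, ContinuousLinearMap.comp_apply,
    ofCoord_toCoord (chartPt_mem_source hx)]

lemma contMDiffAt_toCoord {y : M} {Y : (y : M) → TangentSpace I y} {k : ℕ∞ω} (hk : k ≤ ∞)
    (hy : y ∈ (extChartAt I p).source) (hY : CMDiffAt k (T% Y) y) :
    ContMDiffAt I 𝓘(ℝ, E) k (fun y => toCoord I p y (Y y)) y := by
  have hb := mem_baseSet_of_mem_source hy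
  have : ContMDiffVectorBundle k E (TangentSpace I : M → Type _) I := .of_le hk
  rw [(trivializationAt E (TangentSpace I) p).contMDiffAt_section_iff hb] at hY
  refine hY.congr_of_eventuallyEq ?_
  filter_upwards [(trivializationAt E (TangentSpace I) p).open_baseSet.mem_nhds hb] with z hz
  rw [toCoord, Trivialization.continuousLinearMapAt_apply, Trivialization.linearMapAt_apply,
    if_pos hz]

lemma mdifferentiableAt_toCoord {y : M} {Y : (y : M) → TangentSpace I y}
    (hy : y ∈ (extChartAt I p).source) (hY : MDiffAt (T% Y) y) :
    MDifferentiableAt I 𝓘(ℝ, E) (fun y => toCoord I p y (Y y)) y := by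
  have hb := mem_baseSet_of_mem_source hy
  have : ContMDiffVectorBundle 1 E (TangentSpace I : M → Type _) I := .of_le (n := ∞) (by simp)
  rw [(trivializationAt E (TangentSpace I) p).mdifferentiableAt_section_iff I Y hb] at hY
  refine hY.congr_of_eventuallyEq ?_
  filter_upwards [(trivializationAt E (TangentSpace I) p).open_baseSet.mem_nhds hb] with z hz
  rw [toCoord, Trivialization.continuousLinearMapAt_apply, Trivialization.linearMapAt_apply,
    if_pos hz]

lemma contDiffAt_coordRep {Y : (y : M) → TangentSpace I y} {k : ℕ∞ω} (hk : k ≤ ∞)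
    (hx : x ∈ (extChartAt I p).target) (hY : CMDiffAt k (T% Y) (chartPt I p x)) :
    ContDiffAt ℝ k (coordRep p Y) x :=
  contDiffAt_comp_chartPt hk hx
    (contMDiffAt_toCoord hk (chartPt_mem_source hx) hY)

/-- The Christoffel symbols of a connection in the chart at `p`. -/
def christoffel (D : Connection I M) (p : M) (x : E) : E →L[ℝ] E →L[ℝ] E :=
  ∑ j, (ContinuousLinearMap.smulRightL ℝ E E
      ((Module.finBasis ℝ E).coord j).toContinuousLinearMap).comp
    (toCoord I p (chartPt I p x) ∘L
      D (coordField I p (Module.finBasis ℝ E j)) (chartPt I p x) ∘L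
      ofCoord I p (chartPt I p x))

lemma Connection.sum (D : Connection I M) {y : M} {ι : Type*} {s : Finset ι}
    {Y : ι → (y : M) → TangentSpace I y} (hY : ∀ i ∈ s, MDiffAt (T% (Y i)) y) :
    D (fun z => ∑ i ∈ s, Y i z) y = ∑ i ∈ s, D (Y i) y := by
  classical
  induction s using Finset.induction_on with
  | empty => exact D.isCovariantDerivativeOn.zero (s := Set.univ) (x := y)
  | insert a s ha h =>
    simp only [Finset.mem_insert, forall_eq_or_imp] at hY
    simp only [Finset.sum_insert ha, ← h hY.2]
    exact D.isCovariantDerivativeOn.add hY.1 (.sum_section hY.2)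

/-- A connection in coordinates: `D_X Y = dY(X) + Γ(X, Y)`. -/
lemma toCoord_connection (D : Connection I M) (hx : x ∈ (extChartAt I p).target)
    {Y : (y : M) → TangentSpace I y} (hY : MDiffAt (T% Y) (chartPt I p x))
    (X : TangentSpace I (chartPt I p x)) :
    toCoord I p _ (D Y _ X) =
      fderiv ℝ (coordRep p Y) x (toCoord I p _ X)
        + christoffel D p x (toCoord I p _ X) (coordRep p Y x) := by
  have hy := chartPt_mem_source hx
  let b := Module.finBasis ℝ E
  let c (j : Fin (Module.finrank ℝ E)) (z : M) : ℝ := b.coord j (toCoord I p z (Y z))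
  have hY' := mdifferentiableAt_toCoord hy hY
  have hc (j) : MDifferentiableAt I 𝓘(ℝ, ℝ) (c j) (chartPt I p x) :=
    (b.coord j).toContinuousLinearMap.mdifferentiableAt.comp _ hY'
  have hcs (j) : MDiffAt (T% (c j • coordField I p (b j))) (chartPt I p x) :=
    (hc j).smul_section (mdifferentiableAt_coordField hy _)
  -- Near the point `Y` is a combination of coordinate fields with function coefficients; locality,
  -- additivity and the Leibniz rule then give both terms.
  have e1 : D Y (chartPt I p x) =
      D (fun z => ∑ j, (c j • coordField I p (b j)) z) (chartPt I p x) := by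
    refine D.isCovariantDerivativeOn.congr_of_eventuallyEq (s := Set.univ) hY
      (.sum_section fun j _ => hcs j) Filter.univ_mem ?_
    filter_upwards [extChartAt_source_mem_nhds' hy] with z hz
    calc Y z = ofCoord I p z (∑ j, c j z • b j) := by
          simp only [c, Module.Basis.coord_apply, b.sum_repr]
          rw [ofCoord_toCoord hz]
      _ = _ := by simp [coordField]
  have e2 : D (fun z => ∑ j, (c j • coordField I p (b j)) z) (chartPt I p x) =
      ∑ j, D (c j • coordField I p (b j)) (chartPt I p x) :=
    Connection.sum D fun j _ => hcs j
  have e3 (j) : D (c j • coordField I p (b j)) (chartPt I p x) X =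
      c j (chartPt I p x) • D (coordField I p (b j)) (chartPt I p x) X +
        (mvfderiv I (c j) (chartPt I p x) X) • coordField I p (b j) (chartPt I p x) := by
    rw [D.isCovariantDerivativeOn.leibniz (mdifferentiableAt_coordField hy _) (hc j)]
    simp
  have hd := hasFDerivAt_comp_chartPt hx hY'
  have e4 (j) : mvfderiv I (c j) (chartPt I p x) X =
      b.coord j (fderiv ℝ (coordRep p Y) x (toCoord I p _ X)) := by
    rw [mvfderiv_eq_fderiv hx (hc j) X]
    have h := ((b.coord j).toContinuousLinearMap.hasFDerivAt.comp x hd).fderiv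
    change fderiv ℝ ((b.coord j).toContinuousLinearMap ∘ coordRep p Y) x _ = _
    have h' : fderiv ℝ (coordRep p Y) x = _ := hd.fderiv
    rw [h']
    exact congrArg (fun T : E →L[ℝ] ℝ => T (toCoord I p _ X)) h
  have e5 : (∑ j, D (c j • coordField I p (b j)) (chartPt I p x)) X =
      ∑ j, D (c j • coordField I p (b j)) (chartPt I p x) X :=
    sum_apply _ _ _
  rw [e1, e2, e5, map_sum]
  simp only [e3, map_add, map_smul, e4, Finset.sum_add_distrib]
  rw [add_comm]
  congr 1
  · simp only [coordField, toCoord_ofCoord hy, Module.Basis.coord_apply, b.sum_repr]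
  · simp [christoffel, c, coordRep, ofCoord_toCoord hy, b]

lemma coordRep_coordField_eventuallyEq (hx : x ∈ (extChartAt I p).target) (w : E) :
    coordRep p (coordField I p w) =ᶠ[𝓝 x] fun _ => w := by
  filter_upwards [(isOpen_extChartAt_target p).mem_nhds hx] with z hz
  exact toCoord_ofCoord (chartPt_mem_source hz) w

lemma christoffel_apply (D : Connection I M) (hx : x ∈ (extChartAt I p).target) (u v : E) :
    christoffel D p x u v =
      toCoord I p _ (D (coordField I p v) (chartPt I p x) (ofCoord I p _ u)) := by
  have h := coordRep_coordField_eventuallyEq (I := I) hx v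
  rw [toCoord_connection D hx (mdifferentiableAt_coordField (chartPt_mem_source hx) v),
    h.fderiv_eq, h.eq_of_nhds, toCoord_ofCoord (chartPt_mem_source hx)]
  simp

section

variable [T2Space M]

/-- In finite dimensions an operator-valued map is a finite combination of its values on a basis, so
smoothness can be tested on fixed vectors. -/
lemma contDiffAt_clm_of_apply {E' F G : Type*} [NormedAddCommGroup E'] [NormedSpace ℝ E']
    [NormedAddCommGroup F] [NormedSpace ℝ F] [NormedAddCommGroup G] [NormedSpace ℝ G]
    [FiniteDimensional ℝ F] {k : ℕ∞ω} {f : E' → F →L[ℝ] G} {x : E'}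
    (h : ∀ v, ContDiffAt ℝ k (fun x => f x v) x) : ContDiffAt ℝ k f x := by
  simp only [← contDiffWithinAt_univ] at h ⊢
  let b := Module.finBasis ℝ F
  have e : f = fun x => ∑ j, ContinuousLinearMap.smulRightL ℝ F G
      (b.coord j).toContinuousLinearMap (f x (b j)) := by
    ext x v
    have h' : f x v = ∑ j, b.repr v j • f x (b j) := by
      conv_lhs => rw [← b.sum_repr v, map_sum]
      simp only [map_smul]
    simp [h']
  rw [e]
  exact ContDiffWithinAt.sum fun j _ => (ContinuousLinearMap.contDiff _).comp_contDiffWithinAt (h _)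

/-- A section that is smooth near a point agrees near that point with a global smooth section. -/
lemma exists_section_eventuallyEq {F : Type*} [NormedAddCommGroup F] [NormedSpace ℝ F]
    {V : M → Type*} [TopologicalSpace (TotalSpace F V)]
    [∀ x, AddCommGroup (V x)] [∀ x, Module ℝ (V x)] [∀ x, TopologicalSpace (V x)]
    [FiberBundle F V] [VectorBundle ℝ F V] {y : M}
    {u : Set M} (hu : u ∈ 𝓝 y) {s : (z : M) → V z} (hs : CMDiff[u] ∞ (T% s)) :
    ∃ ψ : M → ℝ, CMDiff ∞ (T% (ψ • s)) ∧ (∀ᶠ z in 𝓝 y, ψ z = 1) ∧ ∀ z ∉ u, ψ z = 0 := by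
  obtain ⟨ψ, -, hψ⟩ := (SmoothBumpFunction.nhds_basis_tsupport (I := I) y).mem_iff.1
    (interior_mem_nhds.2 hu)
  refine ⟨ψ, ContMDiffOn.smul_section_of_tsupport ψ.contMDiff.contMDiffOn isOpen_interior hψ
    (hs.mono interior_subset), ψ.eventuallyEq_one, fun z hz => ?_⟩
  by_contra h
  exact hz (interior_subset (hψ (subset_tsupport _ h)))

/-- Smoothness of `D` is available for sections that are smooth everywhere, so `Y` is cut off by a
bump function; as `D` is local, `D (ψ Y)` and `D Y` agree near `y`. -/
lemma contMDiffAt_connection {D : Connection I M}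
    (hD : CovariantDerivative.ContMDiffCovariantDerivative D ∞)
    {y : M} {u : Set M} (hu : u ∈ 𝓝 y) {Y : (z : M) → TangentSpace I z} (hY : CMDiff[u] ∞ (T% Y)) :
    ContMDiffAt I (I.prod 𝓘(ℝ, E →L[ℝ] E)) ∞ (fun z => TotalSpace.mk' (E →L[ℝ] E)
      (E := fun z : M => TangentSpace I z →L[ℝ] TangentSpace I z) z (D Y z)) y := by
  obtain ⟨ψ, h1, h2, -⟩ := exists_section_eventuallyEq hu hY
  have h3 := (hD.contMDiff.contMDiff (σ := ψ • Y) (by simpa using h1.contMDiffOn)).contMDiffAt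
    (x := y) Filter.univ_mem
  refine h3.congr_of_eventuallyEq ?_
  filter_upwards [h2.eventually_nhds, eventually_mem_nhds_iff.2 hu] with z hz hzu
  congr 1
  refine D.isCovariantDerivativeOn.congr_of_eventuallyEq (s := Set.univ)
    ((hY.contMDiffAt hzu).mdifferentiableAt (by simp)) (h1.contMDiffAt.mdifferentiableAt (by simp))
    Filter.univ_mem ?_
  filter_upwards [hz] with w hw
  simp [hw]

lemma contMDiffOn_coordField (w : E) :
    CMDiff[(extChartAt I p).source] ∞ (T% (coordField I p w)) :=
  fun _ hy => (contMDiffAt_coordField hy w).contMDiffWithinAt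

lemma contDiffAt_christoffel {D : Connection I M}
    (hD : CovariantDerivative.ContMDiffCovariantDerivative D ∞)
    (hx : x ∈ (extChartAt I p).target) : ContDiffAt ℝ ∞ (christoffel D p) x := by
  refine contDiffAt_clm_of_apply fun u => contDiffAt_clm_of_apply fun v => ?_
  have hy := chartPt_mem_source hx
  have h1 := contMDiffAt_connection hD (extChartAt_source_mem_nhds' hy)
    (contMDiffOn_coordField (I := I) (p := p) v)
  have h2 := h1.clm_bundle_apply (contMDiffAt_coordField hy u)
  refine (contDiffAt_coordRep le_rfl hx h2).congr_of_eventuallyEq ?_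
  filter_upwards [(isOpen_extChartAt_target p).mem_nhds hx] with z hz
  exact christoffel_apply D hz u v

end

/-- The constant vector field on a normed space. -/
def constField (w : E) (x : E) : TangentSpace 𝓘(ℝ, E) x := w

lemma mdifferentiableAt_constField (w x : E) : MDiffAt (T% (constField w)) x :=
  ((contMDiffAt_vectorSpace_iff_contDiffAt (n := 1)).2
    (contDiffAt_const (c := w))).mdifferentiableAt (by simp)

lemma mlieBracket_constField (u v x : E) :
    VectorField.mlieBracket 𝓘(ℝ, E) (constField u) (constField v) x = 0 := by
  rw [← VectorField.mlieBracketWithin_univ, VectorField.mlieBracketWithin_eq_lieBracketWithin]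
  change fderivWithin ℝ (fun _ : E => v) Set.univ x _ - fderivWithin ℝ (fun _ : E => u) Set.univ x _
    = (0 : E)
  have h (w : E) : fderivWithin ℝ (fun _ : E => w) Set.univ x = 0 := by simp
  rw [h, h]
  exact sub_self (0 : E)

lemma coordField_eventuallyEq_mpullback {y : M} (hy : y ∈ (extChartAt I p).source) (w : E) :
    coordField I p w =ᶠ[𝓝 y]
      VectorField.mpullback I 𝓘(ℝ, E) (extChartAt I p) (constField w) := by
  filter_upwards [extChartAt_source_mem_nhds' hy] with z hz
  have h : (mfderiv I 𝓘(ℝ, E) (extChartAt I p) z).inverse = ofCoord I p z := by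
    rw [← toCoord_eq_mfderiv hz]
    exact ContinuousLinearMap.inverse_eq
      (ContinuousLinearMap.ext (toCoord_ofCoord hz) :
        toCoord I p z ∘L ofCoord I p z = ContinuousLinearMap.id ℝ E)
      (ContinuousLinearMap.ext (ofCoord_toCoord hz))
  rw [VectorField.mpullback_apply, h]
  rfl

/-- Coordinate fields are pullbacks of constant fields under the chart, and the bracket is natural
under pullback. -/
lemma mlieBracket_coordField {y : M} (hy : y ∈ (extChartAt I p).source) (u v : E) :
    VectorField.mlieBracket I (coordField I p u) (coordField I p v) y = 0 := by
  have : IsManifold I (minSmoothness ℝ 2) M := .of_le (n := ∞) (by simpa using ENat.LEInfty.out)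
  have : IsManifold I (minSmoothness ℝ 3) M := .of_le (n := ∞) (by simpa using ENat.LEInfty.out)
  rw [(coordField_eventuallyEq_mpullback hy u).mlieBracket_vectorField_eq
    (coordField_eventuallyEq_mpullback hy v)]
  rw [← VectorField.mpullback_mlieBracket (n := ∞) (mdifferentiableAt_constField _ _)
    (mdifferentiableAt_constField _ _) (contMDiffAt_extChartAt' (by simpa using hy))
    (by simpa using ENat.LEInfty.out), VectorField.mpullback_apply, mlieBracket_constField,
    map_zero]

/-- Coordinate fields commute, so vanishing torsion is symmetry of `Γ`. -/
lemma christoffel_symm {D : Connection I M} (hD : D.torsion = 0)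
    (hx : x ∈ (extChartAt I p).target) (u v : E) :
    christoffel D p x u v = christoffel D p x v u := by
  have hy := chartPt_mem_source hx
  have h := (CovariantDerivative.torsion_eq_zero_iff D).1 hD
    (mdifferentiableAt_coordField hy u) (mdifferentiableAt_coordField hy v)
  rw [mlieBracket_coordField hy, sub_eq_zero] at h
  rw [christoffel_apply D hx, christoffel_apply D hx]
  exact congrArg _ h

/-- The curvature endomorphism of the connection on `E` with Christoffel symbols `Γ`. -/
def coordCurvature (Γ : E → E →L[ℝ] E →L[ℝ] E) (x u v : E) : E →L[ℝ] E :=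
  fderiv ℝ Γ x u v - fderiv ℝ Γ x v u + (Γ x u * Γ x v - Γ x v * Γ x u)

lemma eventually_contMDiffOn_extend {y : M} (X : TangentSpace I y) :
    ∀ᶠ s in (𝓝 y).smallSets, CMDiff[s] ∞ (T% (FiberBundle.extend E X)) := by
  obtain ⟨s, hs, h⟩ := FiberBundle.exists_contMDiffOn_extend (k := ∞) I E X
  exact Filter.eventually_smallSets.2 ⟨s, hs, fun t ht => h.mono ht⟩

/-- One more differentiation of `toCoord_connection`, expanded so that the terms symmetric in `X`
and `Y` can be recognised. -/
lemma Connection.toCoord_iterate {D : Connection I M} [T2Space M]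
    (hD : CovariantDerivative.ContMDiffCovariantDerivative D ∞)
    (hx : x ∈ (extChartAt I p).target) {X Y Z : (y : M) → TangentSpace I y} {s : Set M}
    (hs : s ∈ 𝓝 (chartPt I p x)) (hY : CMDiff[s] ∞ (T% Y)) (hZ : CMDiff[s] ∞ (T% Z)) :
    toCoord I p _ (D (fun y => D Z y (Y y)) (chartPt I p x) (X _)) =
      fderiv ℝ (fderiv ℝ (coordRep p Z)) x (coordRep p X x) (coordRep p Y x) +
      fderiv ℝ (coordRep p Z) x (fderiv ℝ (coordRep p Y) x (coordRep p X x)) +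
      fderiv ℝ (christoffel D p) x (coordRep p X x) (coordRep p Y x) (coordRep p Z x) +
      christoffel D p x (fderiv ℝ (coordRep p Y) x (coordRep p X x)) (coordRep p Z x) +
      christoffel D p x (coordRep p Y x) (fderiv ℝ (coordRep p Z) x (coordRep p X x)) +
      christoffel D p x (coordRep p X x) (fderiv ℝ (coordRep p Z) x (coordRep p Y x) +
        christoffel D p x (coordRep p Y x) (coordRep p Z x)) := by
  have hW : CMDiffAt ∞ (T% fun y => D Z y (Y y)) (chartPt I p x) :=
    (contMDiffAt_connection hD hs hZ).clm_bundle_apply (hY.contMDiffAt hs)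
  have hcont : ContinuousAt (chartPt I p) x := (contMDiffAt_chartPt hx).continuousAt
  have e : coordRep p (fun y => D Z y (Y y)) =ᶠ[𝓝 x] fun z =>
      fderiv ℝ (coordRep p Z) z (coordRep p Y z)
        + christoffel D p z (coordRep p Y z) (coordRep p Z z) := by
    filter_upwards [(isOpen_extChartAt_target p).mem_nhds hx,
      hcont.eventually (eventually_mem_nhds_iff.2 hs)] with z hz hzs
    exact toCoord_connection D hz ((hZ.contMDiffAt hzs).mdifferentiableAt (by simp)) _
  have hY' := contDiffAt_coordRep le_rfl hx (hY.contMDiffAt hs)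
  have hZ' := contDiffAt_coordRep le_rfl hx (hZ.contMDiffAt hs)
  have dY := (hY'.differentiableAt (by simp)).hasFDerivAt
  have dZ := (hZ'.differentiableAt (by simp)).hasFDerivAt
  have ddZ := ((hZ'.fderiv_right (m := ∞) le_rfl).differentiableAt (by simp)).hasFDerivAt
  have dΓ := ((contDiffAt_christoffel hD hx).differentiableAt (by simp)).hasFDerivAt
  rw [toCoord_connection D hx (hW.mdifferentiableAt (by simp)), e.fderiv_eq, e.eq_of_nhds,
    ((ddZ.clm_apply dY).fun_add ((dΓ.clm_apply dY).clm_apply dZ)).fderiv]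
  simp only [add_apply, ContinuousLinearMap.comp_apply, ContinuousLinearMap.flip_apply]
  change _ + christoffel D p x (coordRep p X x) _ = _
  rw [show toCoord I p (chartPt I p x) (X (chartPt I p x)) = coordRep p X x from rfl]
  abel

/-- The bracket is replaced by `D_X Y - D_Y X`, which removes the derivatives of `X` and `Y`; the
second derivatives of `Z` cancel by symmetry, leaving a tensorial expression. -/
lemma Connection.toCoord_curvatureField {D : Connection I M} [T2Space M]
    (hD : CovariantDerivative.ContMDiffCovariantDerivative D ∞) (hD' : D.torsion = 0)
    (hx : x ∈ (extChartAt I p).target) {X Y Z : (y : M) → TangentSpace I y} {s : Set M}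
    (hs : s ∈ 𝓝 (chartPt I p x)) (hX : CMDiff[s] ∞ (T% X)) (hY : CMDiff[s] ∞ (T% Y))
    (hZ : CMDiff[s] ∞ (T% Z)) :
    toCoord I p _ (D.curvatureField X Y Z (chartPt I p x)) =
      coordCurvature (christoffel D p) x (coordRep p X x) (coordRep p Y x) (coordRep p Z x) := by
  have mX := (hX.contMDiffAt hs).mdifferentiableAt (n := ∞) (by simp)
  have mY := (hY.contMDiffAt hs).mdifferentiableAt (n := ∞) (by simp)
  have mZ := (hZ.contMDiffAt hs).mdifferentiableAt (n := ∞) (by simp)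
  have hsymm : fderiv ℝ (fderiv ℝ (coordRep p Z)) x (coordRep p X x) (coordRep p Y x) =
      fderiv ℝ (fderiv ℝ (coordRep p Z)) x (coordRep p Y x) (coordRep p X x) :=
    (contDiffAt_coordRep le_rfl hx (hZ.contMDiffAt hs)).isSymmSndFDerivAt
      (by simpa using ENat.LEInfty.out) _ _
  have eX : toCoord I p (chartPt I p x) (X (chartPt I p x)) = coordRep p X x := rfl
  have eY : toCoord I p (chartPt I p x) (Y (chartPt I p x)) = coordRep p Y x := rfl
  have hΓ := christoffel_symm hD' hx (coordRep p X x) (coordRep p Y x)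
  unfold curvatureField
  rw [← (CovariantDerivative.torsion_eq_zero_iff D).1 hD' mX mY, map_sub, map_sub,
    toCoord_iterate hD hx hs hY hZ, toCoord_iterate hD hx hs hX hZ,
    toCoord_connection D hx mZ, map_sub, toCoord_connection D hx mY, toCoord_connection D hx mX,
    eX, eY, hsymm, hΓ]
  simp only [coordCurvature, add_apply, sub_apply, map_add, map_sub, mul_apply_eq_comp]
  abel

/-- The curvature tensor in coordinates. -/
lemma Connection.toCoord_curvature {D : Connection I M} [T2Space M]
    (hD : CovariantDerivative.ContMDiffCovariantDerivative D ∞) (hD' : D.torsion = 0)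
    (hx : x ∈ (extChartAt I p).target) (X Y Z : TangentSpace I (chartPt I p x)) :
    toCoord I p _ (D.curvature (chartPt I p x) X Y Z) =
      coordCurvature (christoffel D p) x (toCoord I p _ X) (toCoord I p _ Y) (toCoord I p _ Z) := by
  obtain ⟨s, hs, hX, hY, hZ⟩ := ((eventually_contMDiffOn_extend X).and
    ((eventually_contMDiffOn_extend Y).and (eventually_contMDiffOn_extend Z))).exists_mem_of_smallSets
  unfold curvature
  rw [toCoord_curvatureField hD hD' hx hs hX hY hZ]
  simp [coordRep]

/-- The coordinate expression of a field of endomorphisms in the chart at `p`. -/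
def endRep (p : M) (A : (y : M) → TangentSpace I y →L[ℝ] TangentSpace I y) (x : E) : E →L[ℝ] E :=
  toCoord I p (chartPt I p x) ∘L A (chartPt I p x) ∘L ofCoord I p (chartPt I p x)

lemma endRep_apply_toCoord (hx : x ∈ (extChartAt I p).target)
    (A : (y : M) → TangentSpace I y →L[ℝ] TangentSpace I y) (W : TangentSpace I (chartPt I p x)) :
    endRep p A x (toCoord I p _ W) = toCoord I p _ (A _ W) := by
  simp only [endRep, ContinuousLinearMap.comp_apply, ofCoord_toCoord (chartPt_mem_source hx)]

lemma contDiffAt_endRep {A : (y : M) → TangentSpace I y →L[ℝ] TangentSpace I y}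
    (hx : x ∈ (extChartAt I p).target)
    (hA : ContMDiffAt I (I.prod 𝓘(ℝ, E →L[ℝ] E)) ∞ (fun y => TotalSpace.mk' (E →L[ℝ] E)
      (E := fun y : M => TangentSpace I y →L[ℝ] TangentSpace I y) y (A y)) (chartPt I p x)) :
    ContDiffAt ℝ ∞ (endRep p A) x :=
  contDiffAt_clm_of_apply fun v => contDiffAt_coordRep le_rfl hx
    (hA.clm_bundle_apply (contMDiffAt_coordField (chartPt_mem_source hx) v))

/-- The induced connection on endomorphisms in coordinates: `D_X A = dA(X) + [Γ(X), A]`. -/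
lemma Connection.toCoord_onEnd (D : Connection I M) (hx : x ∈ (extChartAt I p).target)
    (A : EndField I M) (X W : TangentSpace I (chartPt I p x)) :
    toCoord I p _ (D.onEnd A _ X W) =
      (fderiv ℝ (endRep p A) x (toCoord I p _ X)
        + (christoffel D p x (toCoord I p _ X) * endRep p A x
          - endRep p A x * christoffel D p x (toCoord I p _ X))) (toCoord I p _ W) := by
  have hy := chartPt_mem_source hx
  set w := toCoord I p _ W with hw
  have hW : coordField I p w (chartPt I p x) = W := ofCoord_toCoord hy W
  have hm := mdifferentiableAt_coordField (I := I) hy w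
  have h1 : D.onEnd A (chartPt I p x) X W =
      D (fun y => A y (coordField I p w y)) _ X - A _ (D (coordField I p w) _ X) := by
    conv_lhs => rw [← hW]
    exact TensorialAt.mkHom_apply (D.tensorial_end A _ X) hm
  have hA := contDiffAt_endRep (A := A) hx A.contMDiff.contMDiffAt
  have e1 : coordRep p (fun y => A y (coordField I p w y)) = fun z => endRep p A z w := rfl
  have hd := (hA.differentiableAt (by simp)).hasFDerivAt.clm_apply (hasFDerivAt_const w x)
  have e2 := coordRep_coordField_eventuallyEq (I := I) hx w
  rw [h1, map_sub, toCoord_connection D hx (A.mdifferentiableAt_apply hm), e1, hd.fderiv,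
    ← endRep_apply_toCoord hx, toCoord_connection D hx hm, e2.fderiv_eq, e2.eq_of_nhds]
  simp [mul_apply_eq_comp]
  abel

/-- The coordinate expression of a `1`-form in the chart at `p`. -/
def formRep (p : M) (α : (y : M) → TangentSpace I y →L[ℝ] ℝ) (x : E) : E →L[ℝ] ℝ :=
  α (chartPt I p x) ∘L ofCoord I p (chartPt I p x)

lemma formRep_apply_toCoord (hx : x ∈ (extChartAt I p).target)
    (α : (y : M) → TangentSpace I y →L[ℝ] ℝ) (W : TangentSpace I (chartPt I p x)) :
    formRep p α x (toCoord I p _ W) = α _ W := by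
  simp only [formRep, ContinuousLinearMap.comp_apply, ofCoord_toCoord (chartPt_mem_source hx)]

lemma OneForm.contMDiffAt_apply (α : OneForm I M) {y : M}
    {σ : (x : M) → TangentSpace I x} (hσ : CMDiffAt ∞ (T% σ) y) :
    ContMDiffAt I 𝓘(ℝ, ℝ) ∞ (fun y => (α y (σ y) : ℝ)) y := by
  have h : ContMDiffAt I (I.prod 𝓘(ℝ, ℝ)) ∞
      (fun y => TotalSpace.mk' ℝ (E := Bundle.Trivial M ℝ) y (α y (σ y))) y :=
    α.contMDiff.contMDiffAt.clm_bundle_apply hσ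
  exact (contMDiffAt_totalSpace.1 h).2

lemma contDiffAt_formRep (hx : x ∈ (extChartAt I p).target) (α : OneForm I M) :
    ContDiffAt ℝ ∞ (formRep p (fun y => α y)) x :=
  contDiffAt_clm_of_apply fun v => contDiffAt_comp_chartPt le_rfl hx
    (α.contMDiffAt_apply (contMDiffAt_coordField (chartPt_mem_source hx) v))

/-- The induced connection on `1`-forms in coordinates: `(D_X α)(W) = dα(X)(W) - α(Γ(X, W))`. -/
lemma Connection.onForm_eq (D : Connection I M) (hx : x ∈ (extChartAt I p).target)
    (α : OneForm I M) (X W : TangentSpace I (chartPt I p x)) :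
    D.onForm α _ X W =
      fderiv ℝ (formRep p (fun y => α y)) x (toCoord I p _ X) (toCoord I p _ W)
        - formRep p (fun y => α y) x (christoffel D p x (toCoord I p _ X) (toCoord I p _ W)) := by
  have hy := chartPt_mem_source hx
  set w := toCoord I p _ W with hw
  have hW : coordField I p w (chartPt I p x) = W := ofCoord_toCoord hy W
  have hm := mdifferentiableAt_coordField (I := I) hy w
  have h1 : D.onForm α (chartPt I p x) X W =
      mvfderiv I (fun y => (α y (coordField I p w y) : ℝ)) _ X
        - α _ (D (coordField I p w) _ X) := by
    conv_lhs => rw [← hW]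
    exact TensorialAt.mkHom_apply (D.tensorial_form α _ X) hm
  have hA := contDiffAt_formRep hx α
  have e1 : (fun z => (α (chartPt I p z) (coordField I p w (chartPt I p z)) : ℝ)) =
      fun z => formRep p (fun y => α y) z w := rfl
  have hd := (hA.differentiableAt (by simp)).hasFDerivAt.clm_apply (hasFDerivAt_const w x)
  have e2 := coordRep_coordField_eventuallyEq (I := I) hx w
  have e3 := formRep_apply_toCoord hx (fun y => α y) (D (coordField I p w) _ X)
  rw [h1, mvfderiv_eq_fderiv hx (α.mdifferentiableAt_apply hm), e1, hd.fderiv]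
  erw [← e3]
  rw [toCoord_connection D hx hm, e2.fderiv_eq, e2.eq_of_nhds]
  simp

/-! ### The metric in a chart -/

section Riemannian

variable [RiemannianBundle (fun x : M => TangentSpace I x)]
  [IsContMDiffRiemannianBundle I ∞ E (fun x : M => TangentSpace I x)]

variable (I) in
/-- The coordinate expression of the metric in the chart at `p`. -/
def metricRep (p : M) (x : E) : E →L[ℝ] E →L[ℝ] ℝ :=
  (innerSL ℝ (E := TangentSpace I (chartPt I p x))).bilinearComp (ofCoord I p (chartPt I p x))
    (ofCoord I p (chartPt I p x))

lemma metricRep_apply (u v : E) : metricRep I p x u v =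
    inner ℝ (coordField I p u (chartPt I p x)) (coordField I p v (chartPt I p x)) := rfl

lemma metricRep_toCoord (hx : x ∈ (extChartAt I p).target)
    (X Y : TangentSpace I (chartPt I p x)) :
    metricRep I p x (toCoord I p _ X) (toCoord I p _ Y) = inner ℝ X Y := by
  rw [metricRep_apply, coordField, coordField, ofCoord_toCoord (chartPt_mem_source hx),
    ofCoord_toCoord (chartPt_mem_source hx)]

lemma contMDiffAt_inner_coordField {y : M} (hy : y ∈ (extChartAt I p).source) (u v : E) :
    ContMDiffAt I 𝓘(ℝ, ℝ) ∞ (fun y => inner ℝ (coordField I p u y) (coordField I p v y)) y :=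
  ContMDiffAt.inner_bundle (IB := I) (F := E) (E := fun y : M => TangentSpace I y)
    (b := fun y : M => y) (contMDiffAt_coordField hy u) (contMDiffAt_coordField hy v)

lemma contDiffAt_metricRep (hx : x ∈ (extChartAt I p).target) :
    ContDiffAt ℝ ∞ (metricRep I p) x :=
  contDiffAt_clm_of_apply fun u => contDiffAt_clm_of_apply fun v =>
    contDiffAt_comp_chartPt le_rfl hx (contMDiffAt_inner_coordField (chartPt_mem_source hx) u v)

lemma fderiv_metricRep {D : Connection I M} (hD : D.IsLeviCivita)
    (hx : x ∈ (extChartAt I p).target) (u v w : E) :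
    fderiv ℝ (metricRep I p) x u v w = metricRep I p x (christoffel D p x u v) w
      + metricRep I p x v (christoffel D p x u w) := by
  have hy := chartPt_mem_source hx
  have hv := mdifferentiableAt_coordField (I := I) hy v
  have hw := mdifferentiableAt_coordField (I := I) hy w
  have hi : MDifferentiableAt I 𝓘(ℝ, ℝ) (fun y => inner ℝ (coordField I p v y)
      (coordField I p w y)) (chartPt I p x) :=
    (contMDiffAt_inner_coordField hy v w).mdifferentiableAt (by simp)
  have h := hD.metric _ _ _ hv hw (ofCoord I p _ u)
  rw [mvfderiv_eq_fderiv hx hi, toCoord_ofCoord hy] at h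
  have hd := (((contDiffAt_metricRep (I := I) hx).differentiableAt (by simp)).hasFDerivAt.clm_apply
    (hasFDerivAt_const v x)).clm_apply (hasFDerivAt_const w x)
  have e : (fun z => metricRep I p z v w) = (fun z => inner ℝ (coordField I p v (chartPt I p z))
    (coordField I p w (chartPt I p z))) := rfl
  rw [← e, hd.fderiv, ← metricRep_toCoord hx, ← metricRep_toCoord hx, ← christoffel_apply D hx,
    ← christoffel_apply D hx, coordField, coordField, toCoord_ofCoord hy, toCoord_ofCoord hy] at h
  simpa using h

end Riemannian

end BoundarylessChart

/-! ### Algebra of quaternionic-Kähler curvature tensors -/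

section CurvatureAlgebra

variable {V : Type*} [AddCommGroup V] [Module ℝ V] [TopologicalSpace V]
  [IsTopologicalAddGroup V] [ContinuousSMul ℝ V] [FiniteDimensional ℝ V]
  {Q : Submodule ℝ (V →L[ℝ] V)} {J : Fin 3 → V →L[ℝ] V}

namespace IsAdmissibleBasis

lemma apply_self (h : IsAdmissibleBasis Q J) (i : Fin 3) (X : V) : J i (J i X) = -X := by
  simpa using congrArg (fun T : V →L[ℝ] V => T X) (h.sq i)

lemma mul_one_zero (h : IsAdmissibleBasis Q J) : J 1 * J 0 = -J 2 := by
  rw [h.anticomm (by decide), h.mul]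

lemma mul_zero_two (h : IsAdmissibleBasis Q J) : J 0 * J 2 = -J 1 := by
  rw [← h.mul, ← mul_assoc, h.sq, neg_one_mul]

lemma mul_two_zero (h : IsAdmissibleBasis Q J) : J 2 * J 0 = J 1 := by
  rw [h.anticomm (by decide), h.mul_zero_two, neg_neg]

lemma mul_two_one (h : IsAdmissibleBasis Q J) : J 2 * J 1 = -J 0 := by
  rw [← h.mul, mul_assoc, h.sq, mul_neg_one]

lemma mul_one_two (h : IsAdmissibleBasis Q J) : J 1 * J 2 = J 0 := by
  rw [h.anticomm (by decide), h.mul_two_one, neg_neg]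

/-- Cyclic symmetry of the quaternionic relations: identities proved for one index carry over to the
other two. -/
lemma rotate (h : IsAdmissibleBasis Q J) : IsAdmissibleBasis Q (fun i => J (i + 1)) where
  sq i := h.sq _
  mul := h.mul_one_two
  span := by
    rw [h.span]
    congr 1
    exact ((Equiv.addRight (1 : Fin 3)).surjective.range_comp J).symm

end IsAdmissibleBasis

lemma qInner_add_left (A B C : V →L[ℝ] V) : qInner (A + B) C = qInner A C + qInner B C := by
  simp only [qInner, add_mul, ContinuousLinearMap.toLinearMap_add, map_add]; ring

lemma qInner_smul_left (c : ℝ) (A B : V →L[ℝ] V) : qInner (c • A) B = c * qInner A B := by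
  simp only [qInner, smul_mul_assoc, ContinuousLinearMap.toLinearMap_smul, map_smul, smul_eq_mul]
  ring

lemma qInner_add_right (A B C : V →L[ℝ] V) : qInner A (B + C) = qInner A B + qInner A C := by
  rw [qInner_comm, qInner_add_left, qInner_comm B, qInner_comm C]

lemma qInner_smul_right (c : ℝ) (A B : V →L[ℝ] V) : qInner A (c • B) = c * qInner A B := by
  rw [qInner_comm, qInner_smul_left, qInner_comm B]

lemma qInner_neg_left (A B : V →L[ℝ] V) : qInner (-A) B = -qInner A B := by
  simpa using qInner_smul_left (-1) A B

lemma qInner_neg_right (A B : V →L[ℝ] V) : qInner A (-B) = -qInner A B := by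
  simpa using qInner_smul_right (-1) A B

lemma qInner_sub_left (A B C : V →L[ℝ] V) : qInner (A - B) C = qInner A C - qInner B C := by
  rw [sub_eq_add_neg, qInner_add_left, qInner_neg_left, sub_eq_add_neg]

lemma qInner_sub_right (A B C : V →L[ℝ] V) : qInner A (B - C) = qInner A B - qInner A C := by
  rw [sub_eq_add_neg, qInner_add_right, qInner_neg_right, sub_eq_add_neg]

/-- The invariance `⟨[T, A], B⟩ = ⟨T, [A, B]⟩`. -/
lemma qInner_commutator (T A B : V →L[ℝ] V) :
    qInner (T * A - A * T) B = qInner T (A * B - B * A) := by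
  have key : LinearMap.trace ℝ V ((A * T * B : V →L[ℝ] V) : V →ₗ[ℝ] V) =
      LinearMap.trace ℝ V ((T * (B * A) : V →L[ℝ] V) : V →ₗ[ℝ] V) := by
    have := LinearMap.trace_mul_comm ℝ (A : V →ₗ[ℝ] V) ((T * B : V →L[ℝ] V) : V →ₗ[ℝ] V)
    rw [mul_assoc, ← mul_assoc T]; exact this
  rw [qInner_sub_left, qInner_sub_right]
  unfold qInner
  rw [key, mul_assoc]

variable {ι : Type*} [Fintype ι] [DecidableEq ι]

/-- `b` is an orthonormal basis of `V` for the symmetric bilinear form `g`. -/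
structure IsOrthonormalBasis (g : V →L[ℝ] V →L[ℝ] ℝ) (b : Module.Basis ι ℝ V) : Prop where
  symm : ∀ u v, g u v = g v u
  apply : ∀ i j, g (b i) (b j) = if i = j then 1 else 0

namespace IsOrthonormalBasis

variable {g : V →L[ℝ] V →L[ℝ] ℝ} {b : Module.Basis ι ℝ V}

lemma repr_eq (h : IsOrthonormalBasis g b) (v : V) (i : ι) : b.repr v i = g v (b i) := by
  conv_rhs => rw [← b.sum_repr v]
  simp only [map_sum, map_smul, sum_apply, smul_apply, h.apply, smul_eq_mul, mul_ite, mul_one,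
    mul_zero, Finset.sum_ite_eq', Finset.mem_univ, if_true]

lemma sum_smul (h : IsOrthonormalBasis g b) (v : V) : ∑ i, g v (b i) • b i = v := by
  simp_rw [← h.repr_eq]
  exact b.sum_repr v

lemma trace_eq (h : IsOrthonormalBasis g b) (T : V →ₗ[ℝ] V) :
    LinearMap.trace ℝ V T = ∑ i, g (T (b i)) (b i) := by
  rw [LinearMap.trace_eq_matrix_trace ℝ b, Matrix.trace]
  simp [LinearMap.toMatrix_apply, h.repr_eq]

/-- The matrix of `C` in an orthonormal basis is antisymmetric, so in a trace `C` passes from one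
slot to the other with a change of sign. -/
lemma sum_skew (h : IsOrthonormalBasis g b) {C : V →L[ℝ] V}
    (hC : ∀ u v, g (C u) v = -g u (C v)) (T : V →ₗ[ℝ] V →ₗ[ℝ] ℝ) :
    ∑ i, T (C (b i)) (b i) = -∑ i, T (b i) (C (b i)) := by
  have h1 (i) : T (C (b i)) (b i) = ∑ j, g (C (b i)) (b j) * T (b j) (b i) := by
    conv_lhs => rw [← h.sum_smul (C (b i))]
    simp
  have h2 (j) : T (b j) (C (b j)) = ∑ i, g (C (b j)) (b i) * T (b j) (b i) := by
    conv_lhs => rw [← h.sum_smul (C (b j))]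
    simp
  simp_rw [h1, h2]
  rw [Finset.sum_comm, ← Finset.sum_neg_distrib]
  refine Finset.sum_congr rfl fun j _ => ?_
  rw [← Finset.sum_neg_distrib]
  refine Finset.sum_congr rfl fun i _ => ?_
  rw [hC, h.symm]; ring

lemma sum_mul (h : IsOrthonormalBasis g b) (φ : V →ₗ[ℝ] ℝ) (v : V) :
    ∑ i, φ (b i) * g v (b i) = φ v := by
  conv_rhs => rw [← h.sum_smul v]
  simp [mul_comm]

end IsOrthonormalBasis

/-- The algebraic symmetries of the curvature tensor of a quaternionic-Kähler metric. -/
structure IsQuaternionicCurvature (g : V →L[ℝ] V →L[ℝ] ℝ) (Q : Submodule ℝ (V →L[ℝ] V))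
    (R : V →ₗ[ℝ] V →ₗ[ℝ] (V →L[ℝ] V)) : Prop where
  antisymm : ∀ X Y, R X Y = -R Y X
  skew : ∀ X Y Z W, g (R X Y Z) W = -g Z (R X Y W)
  bianchi : ∀ X Y Z, R X Y Z + R Y Z X + R Z X Y = 0
  commutator_mem : ∀ X Y, ∀ A ∈ Q, R X Y * A - A * R X Y ∈ Q

/-- The Ricci form `Ric(X, Y) = tr (Z ↦ R_{Z,X} Y)` in an orthonormal basis. -/
def ricciForm (g : V →L[ℝ] V →L[ℝ] ℝ) (b : Module.Basis ι ℝ V)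
    (R : V →ₗ[ℝ] V →ₗ[ℝ] (V →L[ℝ] V)) : V →ₗ[ℝ] V →ₗ[ℝ] ℝ :=
  LinearMap.mk₂ ℝ (fun X Y => ∑ i, g (R (b i) X Y) (b i))
    (fun X X' Y => by simp [Finset.sum_add_distrib])
    (fun c X Y => by simp [Finset.mul_sum])
    (fun X Y Y' => by simp [Finset.sum_add_distrib])
    (fun c X Y => by simp [Finset.mul_sum])

lemma ricciForm_apply (g : V →L[ℝ] V →L[ℝ] ℝ) (b : Module.Basis ι ℝ V)
    (R : V →ₗ[ℝ] V →ₗ[ℝ] (V →L[ℝ] V)) (X Y : V) :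
    ricciForm g b R X Y = ∑ i, g (R (b i) X Y) (b i) := rfl

namespace IsQuaternionicCurvature

variable {g : V →L[ℝ] V →L[ℝ] ℝ} {b : Module.Basis ι ℝ V}
  {R : V →ₗ[ℝ] V →ₗ[ℝ] (V →L[ℝ] V)}

/-- The classical octahedron argument: the four Bianchi identities on `X, Y, Z, W` are added, using
antisymmetry in each pair. -/
lemma pair_symm (hR : IsQuaternionicCurvature g Q R) (hg : ∀ u v, g u v = g v u) (X Y Z W : V) :
    g (R X Y Z) W = g (R Z W X) Y := by
  have B (X Y Z W : V) : g (R X Y Z) W + g (R Y Z X) W + g (R Z X Y) W = 0 := by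
    rw [← add_apply, ← add_apply, ← map_add, ← map_add, hR.bianchi]; simp
  have A (X Y Z W : V) : g (R X Y Z) W = -g (R Y X Z) W := by rw [hR.antisymm X Y]; simp
  have S (X Y Z W : V) : g (R X Y Z) W = -g (R X Y W) Z := by rw [hR.skew, hg Z]
  linarith [B X Y Z W, B Y Z W X, B Z W X Y, B W X Y Z, A X Y Z W, S X Y Z W, A Y Z X W,
    S Y Z X W, A Z X Y W, S Z X Y W, A Y Z W X, S Y Z W X, A Z W Y X, S Z W Y X, A W Y Z X,
    S W Y Z X, A Z W X Y, S Z W X Y, A W X Z Y, S W X Z Y, A X Z W Y, S X Z W Y, A W X Y Z,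
    S W X Y Z, A X Y W Z, S X Y W Z, A Y W X Z, S Y W X Z, S W Y X Z, S X Z Y W]

lemma ricciForm_symm (hR : IsQuaternionicCurvature g Q R) (hb : IsOrthonormalBasis g b) (X Y : V) :
    ricciForm g b R X Y = ricciForm g b R Y X := by
  rw [ricciForm_apply, ricciForm_apply]
  refine Finset.sum_congr rfl fun i _ => ?_
  rw [hR.pair_symm hb.symm, hR.antisymm Y, neg_apply, map_neg, neg_apply, hR.skew, hb.symm, neg_neg]

variable (hR : IsQuaternionicCurvature g Q R) (hb : IsOrthonormalBasis g b)
  (hJ : IsAdmissibleBasis Q J) (hskew : ∀ A ∈ Q, ∀ u v, g (A u) v = -g u (A v))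

-- The commutator lies in `Q`, so its inner products with the `J_k` determine it; by invariance of
-- the trace form these are `⟨R, [J₀, J_k]⟩`.
include hR hJ in
lemma commutator_zero [Nontrivial V] (X Y : V) :
    R X Y * J 0 - J 0 * R X Y =
      (-(2 * qInner (R X Y) (J 1))) • J 2 + (2 * qInner (R X Y) (J 2)) • J 1 := by
  rw [hJ.eq_sum (hR.commutator_mem X Y _ (hJ.mem 0)), Fin.sum_univ_three]
  simp only [qInner_commutator, hJ.mul, hJ.mul_one_zero, hJ.mul_zero_two, hJ.mul_two_zero, sub_self]
  have h0 : qInner (R X Y) 0 = 0 := by simpa using qInner_smul_right 0 (R X Y) 0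
  rw [h0, qInner_sub_right, qInner_sub_right, qInner_neg_right, qInner_neg_right]
  module

-- The trace of `R_{X,Y} J₀` is rewritten by pair symmetry and Bianchi as a trace of `R_{e,X} J₀ e`.
-- Moving `J₀` past the curvature leaves the Ricci form and, from the commutator, the `J₁` and `J₂`
-- components of `R`.
include hR hb hJ hskew in
lemma finrank_mul_qInner_zero [Nontrivial V] (X Y : V) :
    Module.finrank ℝ V * qInner (R X Y) (J 0) = 2 * ricciForm g b R X (J 0 Y)
      + 4 * qInner (R (J 2 Y) X) (J 1) - 4 * qInner (R (J 1 Y) X) (J 2) := by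
  have hne : (Module.finrank ℝ V : ℝ) ≠ 0 := by
    exact_mod_cast (Module.finrank_pos (R := ℝ) (M := V)).ne'
  have e1 : Module.finrank ℝ V * qInner (R X Y) (J 0) = -∑ i, g (R X Y (J 0 (b i))) (b i) := by
    rw [qInner, mul_div_cancel₀ _ hne, hb.trace_eq]; rfl
  -- pair symmetry and the Bianchi identity
  let T : V →ₗ[ℝ] V →ₗ[ℝ] ℝ := LinearMap.mk₂ ℝ (fun u v => g (R u X v) Y)
    (fun u u' v => by simp) (fun c u v => by simp) (fun u v v' => by simp) (fun c u v => by simp)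
  have hT (u v : V) : T u v = g (R u X v) Y := rfl
  have e2 : ∑ i, g (R X Y (J 0 (b i))) (b i) = -2 * ∑ i, T (b i) (J 0 (b i)) := by
    have s := hb.sum_skew (hskew _ (hJ.mem 0)) T
    have e (i) : g (R X Y (J 0 (b i))) (b i) = -T (b i) (J 0 (b i)) + T (J 0 (b i)) (b i) := by
      rw [hR.pair_symm hb.symm, hT, hT]
      have := congrArg (fun v => g v Y) (hR.bianchi (J 0 (b i)) (b i) X)
      simp only [map_add, add_apply, map_zero, zero_apply, hR.antisymm X (J 0 (b i)), neg_apply,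
        map_neg] at this
      linarith
    simp_rw [e, Finset.sum_add_distrib, Finset.sum_neg_distrib]
    rw [s]; ring
  -- `J₀` is exchanged with `R`, at the cost of the commutator.
  have e3 (i) : T (b i) (J 0 (b i)) = g (R (b i) X (J 0 Y)) (b i)
      + (-2) * (qInner (R (b i) X) (J 1) * g (J 2 (b i)) Y)
      + 2 * (qInner (R (b i) X) (J 2) * g (J 1 (b i)) Y) := by
    have c := congrArg (fun S : V →L[ℝ] V => g (S (b i)) Y) (hR.commutator_zero hJ (b i) X)
    simp only [sub_apply, add_apply, smul_apply, mul_apply_eq_comp, map_sub, map_add, map_smul,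
      smul_eq_mul] at c
    rw [hT]
    have d : g (J 0 (R (b i) X (b i))) Y = g (R (b i) X (J 0 Y)) (b i) := by
      rw [hskew _ (hJ.mem 0), hR.skew, hb.symm, neg_neg]
    linarith
  have e4 (k l : Fin 3) : ∑ i, qInner (R (b i) X) (J k) * g (J l (b i)) Y =
      -qInner (R (J l Y) X) (J k) := by
    let φ : V →ₗ[ℝ] ℝ :=
      { toFun := fun u => qInner (R u X) (J k)
        map_add' := fun u v => by simp [qInner_add_left]
        map_smul' := fun c u => by simp [qInner_smul_left] }
    have := hb.sum_mul φ (J l Y)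
    change _ = -φ (J l Y)
    rw [← this, ← Finset.sum_neg_distrib]
    refine Finset.sum_congr rfl fun i _ => ?_
    rw [hskew _ (hJ.mem l), hb.symm]
    change _ * _ = -(qInner (R (b i) X) (J k) * _)
    ring
  rw [e1, e2]
  simp_rw [e3, Finset.sum_add_distrib, ← Finset.mul_sum, e4, ricciForm_apply]
  ring

include hR hb hJ hskew in
lemma qInner_apply_self_zero [Nontrivial V] (X Y : V) :
    Module.finrank ℝ V * qInner (R X (J 0 Y)) (J 0) = -2 * ricciForm g b R X Y
      - 4 * qInner (R X (J 1 Y)) (J 1) - 4 * qInner (R X (J 2 Y)) (J 2) := by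
  rw [hR.finrank_mul_qInner_zero hb hJ hskew, hJ.apply_self,
    show J 2 (J 0 Y) = (J 2 * J 0) Y from rfl, show J 1 (J 0 Y) = (J 1 * J 0) Y from rfl,
    hJ.mul_two_zero, hJ.mul_one_zero, hR.antisymm _ X, hR.antisymm _ X]
  simp only [neg_apply, map_neg, qInner_neg_left]
  ring

include hR hb hJ hskew in
/-- The `Q`-part of the curvature is determined by the Ricci tensor. -/
lemma qInner_eq_ricciForm (hV : 4 < Module.finrank ℝ V) (i : Fin 3) (X Y : V) :
    (Module.finrank ℝ V + 8) * qInner (R X Y) (J i) = 2 * ricciForm g b R X (J i Y) := by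
  have : Nontrivial V := Module.nontrivial_of_finrank_pos (R := ℝ) (by omega)
  have hV' : (4 : ℝ) < Module.finrank ℝ V := by exact_mod_cast hV
  have key (Y : V) : (Module.finrank ℝ V + 8) * qInner (R X (J i Y)) (J i) =
      -2 * ricciForm g b R X Y := by
    -- With `rᵢ = ⟨R(X, Jᵢ Y), Jᵢ⟩` and `N = dim V`, the three rotated identities form the system `N
    -- r₀ = -2 Ric - 4 r₁ - 4 r₂`, and cyclically. Differences give `(N - 4)(rᵢ - rⱼ) = 0`, hence
    -- all `rᵢ` agree because `N > 4`.
    have h0 := hR.qInner_apply_self_zero hb hJ hskew X Y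
    have h1 := hR.qInner_apply_self_zero hb hJ.rotate hskew X Y
    have h2 := hR.qInner_apply_self_zero hb hJ.rotate.rotate hskew X Y
    simp only [zero_add, Fin.reduceAdd] at h1 h2
    have h01 : qInner (R X (J 0 Y)) (J 0) = qInner (R X (J 1 Y)) (J 1) := by
      have : (Module.finrank ℝ V - 4 : ℝ) ≠ 0 := by linarith
      apply mul_left_cancel₀ this; linarith
    have h02 : qInner (R X (J 0 Y)) (J 0) = qInner (R X (J 2 Y)) (J 2) := by
      have : (Module.finrank ℝ V - 4 : ℝ) ≠ 0 := by linarith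
      apply mul_left_cancel₀ this; linarith
    fin_cases i <;> simp only [Fin.zero_eta, Fin.mk_one, Fin.reduceFinMk] <;> linarith
  have h := key (J i Y)
  rw [hJ.apply_self, map_neg, qInner_neg_left] at h
  linarith

-- For `i = j` the identity `Jᵢ² = -1` produces the scalar curvature. For `i ≠ j` the product `Jᵢ
-- Jⱼ` is skew, and the trace of the symmetric Ricci form against it vanishes.
include hR hb hJ hskew in
lemma sum_qInner_apply (hV : 4 < Module.finrank ℝ V) (i j : Fin 3) :
    (Module.finrank ℝ V + 8) * ∑ k, qInner (R (b k) (J j (b k))) (J i) =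
      if i = j then -2 * ∑ k, ricciForm g b R (b k) (b k) else 0 := by
  rw [Finset.mul_sum]
  simp_rw [hR.qInner_eq_ricciForm hb hJ hskew hV]
  split_ifs with hij
  · subst hij
    simp_rw [hJ.apply_self, map_neg, Finset.mul_sum]
    exact Finset.sum_congr rfl fun k _ => by ring
  · let T : V →ₗ[ℝ] V →ₗ[ℝ] ℝ := (ricciForm g b R).compl₂ (J i : V →ₗ[ℝ] V)
    have s := hb.sum_skew (hskew _ (hJ.mem j)) T
    have s' := hb.sum_skew (hskew _ (hJ.mem i)) ((ricciForm g b R).compl₂ (J j : V →ₗ[ℝ] V))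
    have hT (u v : V) : T u v = ricciForm g b R u (J i v) := rfl
    have e1 (k) : T (J j (b k)) (b k) = ricciForm g b R (J i (b k)) (J j (b k)) := by
      rw [hT, hR.ricciForm_symm hb]
    have e2 (k) : ricciForm g b R (b k) (J j (J i (b k))) =
        -ricciForm g b R (b k) (J i (J j (b k))) := by
      have := congrArg (fun S : V →L[ℝ] V => S (b k)) (hJ.anticomm hij)
      simp only [mul_apply_eq_comp, neg_apply] at this
      rw [this, map_neg, neg_neg]
    have s'' : ∑ k, ricciForm g b R (J i (b k)) (J j (b k)) =
        ∑ k, ricciForm g b R (b k) (J i (J j (b k))) := by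
      have := s'
      simp only [LinearMap.compl₂_apply, ContinuousLinearMap.coe_coe] at this
      rw [this]
      simp_rw [e2]
      simp
    simp_rw [e1, hT, s''] at s
    rw [← Finset.mul_sum]
    linarith

-- Invariance of the trace form reduces this to `⟨R, [A, J₀]⟩`, where `[A, J₀]` involves only the
-- `J₁` and `J₂` components of `A`.
include hR hJ in
lemma qInner_commutator_zero [Nontrivial V] {A : V →L[ℝ] V} (hA : A ∈ Q) (X Y : V) :
    qInner (R X Y * A - A * R X Y) (J 0) =
      2 * (qInner A (J 2) * qInner (R X Y) (J 1) - qInner A (J 1) * qInner (R X Y) (J 2)) := by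
  rw [qInner_commutator]
  have h : A * J 0 - J 0 * A = (-(2 * qInner A (J 1))) • J 2 + (2 * qInner A (J 2)) • J 1 := by
    conv_lhs => rw [hJ.eq_sum hA, Fin.sum_univ_three]
    simp only [add_mul, mul_add, smul_mul_assoc, mul_smul_comm, hJ.mul, hJ.mul_one_zero,
      hJ.mul_zero_two, hJ.mul_two_zero]
    module
  rw [h, qInner_add_right, qInner_smul_right, qInner_smul_right]
  ring

-- The trace of `B` against `J₂` is obtained in two ways, from `J₂ = J₀ J₁` and from `-J₂ = J₁ J₀`.
-- Subtracting the two puts the `η` terms in an antisymmetric form that cancels in the cyclic sum of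
-- `sum_apply`.
include hR hb hJ hskew in
lemma sum_apply_two (hV : 4 < Module.finrank ℝ V) {A : V →L[ℝ] V} (hA : A ∈ Q)
    {B η : V →ₗ[ℝ] V →ₗ[ℝ] ℝ}
    (hB : ∀ k X Y, B X (J k Y) - B Y (J k X) =
      qInner (R X Y * A - A * R X Y) (J k) + qInner A (J k) * η X Y) :
    4 * ((Module.finrank ℝ V + 8) * ∑ i, B (b i) (J 2 (b i))) =
      -8 * (∑ k, ricciForm g b R (b k) (b k)) * qInner A (J 2) + (Module.finrank ℝ V + 8) *
        (qInner A (J 0) * ∑ i, η (b i) (J 1 (b i)) -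
          qInner A (J 1) * ∑ i, η (b i) (J 0 (b i))) := by
  have : Nontrivial V := Module.nontrivial_of_finrank_pos (R := ℝ) (by omega)
  have w (i j) := hR.sum_qInner_apply hb hJ hskew hV i j
  have w11 := w 1 1
  have w21 := w 2 1
  have w00 := w 0 0
  have w20 := w 2 0
  simp only [if_true, Fin.reduceEq, if_false] at w11 w21 w00 w20
  have tr (k l : Fin 3) : ∑ i, B (J l (b i)) (J k (b i)) = -∑ i, B (b i) (J k (J l (b i))) :=
    hb.sum_skew (hskew _ (hJ.mem l)) (B.compl₂ (J k : V →ₗ[ℝ] V))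
  -- The hypothesis with `k = 0`, `Y = J₁ X`, traced over `X`; skewness of `J₁` makes the two terms
  -- on the left equal.
  have e01 : 2 * ∑ i, B (b i) (J 2 (b i)) = ∑ i, (2 * (qInner A (J 2) *
      qInner (R (b i) (J 1 (b i))) (J 1) - qInner A (J 1) * qInner (R (b i) (J 1 (b i))) (J 2))
        + qInner A (J 0) * η (b i) (J 1 (b i))) := by
    have t := tr 0 1
    have m (i) : J 0 (J 1 (b i)) = J 2 (b i) := by
      rw [← hJ.mul]; rfl
    simp_rw [← hR.qInner_commutator_zero hJ hA, ← hB, m, Finset.sum_sub_distrib]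
    simp_rw [m] at t
    rw [t]; ring
  have hrot (X Y : V) : qInner (R X Y * A - A * R X Y) (J 1) =
      2 * (qInner A (J 0) * qInner (R X Y) (J 2) - qInner A (J 2) * qInner (R X Y) (J 0)) :=
    hR.qInner_commutator_zero hJ.rotate hA X Y
  -- The same with the roles of `J₀` and `J₁` exchanged.
  have e10 : -2 * ∑ i, B (b i) (J 2 (b i)) = ∑ i, (2 * (qInner A (J 0) *
      qInner (R (b i) (J 0 (b i))) (J 2) - qInner A (J 2) * qInner (R (b i) (J 0 (b i))) (J 0))
        + qInner A (J 1) * η (b i) (J 0 (b i))) := by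
    have t := tr 1 0
    have m (i) : J 1 (J 0 (b i)) = -J 2 (b i) := by
      change (J 1 * J 0) (b i) = _
      rw [hJ.mul_one_zero]; rfl
    simp_rw [← hrot, ← hB, m, Finset.sum_sub_distrib]
    simp_rw [m] at t
    rw [t]; simp; ring
  simp_rw [Finset.sum_add_distrib, ← Finset.mul_sum, Finset.sum_sub_distrib, ← Finset.mul_sum]
    at e01 e10
  linear_combination (Module.finrank ℝ V + 8) * e01 - (Module.finrank ℝ V + 8) * e10
    + 2 * qInner A (J 2) * w11 - 2 * qInner A (J 1) * w21 - 2 * qInner A (J 0) * w20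
    + 2 * qInner A (J 2) * w00

include hR hb hJ hskew in
/-- The trace identity behind the Weitzenböck formula of the Penrose operator. -/
lemma sum_apply (hV : 4 < Module.finrank ℝ V) {A : V →L[ℝ] V} (hA : A ∈ Q)
    {B η : V →ₗ[ℝ] V →ₗ[ℝ] ℝ}
    (hB : ∀ k X Y, B X (J k Y) - B Y (J k X) =
      qInner (R X Y * A - A * R X Y) (J k) + qInner A (J k) * η X Y) :
    (Module.finrank ℝ V + 8) * ∑ i, B (b i) (A (b i)) =
      -2 * (∑ k, ricciForm g b R (b k) (b k)) * qInner A A := by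
  have : Nontrivial V := Module.nontrivial_of_finrank_pos (R := ℝ) (by omega)
  have h2 := hR.sum_apply_two hb hJ hskew hV hA hB
  have h0 := hR.sum_apply_two hb hJ.rotate hskew hV hA (B := B) (η := η) fun k => hB (k + 1)
  have h1 := hR.sum_apply_two hb hJ.rotate.rotate hskew hV hA (B := B) (η := η)
    fun k => hB (k + 1 + 1)
  simp only [zero_add, Fin.reduceAdd] at h0 h1
  have e1 : ∑ i, B (b i) (A (b i)) = ∑ k, qInner A (J k) * ∑ i, B (b i) (J k (b i)) := by
    simp_rw [Finset.mul_sum]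
    rw [Finset.sum_comm]
    refine Finset.sum_congr rfl fun i _ => ?_
    conv_lhs => rw [hJ.eq_sum hA]
    simp [_root_.sum_apply]
  have e2 : qInner A A = ∑ k, qInner A (J k) * qInner A (J k) := by
    conv_lhs => enter [1]; rw [hJ.eq_sum hA]
    rw [qInner_sum_left]
    simp_rw [qInner_comm (J _) A]
  rw [e1, e2, Fin.sum_univ_three, Fin.sum_univ_three]
  -- Weighted by the components `aₖ` of `A`, the terms `aₖ (aₗ ηₘ - aₘ ηₗ)` over cyclic triples add
  -- up to zero.
  linear_combination (1 / 4) * qInner A (J 0) * h0 + (1 / 4) * qInner A (J 1) * h1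
    + (1 / 4) * qInner A (J 2) * h2

end IsQuaternionicCurvature

end CurvatureAlgebra

/-! ### Covariant derivatives and curvature on an open subset of a vector space -/

section LocalAnalysis

set_option synthInstance.maxHeartbeats 400000
set_option maxHeartbeats 1000000

variable {E : Type*} [NormedAddCommGroup E] [NormedSpace ℝ E] [FiniteDimensional ℝ E]

variable (E) in
/-- The linear form `A ↦ - tr A / dim E`. -/
def qTrace : (E →L[ℝ] E) →L[ℝ] ℝ :=
  LinearMap.toContinuousLinearMap
    { toFun := fun A => -(LinearMap.trace ℝ E (A : E →ₗ[ℝ] E)) / Module.finrank ℝ E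
      map_add' := fun A B => by
        rw [ContinuousLinearMap.toLinearMap_add, map_add]; ring
      map_smul' := fun c A => by
        rw [ContinuousLinearMap.toLinearMap_smul, map_smul, RingHom.id_apply, smul_eq_mul,
          smul_eq_mul]
        ring }

lemma qInner_eq_qTrace (A B : E →L[ℝ] E) : qInner A B = qTrace E (A * B) := rfl

variable {Γ : E → E →L[ℝ] E →L[ℝ] E} {A B : E → E →L[ℝ] E} {x : E}

lemma ContDiffAt.qInner {k : ℕ∞ω} (hA : ContDiffAt ℝ k A x) (hB : ContDiffAt ℝ k B x) :
    ContDiffAt ℝ k (fun z => qInner (A z) (B z)) x :=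
  (qTrace E).contDiff.contDiffAt.comp x (hA.mul hB)

lemma HasFDerivAt.qInner {A' B' : E →L[ℝ] E →L[ℝ] E} (hA : HasFDerivAt A A' x)
    (hB : HasFDerivAt B B' x) (u : E) :
    fderiv ℝ (fun z => qInner (A z) (B z)) x u = qInner (A' u) (B x) + qInner (A x) (B' u) := by
  have h := (qTrace E).hasFDerivAt.comp x (hA.mul' hB)
  have e := h.fderiv
  change fderiv ℝ (fun z => QuatGeom.qInner (A z) (B z)) x = _ at e
  rw [e, qInner_eq_qTrace, qInner_eq_qTrace, ← map_add, add_comm]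
  rfl

/-- The covariant derivative `u ↦ dA(u) + [Γ(u), A]` of a field of endomorphisms of `E`. -/
def covEnd (Γ : E → E →L[ℝ] E →L[ℝ] E) (A : E → E →L[ℝ] E) (x : E) : E →L[ℝ] E →L[ℝ] E :=
  fderiv ℝ A x + ((ContinuousLinearMap.mul ℝ (E →L[ℝ] E)).flip (A x)
    - ContinuousLinearMap.mul ℝ (E →L[ℝ] E) (A x)) ∘L Γ x

lemma covEnd_apply (u : E) :
    covEnd Γ A x u = fderiv ℝ A x u + (Γ x u * A x - A x * Γ x u) := by
  simp [covEnd]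

lemma ContDiffAt.covEnd (hΓ : ContDiffAt ℝ ∞ Γ x) (hA : ContDiffAt ℝ ∞ A x) :
    ContDiffAt ℝ ∞ (covEnd Γ A) x := by
  refine (hA.fderiv_right le_rfl).add ?_
  refine ContDiffAt.clm_comp (ContDiffAt.sub ?_ ?_) hΓ
  · exact (ContinuousLinearMap.contDiff _).contDiffAt.comp x hA
  · exact (ContinuousLinearMap.contDiff _).contDiffAt.comp x hA

lemma hasFDerivAt_apply_const {F : Type*} [NormedAddCommGroup F] [NormedSpace ℝ F]
    {T : E → E →L[ℝ] F} (hT : DifferentiableAt ℝ T x) (v : E) :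
    HasFDerivAt (fun z => T z v) ((fderiv ℝ T x).flip v) x := by
  have := hT.hasFDerivAt.clm_apply (hasFDerivAt_const v x)
  simpa using this

/-- The Ricci identity. -/
lemma covEnd_covEnd_sub (hΓ : ContDiffAt ℝ ∞ Γ x) (hA : ContDiffAt ℝ ∞ A x) (u v : E) :
    covEnd Γ (fun z => covEnd Γ A z v) x u - covEnd Γ (fun z => covEnd Γ A z u) x v =
      coordCurvature Γ x u v * A x - A x * coordCurvature Γ x u v := by
  have dΓ := (hΓ.differentiableAt (by simp))
  have dA := (hA.differentiableAt (by simp)).hasFDerivAt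
  have ddA := ((hA.fderiv_right (m := ∞) le_rfl).differentiableAt (by simp))
  have key (u v : E) : fderiv ℝ (fun z => covEnd Γ A z v) x u = fderiv ℝ (fderiv ℝ A) x u v +
      (fderiv ℝ Γ x u v * A x - A x * fderiv ℝ Γ x u v) +
      (Γ x v * fderiv ℝ A x u - fderiv ℝ A x u * Γ x v) := by
    have h := (hasFDerivAt_apply_const ddA v).add
      (((hasFDerivAt_apply_const dΓ v).mul' dA).sub (dA.mul' (hasFDerivAt_apply_const dΓ v)))
    have e : (fun z => covEnd Γ A z v) =
        (fun z => fderiv ℝ A z v) + ((fun z => Γ z v) * A - A * (fun z => Γ z v)) := by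
      ext1 z; simp [covEnd_apply]
    rw [e, h.fderiv]
    simp
    abel
  have hs : fderiv ℝ (fderiv ℝ A) x u v = fderiv ℝ (fderiv ℝ A) x v u :=
    hA.isSymmSndFDerivAt (by simpa using ENat.LEInfty.out) _ _
  rw [covEnd_apply (A := fun z => covEnd Γ A z v) u, covEnd_apply (A := fun z => covEnd Γ A z u) v,
    key, key, hs, covEnd_apply, covEnd_apply, coordCurvature]
  noncomm_ring

/-- `coordCurvature` as a bilinear map. -/
def coordCurvatureL (Γ : E → E →L[ℝ] E →L[ℝ] E) (x : E) : E →ₗ[ℝ] E →ₗ[ℝ] (E →L[ℝ] E) :=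
  LinearMap.mk₂ ℝ (coordCurvature Γ x)
    (fun u u' v => by simp only [coordCurvature, map_add, add_apply]; noncomm_ring)
    (fun c u v => by
      simp only [coordCurvature, map_smul, smul_apply, smul_mul_assoc, mul_smul_comm]; module)
    (fun u v v' => by simp only [coordCurvature, map_add, add_apply]; noncomm_ring)
    (fun c u v => by
      simp only [coordCurvature, map_smul, smul_apply, smul_mul_assoc, mul_smul_comm]; module)

lemma coordCurvatureL_apply (u v : E) : coordCurvatureL Γ x u v = coordCurvature Γ x u v := rfl

lemma coordCurvature_bianchi (hΓ : ContDiffAt ℝ ∞ Γ x)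
    (hsymm : ∀ᶠ z in 𝓝 x, ∀ u v, Γ z u v = Γ z v u) (u v w : E) :
    coordCurvature Γ x u v w + coordCurvature Γ x v w u + coordCurvature Γ x w u v = 0 := by
  have hd (u v w : E) : fderiv ℝ Γ x u v w = fderiv ℝ Γ x u w v := by
    have dΓ := hΓ.differentiableAt (n := ∞) (by simp)
    have h (v w : E) := ((hasFDerivAt_apply_const dΓ v).clm_apply (hasFDerivAt_const w x))
    have e : (fun z => Γ z v w) =ᶠ[𝓝 x] fun z => Γ z w v := by
      filter_upwards [hsymm] with z hz using hz v w
    have := congrArg (fun T : E →L[ℝ] E => T u) (((h v w).fderiv.symm.trans e.fderiv_eq).trans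
      (h w v).fderiv)
    simpa using this
  have s := hsymm.self_of_nhds
  simp only [coordCurvature, add_apply, sub_apply, mul_apply_eq_comp]
  rw [hd v u w, hd w v u, hd u w v, s v w, s w u, s u v]
  abel

/-- The curvature of a metric connection is skew-symmetric. -/
lemma coordCurvature_skew {g : E → E →L[ℝ] E →L[ℝ] ℝ} (hΓ : ContDiffAt ℝ ∞ Γ x)
    (hg : ContDiffAt ℝ ∞ g x) (hmetric : ∀ᶠ z in 𝓝 x, ∀ u v w,
      fderiv ℝ g z u v w = g z (Γ z u v) w + g z v (Γ z u w)) (u v w w' : E) :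
    g x (coordCurvature Γ x u v w) w' = -g x w (coordCurvature Γ x u v w') := by
  have dΓ := hΓ.differentiableAt (n := ∞) (by simp)
  have dg := (hg.differentiableAt (n := ∞) (by simp)).hasFDerivAt
  have m := hmetric.self_of_nhds
  have hG : ContDiffAt ℝ ∞ (fun z => g z w w') x :=
    (hg.clm_apply contDiffAt_const).clm_apply contDiffAt_const
  have ddG := (hG.fderiv_right (m := ∞) le_rfl).differentiableAt (by simp)
  have hg' : ∀ᶠ z in 𝓝 x, DifferentiableAt ℝ g z :=
    ((hg.of_le (m := 1) (by simp)).eventually (by simp)).mono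
      fun z hz => hz.differentiableAt (by simp)
  have key (u v : E) : fderiv ℝ (fderiv ℝ fun z => g z w w') x u v =
      fderiv ℝ g x u (Γ x v w) w' + g x (fderiv ℝ Γ x u v w) w'
        + (fderiv ℝ g x u w (Γ x v w') + g x w (fderiv ℝ Γ x u v w')) := by
    have e : (fun z => fderiv ℝ (fun z => g z w w') z v) =ᶠ[𝓝 x]
        fun z => g z (Γ z v w) w' + g z w (Γ z v w') := by
      filter_upwards [hmetric, hg'] with z hz hgz
      have h := (hgz.hasFDerivAt.clm_apply (hasFDerivAt_const w z)).clm_apply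
        (hasFDerivAt_const w' z)
      rw [← hz v w w', h.fderiv]
      simp
    have h1 := hasFDerivAt_apply_const ddG v
    have hΓw (w : E) := (hasFDerivAt_apply_const dΓ v).clm_apply (hasFDerivAt_const w x)
    have h2 := ((dg.clm_apply (hΓw w)).clm_apply (hasFDerivAt_const w' x)).fun_add
      ((dg.clm_apply (hasFDerivAt_const w x)).clm_apply (hΓw w'))
    have := congrArg (fun T : E →L[ℝ] ℝ => T u) ((h1.fderiv.symm.trans e.fderiv_eq).trans h2.fderiv)
    simp at this
    linarith
  -- The Hessian of `z ↦ g_z(w, w')` is symmetric. Expanding both sides with the metric equation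
  -- leaves exactly the two curvature terms, with sum zero.
  have hs : fderiv ℝ (fderiv ℝ fun z => g z w w') x u v =
      fderiv ℝ (fderiv ℝ fun z => g z w w') x v u :=
    hG.isSymmSndFDerivAt (by simpa using ENat.LEInfty.out) _ _
  rw [key u v, key v u] at hs
  simp only [m] at hs
  simp only [coordCurvature, add_apply, sub_apply, mul_apply_eq_comp, map_add, map_sub]
  linarith

end LocalAnalysis

/-! ### Local quaternionic-Kähler data -/

section Bochner

set_option synthInstance.maxHeartbeats 400000
set_option maxHeartbeats 1000000

variable {E : Type*} [NormedAddCommGroup E] [NormedSpace ℝ E] [FiniteDimensional ℝ E]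
  {Γ : E → E →L[ℝ] E →L[ℝ] E} {A B : E → E →L[ℝ] E} {x : E}

lemma covEnd_congr (h : A =ᶠ[𝓝 x] B) : covEnd Γ A x = covEnd Γ B x := by
  rw [covEnd, covEnd, h.fderiv_eq, h.self_of_nhds]

/-- The connection terms cancel because the trace form is invariant under commutators; no property
of `Γ` is needed. -/
lemma fderiv_qInner (hA : DifferentiableAt ℝ A x) (hB : DifferentiableAt ℝ B x) (u : E) :
    fderiv ℝ (fun z => qInner (A z) (B z)) x u =
      qInner (covEnd Γ A x u) (B x) + qInner (A x) (covEnd Γ B x u) := by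
  rw [HasFDerivAt.qInner hA.hasFDerivAt hB.hasFDerivAt, covEnd_apply, covEnd_apply,
    qInner_add_left, qInner_add_right, qInner_commutator, qInner_comm (A x) (_ - _),
    qInner_commutator, ← neg_sub (A x * B x), qInner_neg_right]
  ring

lemma covEnd_smul {φ : E → ℝ} (hφ : DifferentiableAt ℝ φ x) (hA : DifferentiableAt ℝ A x) (u : E) :
    covEnd Γ (fun z => φ z • A z) x u = fderiv ℝ φ x u • A x + φ x • covEnd Γ A x u := by
  have h := (hφ.hasFDerivAt.fun_smul hA.hasFDerivAt).fderiv
  rw [covEnd_apply, covEnd_apply, h]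
  simp only [add_apply, smul_apply, ContinuousLinearMap.smulRight_apply, smul_mul_assoc,
    mul_smul_comm, smul_add, smul_sub]
  abel

lemma covEnd_add (hA : DifferentiableAt ℝ A x) (hB : DifferentiableAt ℝ B x) (u : E) :
    covEnd Γ (fun z => A z + B z) x u = covEnd Γ A x u + covEnd Γ B x u := by
  rw [covEnd_apply, covEnd_apply, covEnd_apply, (hA.hasFDerivAt.fun_add hB.hasFDerivAt).fderiv]
  simp only [add_apply, mul_add, add_mul]
  abel

lemma covEnd_sum_smul {φ : Fin 3 → E → ℝ} {J : Fin 3 → E → E →L[ℝ] E}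
    (hφ : ∀ i, DifferentiableAt ℝ (φ i) x) (hJ : ∀ i, DifferentiableAt ℝ (J i) x) (u : E) :
    covEnd Γ (fun z => ∑ i, φ i z • J i z) x u =
      ∑ i, (fderiv ℝ (φ i) x u • J i x + φ i x • covEnd Γ (J i) x u) := by
  simp only [Fin.sum_univ_three]
  rw [covEnd_add (((hφ 0).fun_smul (hJ 0)).fun_add ((hφ 1).fun_smul (hJ 1)))
    ((hφ 2).fun_smul (hJ 2)), covEnd_add ((hφ 0).fun_smul (hJ 0)) ((hφ 1).fun_smul (hJ 1)),
    covEnd_smul (hφ 0) (hJ 0), covEnd_smul (hφ 1) (hJ 1), covEnd_smul (hφ 2) (hJ 2)]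

lemma fderiv_apply_eq (u v : E) : fderiv ℝ A x u v =
    covEnd Γ A x u v - Γ x u (A x v) + A x (Γ x u v) := by
  rw [covEnd_apply]
  simp only [add_apply, sub_apply, mul_apply_eq_comp]
  abel

/-- The local data of a quaternionic-Kähler metric on an open subset `U` of `E`: the Christoffel
symbols `Γ`, the metric `g`, the quaternionic structure `Q` and an admissible frame `J`. -/
structure IsQuaternionicKahlerOn (U : Set E) (Γ : E → E →L[ℝ] E →L[ℝ] E)
    (g : E → E →L[ℝ] E →L[ℝ] ℝ) (Q : E → Submodule ℝ (E →L[ℝ] E))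
    (J : Fin 3 → E → E →L[ℝ] E) : Prop where
  isOpen : IsOpen U
  christoffel_smooth : ∀ z ∈ U, ContDiffAt ℝ ∞ Γ z
  metric_smooth : ∀ z ∈ U, ContDiffAt ℝ ∞ g z
  frame_smooth : ∀ i, ∀ z ∈ U, ContDiffAt ℝ ∞ (J i) z
  symm : ∀ z ∈ U, ∀ u v, Γ z u v = Γ z v u
  metric : ∀ z ∈ U, ∀ u v w, fderiv ℝ g z u v w = g z (Γ z u v) w + g z v (Γ z u w)
  admissible : ∀ z ∈ U, IsAdmissibleBasis (Q z) (fun i => J i z)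
  covEnd_frame_mem : ∀ z ∈ U, ∀ i u, covEnd Γ (J i) z u ∈ Q z
  skew : ∀ z ∈ U, ∀ C ∈ Q z, ∀ u v, g z (C u) v = -g z u (C v)

namespace IsQuaternionicKahlerOn

variable {U : Set E} {g : E → E →L[ℝ] E →L[ℝ] ℝ} {Q : E → Submodule ℝ (E →L[ℝ] E)}
  {J : Fin 3 → E → E →L[ℝ] E} (hU : IsQuaternionicKahlerOn U Γ g Q J)

include hU

lemma mem_nhds (hx : x ∈ U) : U ∈ 𝓝 x := hU.isOpen.mem_nhds hx

lemma frame_diff (hx : x ∈ U) (i : Fin 3) : DifferentiableAt ℝ (J i) x :=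
  (hU.frame_smooth i x hx).differentiableAt (by simp)

lemma eq_sum [Nontrivial E] (hA : ∀ z ∈ U, A z ∈ Q z) (hx : x ∈ U) :
    A =ᶠ[𝓝 x] fun z => ∑ i, qInner (A z) (J i z) • J i z := by
  filter_upwards [hU.mem_nhds hx] with z hz using (hU.admissible z hz).eq_sum (hA z hz)

lemma covEnd_mem [Nontrivial E] (hA : ∀ z ∈ U, A z ∈ Q z) (hAs : ContDiffAt ℝ ∞ A x)
    (hx : x ∈ U) (u : E) : covEnd Γ A x u ∈ Q x := by
  rw [covEnd_congr (hU.eq_sum hA hx), covEnd_sum_smul (fun i =>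
    (ContDiffAt.qInner hAs (hU.frame_smooth i x hx)).differentiableAt (by simp))
    (hU.frame_diff hx)]
  exact Submodule.sum_mem _ fun i _ => Submodule.add_mem _
    (Submodule.smul_mem _ _ ((hU.admissible x hx).mem i))
    (Submodule.smul_mem _ _ (hU.covEnd_frame_mem x hx i u))

/-- The Levi-Civita symmetries come from torsion-freeness and the metric equation. For the
commutator, `C` is extended with constant coefficients in the frame and the Ricci identity is
applied: both second covariant derivatives stay in `Q`. -/
lemma isQuaternionicCurvature [Nontrivial E] (hx : x ∈ U) :
    IsQuaternionicCurvature (g x) (Q x) (coordCurvatureL Γ x) where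
  antisymm u v := by
    simp only [coordCurvatureL_apply, coordCurvature]; abel
  skew := coordCurvature_skew (hU.christoffel_smooth x hx) (hU.metric_smooth x hx)
    (Filter.mem_of_superset (hU.mem_nhds hx) fun z hz => hU.metric z hz)
  bianchi := coordCurvature_bianchi (hU.christoffel_smooth x hx)
    (Filter.mem_of_superset (hU.mem_nhds hx) fun z hz => hU.symm z hz)
  commutator_mem u v C hC := by
    set A : E → E →L[ℝ] E := fun z => ∑ i, qInner C (J i x) • J i z with hAdef
    have hAx : A x = C := ((hU.admissible x hx).eq_sum hC).symm
    have hA : ∀ z ∈ U, A z ∈ Q z := fun z hz => Submodule.sum_mem _ fun i _ =>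
      Submodule.smul_mem _ _ ((hU.admissible z hz).mem i)
    have hAs : ∀ z ∈ U, ContDiffAt ℝ ∞ A z := fun z hz => ContDiffAt.sum fun i _ =>
      (hU.frame_smooth i z hz).const_smul _
    have hcs := ContDiffAt.covEnd (hU.christoffel_smooth x hx) (hAs x hx)
    have hm (u v : E) : covEnd Γ (fun z => covEnd Γ A z v) x u ∈ Q x :=
      hU.covEnd_mem (fun z hz => hU.covEnd_mem hA (hAs z hz) hz v)
        (hcs.clm_apply contDiffAt_const) hx u
    rw [← hAx, coordCurvatureL_apply,
      ← covEnd_covEnd_sub (hU.christoffel_smooth x hx) (hAs x hx)]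
    exact Submodule.sub_mem _ (hm u v) (hm v u)

/-- Differentiation of the constant products `⟨Jᵢ, Jⱼ⟩`. -/
lemma qInner_covEnd_frame [Nontrivial E] (hx : x ∈ U) (i j : Fin 3) (u : E) :
    qInner (covEnd Γ (J i) x u) (J j x) = -qInner (covEnd Γ (J j) x u) (J i x) := by
  have e : (fun z => qInner (J i z) (J j z)) =ᶠ[𝓝 x] fun _ => if i = j then 1 else 0 := by
    filter_upwards [hU.mem_nhds hx] with z hz using (hU.admissible z hz).qInner_eq i j
  have h := fderiv_qInner (Γ := Γ) (hU.frame_diff hx i) (hU.frame_diff hx j) u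
  rw [e.fderiv_eq, fderiv_fun_const] at h
  rw [qInner_comm (covEnd Γ (J j) x u)]
  simp only [Pi.zero_apply, zero_apply] at h
  linarith

end IsQuaternionicKahlerOn

end Bochner

/-! ### The twistor equation and its Bochner formula -/

section Twistor

set_option synthInstance.maxHeartbeats 400000
set_option maxHeartbeats 1000000

variable {E : Type*} [NormedAddCommGroup E] [NormedSpace ℝ E] [FiniteDimensional ℝ E]

lemma IsAdmissibleBasis.qInner_eq_sum [Nontrivial E] {Q : Submodule ℝ (E →L[ℝ] E)}
    {J : Fin 3 → E →L[ℝ] E} (h : IsAdmissibleBasis Q J) {A : E →L[ℝ] E} (hA : A ∈ Q)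
    (B : E →L[ℝ] E) : qInner A B = ∑ i, qInner A (J i) * qInner (J i) B := by
  conv_lhs => rw [h.eq_sum hA]
  exact qInner_sum_left _ _ _

lemma IsAdmissibleBasis.apply_eq_sum [Nontrivial E] {Q : Submodule ℝ (E →L[ℝ] E)}
    {J : Fin 3 → E →L[ℝ] E} (h : IsAdmissibleBasis Q J) {A : E →L[ℝ] E} (hA : A ∈ Q)
    (u : E) : A u = ∑ i, qInner A (J i) • J i u := by
  conv_lhs => rw [h.eq_sum hA]
  simp [_root_.sum_apply]

lemma IsAdmissibleBasis.apply_apply [Nontrivial E] {Q : Submodule ℝ (E →L[ℝ] E)}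
    {J : Fin 3 → E →L[ℝ] E} (h : IsAdmissibleBasis Q J) {A : E →L[ℝ] E} (hA : A ∈ Q)
    (u : E) : A (A u) = -qInner A A • u := by
  have e : A * A = -qInner A A • (1 : E →L[ℝ] E) := by
    have hf := h.qInner_eq_sum hA A
    simp_rw [qInner_comm (J _) A] at hf
    rw [hf]
    conv_lhs => rw [h.eq_sum hA]
    simp only [Fin.sum_univ_three, add_mul, mul_add, smul_mul_assoc, mul_smul_comm, h.sq, h.mul,
      h.mul_one_zero, h.mul_zero_two, h.mul_two_zero, h.mul_two_one, h.mul_one_two]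
    module
  simpa using congrArg (fun T : E →L[ℝ] E => T u) e

/-- If `C` is skew-symmetric with `C² = -c`, then `∑ φ(C eᵢ)² = c ∑ φ(eᵢ)²`. -/
lemma IsOrthonormalBasis.sum_sq_comp {ι : Type*} [Fintype ι] [DecidableEq ι]
    {g : E →L[ℝ] E →L[ℝ] ℝ} {b : Module.Basis ι ℝ E} (h : IsOrthonormalBasis g b)
    {C : E →L[ℝ] E} (hC : ∀ u v, g (C u) v = -g u (C v)) {c : ℝ} (hCC : ∀ u, C (C u) = -c • u)
    (φ : E →L[ℝ] ℝ) : ∑ i, φ (C (b i)) ^ 2 = c * ∑ i, φ (b i) ^ 2 := by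
  have := h.sum_skew hC (LinearMap.mk₂ ℝ (fun u v => φ u * φ (C v))
    (fun _ _ _ => by simp [add_mul]) (fun _ _ _ => by simp [mul_assoc])
    (fun _ _ _ => by simp [mul_add]) (fun _ _ _ => by simp; ring))
  simp only [LinearMap.mk₂_apply, hCC, map_smul, smul_eq_mul] at this
  simp_rw [sq]
  rw [this, Finset.mul_sum, ← Finset.sum_neg_distrib]
  exact Finset.sum_congr rfl fun i _ => by ring

variable {Γ : E → E →L[ℝ] E →L[ℝ] E} {A : E → E →L[ℝ] E} {x : E}
  {U : Set E} {g : E → E →L[ℝ] E →L[ℝ] ℝ} {Q : E → Submodule ℝ (E →L[ℝ] E)}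
  {J : Fin 3 → E → E →L[ℝ] E} {α : E → E →L[ℝ] ℝ}

/-- `A` is a section of `Q` over `U` with `∇ A = 2 α ⊗ A + ∑ᵢ (β ∘ Jᵢ) ⊗ Jᵢ` for some `1`-form
`β`. -/
structure IsTwistorOn (U : Set E) (Γ : E → E →L[ℝ] E →L[ℝ] E) (Q : E → Submodule ℝ (E →L[ℝ] E))
    (J : Fin 3 → E → E →L[ℝ] E) (α : E → E →L[ℝ] ℝ) (A : E → E →L[ℝ] E)
    (β : E → E →L[ℝ] ℝ) : Prop where
  form_smooth : ∀ z ∈ U, ContDiffAt ℝ ∞ α z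
  smooth : ∀ z ∈ U, ContDiffAt ℝ ∞ A z
  beta_smooth : ∀ z ∈ U, ContDiffAt ℝ ∞ β z
  mem : ∀ z ∈ U, A z ∈ Q z
  eq : ∀ z ∈ U, ∀ u, covEnd Γ A z u = (2 * α z u) • A z + ∑ i, β z (J i z u) • J i z

/-- The form `β` in a twistor equation is automatically smooth. -/
lemma exists_isTwistorOn [Nontrivial E] (hU : IsQuaternionicKahlerOn U Γ g Q J)
    (hα : ∀ z ∈ U, ContDiffAt ℝ ∞ α z) (hA : ∀ z ∈ U, ContDiffAt ℝ ∞ A z)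
    (hQ : ∀ z ∈ U, A z ∈ Q z)
    (h : ∀ z ∈ U, ∃ β : E →L[ℝ] ℝ, ∀ u, covEnd Γ A z u = (2 * α z u) • A z +
      ∑ i, β (J i z u) • J i z) : ∃ β, IsTwistorOn U Γ Q J α A β := by
  classical
  choose β hβ using h
  let β' : E → E →L[ℝ] ℝ := fun z => if hz : z ∈ U then β z hz else 0
  have hβ' (z) (hz : z ∈ U) : β' z = β z hz := dif_pos hz
  -- The `J₀` component of the equation in the direction `J₀ u` contains `β(J₀ J₀ u) = -β(u)`, which
  -- expresses `β` by smooth data.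
  have key (z) (hz : z ∈ U) (u : E) : β' z u = -(qInner (covEnd Γ A z (J 0 z u)) (J 0 z)
      - (2 * α z (J 0 z u)) * qInner (A z) (J 0 z)) := by
    rw [hβ' z hz, hβ z hz, qInner_add_left, qInner_smul_left, qInner_sum_left]
    simp only [(hU.admissible z hz).qInner_eq]
    simp [(hU.admissible z hz).apply_self 0]
  refine ⟨β', hα, hA, fun z hz => ?_, hQ, fun z hz u => by rw [hβ' z hz, ← hβ z hz]⟩
  refine contDiffAt_clm_of_apply fun u => ?_
  have hJ := hU.frame_smooth 0 z hz
  have hJu : ContDiffAt ℝ ∞ (fun z => J 0 z u) z := hJ.clm_apply contDiffAt_const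
  have hF := ContDiffAt.covEnd (hU.christoffel_smooth z hz) (hA z hz)
  refine ContDiffAt.congr_of_eventuallyEq (f := fun z => -(qInner (covEnd Γ A z (J 0 z u)) (J 0 z)
      - (2 * α z (J 0 z u)) * qInner (A z) (J 0 z))) ?_ ?_
  · exact ((ContDiffAt.qInner (hF.clm_apply hJu) hJ).sub
      ((contDiffAt_const.mul ((hα z hz).clm_apply hJu)).mul (ContDiffAt.qInner (hA z hz) hJ))).neg
  · filter_upwards [hU.mem_nhds hz] with y hy using key y hy u

namespace IsTwistorOn

variable {β : E → E →L[ℝ] ℝ} (hU : IsQuaternionicKahlerOn U Γ g Q J)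
  (hA : IsTwistorOn U Γ Q J α A β)

include hU hA

lemma qInner_covEnd [Nontrivial E] (hx : x ∈ U) (u : E) (k : Fin 3) :
    qInner (covEnd Γ A x u) (J k x) = 2 * α x u * qInner (A x) (J k x) + β x (J k x u) := by
  rw [hA.eq x hx, qInner_add_left, qInner_smul_left, qInner_sum_left]
  simp only [(hU.admissible x hx).qInner_eq]
  simp

/-- Second derivative of `A` read off from the twistor equation. The derivatives of the frame drop
out, since the canonical element `∑ Jᵢ ⊗ Jᵢ` is parallel. -/
lemma qInner_covEnd_covEnd [Nontrivial E] (hx : x ∈ U) (u v : E) (k : Fin 3) :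
    qInner (covEnd Γ (fun z => covEnd Γ A z v) x u) (J k x) =
      2 * fderiv ℝ α x u v * qInner (A x) (J k x) +
      2 * α x v * (2 * α x u * qInner (A x) (J k x) + β x (J k x u)) +
      fderiv ℝ β x u (J k x v) - β x (Γ x u (J k x v)) + β x (J k x (Γ x u v)) := by
  have dα := (hA.form_smooth x hx).differentiableAt (by simp)
  have dβ := (hA.beta_smooth x hx).differentiableAt (by simp)
  have dA := (hA.smooth x hx).differentiableAt (by simp)
  have dJ := hU.frame_diff hx
  have e : (fun z => covEnd Γ A z v) =ᶠ[𝓝 x]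
      fun z => (2 * α z v) • A z + ∑ i, β z (J i z v) • J i z := by
    filter_upwards [hU.mem_nhds hx] with z hz using hA.eq z hz v
  have h1 := (hasFDerivAt_apply_const dα v).const_mul 2
  have h2 (i) := dβ.hasFDerivAt.clm_apply (hasFDerivAt_apply_const (dJ i) v)
  have d2 (i) : DifferentiableAt ℝ (fun z => β z (J i z v)) x := (h2 i).differentiableAt
  have d3 : DifferentiableAt ℝ (fun z => ∑ i, β z (J i z v) • J i z) x :=
    DifferentiableAt.fun_sum fun i _ => (d2 i).fun_smul (dJ i)
  rw [covEnd_congr e, covEnd_add (h1.differentiableAt.fun_smul dA) d3,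
    covEnd_smul h1.differentiableAt dA, covEnd_sum_smul d2 dJ, h1.fderiv, qInner_add_left,
    qInner_add_left, qInner_smul_left, qInner_smul_left, hA.qInner_covEnd hU hx,
    Finset.sum_add_distrib, qInner_add_left, qInner_sum_left, qInner_sum_left]
  simp only [(hU.admissible x hx).qInner_eq, mul_ite, mul_one, mul_zero, Finset.sum_ite_eq',
    Finset.mem_univ, if_true]
  rw [(h2 k).fderiv]
  -- Antisymmetry of the frame's connection coefficients makes the derivative of `β ∘ J_k` cancel
  -- that of the factors `Jᵢ`.
  have e3 : β x (covEnd Γ (J k) x u v) =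
      -∑ i, β x (J i x v) * qInner (covEnd Γ (J i) x u) (J k x) := by
    rw [(hU.admissible x hx).apply_eq_sum (hU.covEnd_frame_mem x hx k u), map_sum,
      ← Finset.sum_neg_distrib]
    refine Finset.sum_congr rfl fun i _ => ?_
    rw [map_smul, smul_eq_mul, hU.qInner_covEnd_frame hx k i]; ring
  have e4 := fderiv_apply_eq (Γ := Γ) (A := J k) (x := x) u v
  simp only [add_apply, smul_apply, ContinuousLinearMap.flip_apply, smul_eq_mul,
    ContinuousLinearMap.comp_apply, e4, map_add, map_sub, e3]
  ring

/-- The failure of `B(u, w) = (∇_u β)(w) - 2 α(u) β(w)` to be symmetric is a curvature term. -/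
lemma sub_eq [Nontrivial E] (hx : x ∈ U) (u v : E) (k : Fin 3) :
    (fderiv ℝ β x u (J k x v) - β x (Γ x u (J k x v)) - 2 * α x u * β x (J k x v)) -
    (fderiv ℝ β x v (J k x u) - β x (Γ x v (J k x u)) - 2 * α x v * β x (J k x u)) =
    qInner (coordCurvature Γ x u v * A x - A x * coordCurvature Γ x u v) (J k x) +
      qInner (A x) (J k x) * (-2 * (fderiv ℝ α x u v - fderiv ℝ α x v u)) := by
  rw [← covEnd_covEnd_sub (hU.christoffel_smooth x hx) (hA.smooth x hx), qInner_sub_left,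
    hA.qInner_covEnd_covEnd hU hx, hA.qInner_covEnd_covEnd hU hx, hU.symm x hx v u]
  ring

/-- The algebraic trace identity applied to `B(u,w) = (∇_uβ)(w) - 2α(u)β(w)`, with `η = -2 dα`. -/
lemma sum_trace {ι : Type*} [Fintype ι] [DecidableEq ι] {b : Module.Basis ι ℝ E} (hx : x ∈ U)
    (hb : IsOrthonormalBasis (g x) b) (hE : 4 < Module.finrank ℝ E) :
    (Module.finrank ℝ E + 8) * ∑ i, (fderiv ℝ β x (b i) (A x (b i))
      - β x (Γ x (b i) (A x (b i))) - 2 * α x (b i) * β x (A x (b i))) =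
    -2 * (∑ k, ricciForm (g x) b (coordCurvatureL Γ x) (b k) (b k)) * qInner (A x) (A x) := by
  have : Nontrivial E := Module.nontrivial_of_finrank_pos (R := ℝ) (by omega)
  refine (hU.isQuaternionicCurvature hx).sum_apply hb (hU.admissible x hx) (hU.skew x hx) hE
    (hA.mem x hx)
    (B := LinearMap.mk₂ ℝ (fun u w => fderiv ℝ β x u w - β x (Γ x u w) - 2 * α x u * β x w)
      (fun _ _ _ => by simp; ring) (fun _ _ _ => by simp; ring)
      (fun _ _ _ => by simp; ring) (fun _ _ _ => by simp; ring))
    (η := LinearMap.mk₂ ℝ (fun u v => -2 * (fderiv ℝ α x u v - fderiv ℝ α x v u))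
      (fun _ _ _ => by simp; ring) (fun _ _ _ => by simp; ring)
      (fun _ _ _ => by simp; ring) (fun _ _ _ => by simp; ring)) ?_
  intro k u v
  exact hA.sub_eq hU hx u v k

/-- Pairing the twistor equation with `A` turns `∑ β(Jᵢ u)⟨Jᵢ, A⟩` into `β(A u)`. -/
lemma fderiv_normSq [Nontrivial E] (hx : x ∈ U) (u : E) :
    fderiv ℝ (fun z => qInner (A z) (A z)) x u =
      4 * α x u * qInner (A x) (A x) + 2 * β x (A x u) := by
  have dA := (hA.smooth x hx).differentiableAt (by simp)
  have hQ := hA.mem x hx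
  have hJ := hU.admissible x hx
  rw [fderiv_qInner (Γ := Γ) dA dA, qInner_comm (covEnd Γ A x u),
    hJ.qInner_eq_sum hQ (covEnd _ _ _ _),
    hJ.qInner_eq_sum hQ (A x), hJ.apply_eq_sum hQ, map_sum]
  simp_rw [qInner_comm (J _ x), hA.qInner_covEnd hU hx, map_smul, smul_eq_mul,
    Fin.sum_univ_three]
  ring

lemma hessian_normSq [Nontrivial E] (hx : x ∈ U) (u v : E) :
    fderiv ℝ (fderiv ℝ fun z => qInner (A z) (A z)) x u v
      - fderiv ℝ (fun z => qInner (A z) (A z)) x (Γ x u v) =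
    4 * (fderiv ℝ α x u v - α x (Γ x u v)) * qInner (A x) (A x)
      + 4 * α x v * fderiv ℝ (fun z => qInner (A z) (A z)) x u
      + 2 * (fderiv ℝ β x u (A x v) - β x (Γ x u (A x v))) + 2 * β x (covEnd Γ A x u v) := by
  have dα := (hA.form_smooth x hx).differentiableAt (by simp)
  have dβ := (hA.beta_smooth x hx).differentiableAt (by simp)
  have dA := (hA.smooth x hx).differentiableAt (by simp)
  have hf : ContDiffAt ℝ ∞ (fun z => qInner (A z) (A z)) x :=
    ContDiffAt.qInner (hA.smooth x hx) (hA.smooth x hx)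
  have ddf := (hf.fderiv_right (m := ∞) le_rfl).differentiableAt (by simp)
  have df := (hf.differentiableAt (by simp)).hasFDerivAt
  have e : (fun z => fderiv ℝ (fun z => qInner (A z) (A z)) z v) =ᶠ[𝓝 x]
      fun z => 4 * α z v * qInner (A z) (A z) + 2 * β z (A z v) := by
    filter_upwards [hU.mem_nhds hx] with z hz using hA.fderiv_normSq hU hz v
  have h1 := hasFDerivAt_apply_const ddf v
  have h2 := (((hasFDerivAt_apply_const dα v).const_mul 4).fun_mul df).fun_add
    ((dβ.hasFDerivAt.clm_apply (hasFDerivAt_apply_const dA v)).const_mul 2)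
  have h := congrArg (fun T : E →L[ℝ] ℝ => T u) ((h1.fderiv.symm.trans e.fderiv_eq).trans h2.fderiv)
  simp only [add_apply, smul_apply, ContinuousLinearMap.flip_apply, smul_eq_mul,
    ContinuousLinearMap.comp_apply, fderiv_apply_eq (Γ := Γ) (A := A) (x := x) u v, map_add,
    map_sub] at h
  rw [h, hA.fderiv_normSq hU hx (Γ x u v)]
  ring

/-- The Bochner formula for the squared norm of a solution of the twistor equation. -/
lemma bochner {ι : Type*} [Fintype ι] [DecidableEq ι] {b : Module.Basis ι ℝ E} (hx : x ∈ U)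
    (hb : IsOrthonormalBasis (g x) b) (hE : 4 < Module.finrank ℝ E)
    (hdiv : ∑ i, (fderiv ℝ α x (b i) (b i) - α x (Γ x (b i) (b i))) = 0) {f : E → ℝ}
    (hf : f = fun z => qInner (A z) (A z)) :
    (Module.finrank ℝ E + 8) * (f x * (∑ i, (fderiv ℝ (fderiv ℝ f) x (b i) (b i)
        - fderiv ℝ f x (Γ x (b i) (b i))) + 4 * ∑ i, α x (b i) * fderiv ℝ f x (b i))
      - 8 * (∑ i, α x (b i) ^ 2) * f x ^ 2 - 3 / 2 * ∑ i, fderiv ℝ f x (b i) ^ 2) =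
    -4 * (∑ k, ricciForm (g x) b (coordCurvatureL Γ x) (b k) (b k)) * f x ^ 2 := by
  have : Nontrivial E := Module.nontrivial_of_finrank_pos (R := ℝ) (by omega)
  have hfx : qInner (A x) (A x) = f x := by rw [hf]
  have hJ := hU.admissible x hx
  have hW := hA.sum_trace hU hx hb hE
  -- As `A² = -|A|²` and `Jₖ² = -1`, `|β ∘ A|² = f|β|²` and `|β ∘ Jₖ|² = |β|²`.
  have hβ := hb.sum_sq_comp (hU.skew x hx _ (hA.mem x hx)) (hJ.apply_apply (hA.mem x hx)) (β x)
  have hβJ (k) := hb.sum_sq_comp (hU.skew x hx _ (hJ.mem k)) (c := 1)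
    (fun u => by simpa using hJ.apply_self k u) (β x)
  have hd (i) : β x (A x (b i)) = (fderiv ℝ f x (b i) - 4 * α x (b i) * f x) / 2 := by
    have := hA.fderiv_normSq hU hx (b i)
    rw [← hf, hfx] at this
    linarith
  have hH (i) := hA.hessian_normSq hU hx (b i) (b i)
  simp_rw [hA.eq x hx, ← hf, hfx] at hH
  simp only [add_apply, smul_apply, map_add, map_smul, smul_eq_mul,
    Fin.sum_univ_three] at hH
  rw [hfx] at hβ hW
  have hsum : ∑ i, (fderiv ℝ (fderiv ℝ f) x (b i) (b i) - fderiv ℝ f x (Γ x (b i) (b i))) =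
      4 * f x * ∑ i, (fderiv ℝ α x (b i) (b i) - α x (Γ x (b i) (b i)))
      + 8 * ∑ i, α x (b i) * fderiv ℝ f x (b i) - 16 * f x * ∑ i, α x (b i) ^ 2
      + 2 * ∑ i, (fderiv ℝ β x (b i) (A x (b i))
        - β x (Γ x (b i) (A x (b i))) - 2 * α x (b i) * β x (A x (b i)))
      + 2 * (∑ i, β x (J 0 x (b i)) ^ 2 + ∑ i, β x (J 1 x (b i)) ^ 2
        + ∑ i, β x (J 2 x (b i)) ^ 2) := by
    simp only [Finset.mul_sum, ← Finset.sum_add_distrib, ← Finset.sum_sub_distrib]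
    refine Finset.sum_congr rfl fun i _ => ?_
    rw [hH, hd]
    ring
  have hsq : ∑ i, β x (A x (b i)) ^ 2 = 1 / 4 * ∑ i, fderiv ℝ f x (b i) ^ 2
      - 2 * f x * ∑ i, α x (b i) * fderiv ℝ f x (b i) + 4 * f x ^ 2 * ∑ i, α x (b i) ^ 2 := by
    simp only [Finset.mul_sum, ← Finset.sum_add_distrib, ← Finset.sum_sub_distrib]
    refine Finset.sum_congr rfl fun i _ => ?_
    rw [hd]
    ring
  rw [hsum, hdiv, hβJ 0, hβJ 1, hβJ 2]
  rw [hsq] at hβ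
  -- After multiplication by `f`, the term `2W` contributes through `hW`; the three `2|β ∘ Jₖ|²`
  -- make `6f|β|² = 6|β ∘ A|²`, which `hβ` eliminates.
  linear_combination 2 * f x * hW - 6 * (Module.finrank ℝ E + 8) * hβ

end IsTwistorOn

end Twistor

/-! ### The strong maximum principle -/

section MaximumPrinciple

/-- On the line through `z` in direction `v`, a positive second derivative would make the maximum a
local minimum as well, so the function would be locally constant with second derivative zero. -/
lemma fderiv_fderiv_nonpos_of_isLocalMax {E : Type*} [NormedAddCommGroup E] [NormedSpace ℝ E]
    {F : E → ℝ} {z : E} (hF : ContDiffAt ℝ 2 F z) (hmax : IsLocalMax F z) (v : E) :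
    fderiv ℝ (fderiv ℝ F) z v v ≤ 0 := by
  by_contra! hpos
  let l : ℝ → E := fun t => z + t • v
  have hl0 : l 0 = z := by simp [l]
  have hl (t : ℝ) : HasDerivAt l v t := by
    simpa [l] using ((hasDerivAt_id t).smul_const v).const_add z
  have hlc : Filter.Tendsto l (𝓝 0) (𝓝 z) := by
    have := (hl 0).continuousAt.tendsto
    rwa [hl0] at this
  have hd : ∀ᶠ y in 𝓝 z, DifferentiableAt ℝ F y :=
    (hF.eventually (by simp)).mono fun y hy => hy.differentiableAt (by simp)
  have h1 : deriv (F ∘ l) =ᶠ[𝓝 0] fun t => fderiv ℝ F (l t) v := by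
    filter_upwards [hlc.eventually hd] with t ht
    exact (ht.hasFDerivAt.comp_hasDerivAt t (hl t)).deriv
  have h2 : HasDerivAt (fun t => fderiv ℝ F (l t) v) (fderiv ℝ (fderiv ℝ F) z v v) 0 := by
    have hdd : DifferentiableAt ℝ (fderiv ℝ F) z :=
      (hF.fderiv_right (m := 1) (by norm_num)).differentiableAt (by simp)
    have hdd' : HasFDerivAt (fderiv ℝ F) (fderiv ℝ (fderiv ℝ F) z) (l 0) := by
      rw [hl0]; exact hdd.hasFDerivAt
    have := (hdd'.comp_hasDerivAt 0 (hl 0)).clm_apply (hasDerivAt_const 0 v)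
    simpa using this
  have h3 : deriv (deriv (F ∘ l)) 0 = fderiv ℝ (fderiv ℝ F) z v v := by
    rw [h1.deriv_eq, h2.deriv]
  have hmax' : IsLocalMax (F ∘ l) 0 := by
    have : ∀ᶠ y in 𝓝 z, F y ≤ F z := hmax
    filter_upwards [hlc.eventually this] with t ht
    simpa [hl0] using ht
  have hcont : ContinuousAt (F ∘ l) 0 := by
    refine ContinuousAt.comp ?_ (hl 0).continuousAt
    rw [hl0]; exact hF.continuousAt
  have hmin : IsLocalMin (F ∘ l) 0 :=
    isLocalMin_of_deriv_deriv_pos (by rw [h3]; exact hpos) hmax'.deriv_eq_zero hcont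
  have hconst : (F ∘ l) =ᶠ[𝓝 0] fun _ => (F ∘ l) 0 := by
    filter_upwards [hmax', hmin] with t h h' using le_antisymm h h'
  have h4 : deriv (deriv (F ∘ l)) 0 = 0 := by
    have : deriv (F ∘ l) =ᶠ[𝓝 0] fun _ => 0 := by
      filter_upwards [hconst.eventuallyEq_nhds] with t ht
      rw [ht.deriv_eq]; simp
    rw [this.deriv_eq]; simp
  rw [h3] at h4
  exact hpos.ne' h4

variable {E : Type*} [NormedAddCommGroup E] [InnerProductSpace ℝ E]

/-- The barrier function of the strong maximum principle. -/
def barrier (l : ℝ) (q x : E) : ℝ := Real.exp (-(l * ‖x - q‖ ^ 2))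

lemma contDiff_barrier (l : ℝ) (q : E) {k : ℕ∞ω} : ContDiff ℝ k (barrier l q) := by
  unfold barrier
  exact Real.contDiff_exp.comp (contDiff_const.mul
    ((contDiff_id.sub contDiff_const).norm_sq ℝ)).neg

lemma hasFDerivAt_barrier (l : ℝ) (q x : E) :
    HasFDerivAt (barrier l q) ((-2 * l * barrier l q x) • innerSL ℝ (x - q)) x := by
  have h1 : HasFDerivAt (fun x : E => ‖x - q‖ ^ 2) (2 • innerSL ℝ (x - q)) x :=
    ((hasFDerivAt_id x).sub_const q).norm_sq
  have h := (h1.const_mul l).fun_neg.exp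
  refine h.congr_fderiv ?_
  rw [barrier, two_nsmul]
  module

lemma fderiv_barrier (l : ℝ) (q x v : E) :
    fderiv ℝ (barrier l q) x v = -2 * l * barrier l q x * inner ℝ (x - q) v := by
  rw [(hasFDerivAt_barrier l q x).fderiv]; rfl

lemma fderiv_fderiv_barrier (l : ℝ) (q x u v : E) :
    fderiv ℝ (fderiv ℝ (barrier l q)) x u v = barrier l q x *
      (4 * l ^ 2 * inner ℝ (x - q) u * inner ℝ (x - q) v - 2 * l * inner ℝ u v) := by
  have hd : DifferentiableAt ℝ (fderiv ℝ (barrier l q)) x :=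
    ((contDiff_barrier l q (k := ∞)).contDiffAt.fderiv_right (m := ∞) le_rfl).differentiableAt
      (by simp)
  have h1 := hd.hasFDerivAt.clm_apply (hasFDerivAt_const v x)
  have e : (fun y => fderiv ℝ (barrier l q) y v) =
      fun y => -2 * l * barrier l q y * inner ℝ (y - q) v := funext fun y => fderiv_barrier l q y v
  have h2 := ((hasFDerivAt_barrier l q x).const_mul (-2 * l)).fun_mul
    (((hasFDerivAt_id x).sub_const q).inner ℝ (hasFDerivAt_const v x))
  have h := congrArg (fun T : E →L[ℝ] ℝ => T u)
    ((h1.fderiv.symm.trans (congrArg (fun φ => fderiv ℝ φ x) e)).trans h2.fderiv)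
  simp at h
  rw [h, inner_sub_left x q u]; ring

lemma barrier_pos (l : ℝ) (q x : E) : 0 < barrier l q x := Real.exp_pos _

lemma barrier_lt_barrier {l : ℝ} (hl : 0 < l) {q x y : E} (h : ‖x - q‖ < ‖y - q‖) :
    barrier l q y < barrier l q x := by
  unfold barrier
  gcongr

variable {ι : Type*} [Fintype ι]

/-- The barrier is a strict subsolution away from its centre. -/
lemma barrier_subsolution {c C s l : ℝ} (hs : 0 < s) (hl : 0 < l)
    (hlarge : 2 * Fintype.card ι * C ^ 2 + 3 * s * C < l * c * s ^ 2) (hc : 0 < c)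
    {q x b : E} {e : ι → E} (he : ∀ i, ‖e i‖ ≤ C) (hb : ‖b‖ ≤ C)
    (hell : ∀ v, c * ‖v‖ ^ 2 ≤ ∑ i, inner ℝ v (e i) ^ 2)
    (hx1 : s / 2 ≤ ‖x - q‖) (hx2 : ‖x - q‖ ≤ 3 / 2 * s) :
    0 < ∑ i, fderiv ℝ (fderiv ℝ (barrier l q)) x (e i) (e i) + fderiv ℝ (barrier l q) x b := by
  have h1 := hell (x - q)
  have h2 : ∑ i, inner ℝ (e i) (e i) ≤ Fintype.card ι * C ^ 2 := by
    calc ∑ i, inner ℝ (e i) (e i) ≤ ∑ _i : ι, C ^ 2 := by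
          refine Finset.sum_le_sum fun i _ => ?_
          rw [real_inner_self_eq_norm_sq]
          gcongr
          exact he i
      _ = _ := by simp
  have h3 : inner ℝ (x - q) b ≤ 3 / 2 * s * C :=
    (real_inner_le_norm _ _).trans (by gcongr)
  have h4 : c * (s / 2) ^ 2 ≤ c * ‖x - q‖ ^ 2 := by gcongr
  have e1 : ∑ i, fderiv ℝ (fderiv ℝ (barrier l q)) x (e i) (e i) + fderiv ℝ (barrier l q) x b =
      barrier l q x * (l * (4 * l * ∑ i, inner ℝ (x - q) (e i) ^ 2 - 2 * ∑ i, inner ℝ (e i) (e i)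
        - 2 * inner ℝ (x - q) b)) := by
    simp_rw [fderiv_fderiv_barrier, fderiv_barrier, ← Finset.mul_sum, Finset.sum_sub_distrib,
      mul_assoc, ← Finset.mul_sum, ← sq]
    ring
  rw [e1]
  refine mul_pos (barrier_pos _ _ _) (mul_pos hl ?_)
  -- Ellipticity and `‖x - q‖ ≥ s/2` bound the leading term `4l ∑⟨x - q, eᵢ⟩²` below by `l c s²`,
  -- which exceeds the other terms by `hlarge`.
  have h5 : l * (c * (s / 2) ^ 2) ≤ l * ∑ i, inner ℝ (x - q) (e i) ^ 2 := by
    gcongr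
    exact h4.trans h1
  nlinarith

/-- The strong maximum principle for locally uniformly elliptic second order operators. -/
theorem eventually_eq_of_subsolution [FiniteDimensional ℝ E] {f : E → ℝ} {U : Set E} {p : E}
    {m c C : ℝ} (hU : IsOpen U) (hp : p ∈ U) (hf : ∀ x ∈ U, ContDiffAt ℝ 2 f x)
    (hle : ∀ x ∈ U, f x ≤ m) (hfp : f p = m) (hc : 0 < c) (hC : 0 ≤ C)
    (h : ∀ x ∈ U, ∃ (e : ι → E) (b : E), (∀ i, ‖e i‖ ≤ C) ∧ ‖b‖ ≤ C ∧
      (∀ v, c * ‖v‖ ^ 2 ≤ ∑ i, inner ℝ v (e i) ^ 2) ∧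
      0 ≤ ∑ i, fderiv ℝ (fderiv ℝ f) x (e i) (e i) + fderiv ℝ f x b) :
    ∀ᶠ x in 𝓝 p, f x = m := by
  obtain ⟨R, hR, hRU⟩ := Metric.nhds_basis_closedBall.mem_iff.1 (hU.mem_nhds hp)
  -- With `q` within `R/3` of `p`, the nearest level point `y` is within `2R/3` of `p`, so the balls
  -- used below stay inside `closedBall p R`.
  filter_upwards [Metric.ball_mem_nhds p (show 0 < R / 3 by positivity)] with q hq
  by_contra hqm
  rw [Metric.mem_ball] at hq
  have hfc : ContinuousOn f U := fun x hx => (hf x hx).continuousAt.continuousWithinAt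
  -- a point `y` of the level set closest to `q`
  let K : Set E := {x | x ∈ Metric.closedBall p R ∧ f x = m}
  have hKc : IsCompact K := by
    refine (isCompact_closedBall p R).of_isClosed_subset ?_ fun x hx => hx.1
    exact (hfc.mono hRU).preimage_isClosed_of_isClosed Metric.isClosed_closedBall
      (isClosed_singleton (x := m))
  obtain ⟨y, hyK, hy⟩ := hKc.exists_infDist_eq_dist
    (⟨p, Metric.mem_closedBall_self hR.le, hfp⟩ : K.Nonempty) q
  have hmin (x) (hx : x ∈ K) : dist q y ≤ dist q x := hy ▸ Metric.infDist_le_dist_of_mem hx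
  have hqy : dist q y < R / 3 :=
    (hmin p ⟨Metric.mem_closedBall_self hR.le, hfp⟩).trans_lt hq
  have hqy0 : 0 < dist q y := by
    rw [dist_pos]; rintro rfl; exact hqm hyK.2
  have hyp : dist y p < 2 * R / 3 := by
    have := dist_triangle y q p
    rw [dist_comm y q] at this; linarith
  -- the ball of radius `s` about the midpoint touches the level set only at `y`
  let q' := midpoint ℝ q y
  let s := dist q y / 2
  have hs : 0 < s := by positivity
  have hq'q : dist q' q = s := by
    simp only [q', dist_midpoint_left, s]; norm_num; ring
  have hq'y : dist y q' = s := by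
    rw [dist_comm]; simp only [q', dist_midpoint_right, s]; norm_num; ring
  have htouch (x : E) (hx : dist x q' ≤ s) (hxy : x ≠ y) : f x < m := by
    have hxp : x ∈ Metric.closedBall p R := by
      rw [Metric.mem_closedBall]
      have h1 := dist_triangle x q' p
      have h2 := dist_triangle q' q p
      simp only [s] at *
      linarith
    -- A level point `x` of the ball lies at distance at least `2s` from `q`, hence exactly `2s`;
    -- then `q'` is the midpoint of `q` and `x`, which forces `x = y`.
    refine lt_of_le_of_ne (hle x (hRU hxp)) fun hxm => hxy ?_
    have h1 := hmin x ⟨hxp, hxm⟩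
    have h2 : dist q x ≤ 2 * s := by
      have := dist_triangle q q' x
      rw [dist_comm q q', dist_comm q' x] at this
      linarith
    have h3 : dist q' x = s := by
      have := dist_triangle q q' x
      rw [dist_comm q q'] at this
      rw [dist_comm] at hx
      simp only [s] at *
      linarith
    have h4 : q' = midpoint ℝ q x := by
      refine eq_midpoint_of_dist_eq_half ?_ ?_
      · rw [dist_comm q q', hq'q]; simp only [s] at *; linarith
      · rw [h3]; simp only [s] at *; linarith
    have h5 := (midpoint_eq_midpoint_iff_vsub_eq_vsub ℝ).1 h4
    simpa [sub_eq_zero] using h5.symm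
  let l : ℝ := (2 * Fintype.card ι * C ^ 2 + 3 * s * C + 1) / (c * s ^ 2)
  have hl : 0 < l := by positivity
  have hlarge : 2 * Fintype.card ι * C ^ 2 + 3 * s * C < l * c * s ^ 2 := by
    have : l * c * s ^ 2 = 2 * Fintype.card ι * C ^ 2 + 3 * s * C + 1 := by
      simp only [l]; field_simp
    linarith
  have hBU : Metric.closedBall y (s / 2) ⊆ U := by
    refine fun x hx => hRU ?_
    rw [Metric.mem_closedBall] at hx ⊢
    have := dist_triangle x y p
    simp only [s] at *
    linarith
  -- the gap on the part of the sphere inside the touching ball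
  obtain ⟨ε, hε, hgap⟩ : ∃ ε > 0, ∀ x ∈ Metric.sphere y (s / 2) ∩ Metric.closedBall q' s,
      f x + ε < m := by
    have hcomp : IsCompact (Metric.sphere y (s / 2) ∩ Metric.closedBall q' s) :=
      (isCompact_sphere _ _).inter_right Metric.isClosed_closedBall
    rcases (Metric.sphere y (s / 2) ∩ Metric.closedBall q' s).eq_empty_or_nonempty with h0 | hne
    · exact ⟨1, one_pos, by simp [h0]⟩
    · obtain ⟨x0, hx0, hx0m⟩ := hcomp.exists_isMaxOn hne
        (hfc.mono fun x hx => hBU (Metric.sphere_subset_closedBall hx.1))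
      have : f x0 < m := htouch x0 hx0.2 (by
        rintro rfl
        have := hx0.1
        rw [Metric.mem_sphere, dist_self] at this
        linarith)
      refine ⟨(m - f x0) / 2, by linarith, fun x hx => ?_⟩
      have := hx0m hx
      simp only [Set.mem_ofPred_eq] at this
      linarith
  -- On the sphere of radius `s/2` about `y`, `F < F y`: inside the touching ball by the gap `ε` and
  -- `barrier ≤ 1`, outside because `f ≤ m` and the barrier is smaller than at `y`. So `F` has an
  -- interior maximum.
  let F : E → ℝ := fun x => f x + ε * barrier l q' x
  obtain ⟨z, hzB, hz⟩ := (isCompact_closedBall y (s / 2)).exists_isMaxOn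
    ⟨y, Metric.mem_closedBall_self (by positivity)⟩
    ((hfc.mono hBU).add (continuousOn_const.mul
      (contDiff_barrier l q' (k := 0)).continuous.continuousOn) : ContinuousOn F _)
  have hyz : F y ≤ F z := hz (Metric.mem_closedBall_self (by positivity))
  have hb1 (x : E) : barrier l q' x ≤ 1 := by
    rw [barrier, Real.exp_le_one_iff]; have := sq_nonneg ‖x - q'‖; nlinarith
  have hzball : z ∈ Metric.ball y (s / 2) := by
    rw [Metric.mem_ball]
    refine lt_of_le_of_ne hzB fun hzs => hyz.not_gt ?_
    have hfy : f y = m := hyK.2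
    by_cases hzq : dist z q' ≤ s
    · have h1 := hgap z ⟨hzs, hzq⟩
      have h2 := hb1 z
      have h3 := barrier_pos l q' y
      simp only [F]
      nlinarith
    · have h1 : barrier l q' z < barrier l q' y := barrier_lt_barrier hl (by
        rw [← dist_eq_norm, ← dist_eq_norm, hq'y]; exact not_le.1 hzq)
      have h2 := hle z (hBU hzB)
      simp only [F]
      nlinarith
  have hzU := hBU hzB
  have hloc : IsLocalMax F z := hz.isLocalMax (Filter.mem_of_superset
    (Metric.isOpen_ball.mem_nhds hzball) Metric.ball_subset_closedBall)
  have hbs : ContDiffAt ℝ 2 (barrier l q') z := (contDiff_barrier l q').contDiffAt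
  have hFs : ContDiffAt ℝ 2 F z := (hf z hzU).add (contDiffAt_const.mul hbs)
  have hdF (x) (hx : x ∈ U) : fderiv ℝ F x = fderiv ℝ f x + ε • fderiv ℝ (barrier l q') x :=
    (((hf x hx).differentiableAt (by simp)).hasFDerivAt.fun_add
      ((hasFDerivAt_barrier l q' x).differentiableAt.hasFDerivAt.const_mul ε)).fderiv
  have hddF : fderiv ℝ (fderiv ℝ F) z =
      fderiv ℝ (fderiv ℝ f) z + ε • fderiv ℝ (fderiv ℝ (barrier l q')) z := by
    have e : fderiv ℝ F =ᶠ[𝓝 z] fun x => fderiv ℝ f x + ε • fderiv ℝ (barrier l q') x :=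
      Filter.mem_of_superset (hU.mem_nhds hzU) hdF
    rw [e.fderiv_eq]
    exact ((((hf z hzU).fderiv_right (m := 1) (by norm_num)).differentiableAt
      (by simp)).hasFDerivAt.fun_add (((hbs.fderiv_right (m := 1) (by norm_num)).differentiableAt
      (by simp)).hasFDerivAt.fun_const_smul ε)).fderiv
  obtain ⟨e, b, he, hb, hell, hsub⟩ := h z hzU
  have hzq1 : s / 2 ≤ ‖z - q'‖ := by
    rw [← dist_eq_norm]
    have := dist_triangle y z q'
    rw [dist_comm y z] at this
    rw [Metric.mem_closedBall] at hzB
    linarith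
  have hzq2 : ‖z - q'‖ ≤ 3 / 2 * s := by
    rw [← dist_eq_norm]
    have := dist_triangle z y q'
    rw [Metric.mem_closedBall] at hzB
    linarith
  have hbar := barrier_subsolution hs hl hlarge hc he hb hell hzq1 hzq2
  have h1 (i) : fderiv ℝ (fderiv ℝ f) z (e i) (e i) +
      ε * fderiv ℝ (fderiv ℝ (barrier l q')) z (e i) (e i) ≤ 0 := by
    have := fderiv_fderiv_nonpos_of_isLocalMax hFs hloc (e i)
    rw [hddF] at this
    exact this
  have h2 : fderiv ℝ f z b + ε * fderiv ℝ (barrier l q') z b = 0 := by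
    have := congrArg (fun T : E →L[ℝ] ℝ => T b) ((hdF z hzU).symm.trans hloc.fderiv_eq_zero)
    exact this
  have h3 := Finset.sum_nonpos (s := Finset.univ) fun i _ => h1 i
  rw [Finset.sum_add_distrib, ← Finset.mul_sum] at h3
  -- At the maximum the operator applied to `F` is nonpositive, yet it is a subsolution term plus
  -- `ε` times a strictly positive one.
  nlinarith

end MaximumPrinciple

/-! ### The action of `S^α` on `Q` and positivity of the norm -/

section PenroseAlgebra

variable {V : Type*} [AddCommGroup V] [Module ℝ V] [TopologicalSpace V]
  [IsTopologicalAddGroup V] [ContinuousSMul ℝ V] [FiniteDimensional ℝ V] [Nontrivial V]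
  {Q : Submodule ℝ (V →L[ℝ] V)} {J : Fin 3 → V →L[ℝ] V}

/-- The action of `S^a_X` on `Q`. -/
lemma IsAdmissibleBasis.sTensor_commutator (h : IsAdmissibleBasis Q J) {A : V →L[ℝ] V}
    (hA : A ∈ Q) (a : V →L[ℝ] ℝ) (X : V) :
    sTensor J a X * A - A * sTensor J a X =
      -((2 * a X) • A + ∑ i, (2 * a (A (J i X))) • J i) := by
  have m (i j k : Fin 3) (c : ℝ) (hm : J i * J j = c • J k) (Z : V) : J i (J j Z) = c • J k Z := by
    simpa using congrArg (fun T : V →L[ℝ] V => T Z) hm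
  have m01 := m 0 1 2 1 (by rw [h.mul, one_smul])
  have m10 := m 1 0 2 (-1) (by rw [h.mul_one_zero]; module)
  have m02 := m 0 2 1 (-1) (by rw [h.mul_zero_two]; module)
  have m20 := m 2 0 1 1 (by rw [h.mul_two_zero, one_smul])
  have m12 := m 1 2 0 1 (by rw [h.mul_one_two, one_smul])
  have m21 := m 2 1 0 (-1) (by rw [h.mul_two_one]; module)
  have ms := h.apply_self
  rw [h.eq_sum hA]
  ext Z
  simp only [sTensor, Fin.sum_univ_three, sub_apply, add_apply, smul_apply, neg_apply,
    mul_apply_eq_comp, map_add, map_sub, map_smul, map_neg, one_apply_eq_self, smul_eq_mul,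
    ContinuousLinearMap.smulRight_apply, ContinuousLinearMap.comp_apply, m01, m10, m02, m20, m12,
    m21, ms]
  module

lemma IsAdmissibleBasis.qInner_self_eq (h : IsAdmissibleBasis Q J) {A : V →L[ℝ] V} (hA : A ∈ Q) :
    qInner A A = ∑ i, qInner A (J i) ^ 2 := by
  conv_lhs => enter [1]; rw [h.eq_sum hA]
  rw [qInner_sum_left]
  exact Finset.sum_congr rfl fun i _ => by rw [qInner_comm (J i), pow_two]

lemma IsAdmissibleBasis.qInner_self_nonneg (h : IsAdmissibleBasis Q J) {A : V →L[ℝ] V}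
    (hA : A ∈ Q) : 0 ≤ qInner A A := by
  rw [h.qInner_self_eq hA]; positivity

lemma IsAdmissibleBasis.eq_zero_of_qInner_self (h : IsAdmissibleBasis Q J) {A : V →L[ℝ] V}
    (hA : A ∈ Q) (h0 : qInner A A = 0) : A = 0 := by
  rw [h.qInner_self_eq hA, Finset.sum_eq_zero_iff_of_nonneg fun i _ => sq_nonneg _] at h0
  rw [h.eq_sum hA]
  exact Finset.sum_eq_zero fun i hi => by rw [pow_eq_zero_iff two_ne_zero |>.1 (h0 i hi), zero_smul]

end PenroseAlgebra

/-! ### Transport of quaternionic structures by linear isomorphisms -/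

section Conjugation

variable {V : Type*} [AddCommGroup V] [Module ℝ V] [TopologicalSpace V]
  [IsTopologicalAddGroup V] [ContinuousSMul ℝ V] [FiniteDimensional ℝ V]
  {Q : Submodule ℝ (V →L[ℝ] V)} {J : Fin 3 → V →L[ℝ] V}
  {W : Type*} [AddCommGroup W] [Module ℝ W] [TopologicalSpace W]
  [IsTopologicalAddGroup W] [ContinuousSMul ℝ W] [FiniteDimensional ℝ W]

/-- Conjugation by a linear isomorphism. -/
def conjL (a : V →L[ℝ] W) (b : W →L[ℝ] V) : (V →L[ℝ] V) →ₗ[ℝ] (W →L[ℝ] W) where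
  toFun T := a ∘L T ∘L b
  map_add' T T' := by ext; simp
  map_smul' c T := by ext; simp

variable {a : V →L[ℝ] W} {b : W →L[ℝ] V}

lemma conjL_apply (T : V →L[ℝ] V) (w : W) : conjL a b T w = a (T (b w)) := rfl

lemma conjL_mul (hba : ∀ v, b (a v) = v) (S T : V →L[ℝ] V) :
    conjL a b (S * T) = conjL a b S * conjL a b T := by
  ext w; simp [conjL_apply, hba]

lemma qInner_conjL (hba : ∀ v, b (a v) = v) (hab : ∀ w, a (b w) = w) (S T : V →L[ℝ] V) :
    qInner (conjL a b S) (conjL a b T) = qInner S T := by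
  let e : V ≃ₗ[ℝ] W := { (a : V →ₗ[ℝ] W) with invFun := b, left_inv := hba, right_inv := hab }
  have h : ((conjL a b S * conjL a b T : W →L[ℝ] W) : W →ₗ[ℝ] W) =
      e.conj ((S * T : V →L[ℝ] V) : V →ₗ[ℝ] V) := by
    rw [← conjL_mul hba]; rfl
  rw [qInner, qInner, h, LinearMap.trace_conj', e.finrank_eq]

lemma IsAdmissibleBasis.map_conjL (h : IsAdmissibleBasis Q J) (hba : ∀ v, b (a v) = v)
    (hab : ∀ w, a (b w) = w) : IsAdmissibleBasis (Q.map (conjL a b)) fun i => conjL a b (J i) where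
  sq i := by
    rw [← conjL_mul hba, h.sq]; ext w; simp [conjL_apply, hab]
  mul := by rw [← conjL_mul hba, h.mul]
  span := by
    rw [h.span, Submodule.map_span, ← Set.range_comp]; rfl

end Conjugation

/-! ### From the Penrose operator to the twistor equation -/

section Transfer

variable {E : Type*} [NormedAddCommGroup E] [NormedSpace ℝ E] [FiniteDimensional ℝ E]
  {H : Type*} [TopologicalSpace H] {I : ModelWithCorners ℝ E H}
  {M : Type*} [TopologicalSpace M] [ChartedSpace H M] [IsManifold I ∞ M]

/-- The effect of a change of connection `D' = D + S^α` on sections of `Q`. -/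
lemma AlmostQuaternionicStructure.IsShift.onEnd_eq {Q : AlmostQuaternionicStructure I M}
    {D' D : Connection I M} {α : OneForm I M} (h : Q.IsShift D' D α) (A : EndField I M) (x : M)
    (X : TangentSpace I x) :
    D'.onEnd A x X = D.onEnd A x X + (Q.S x (α x) X * A x - A x * Q.S x (α x) X) := by
  ext Y
  have hY : MDiffAt (T% (FiberBundle.extend E Y)) x := FiberBundle.mdifferentiableAt_extend ..
  have e (D : Connection I M) : D.onEnd A x X Y =
      D (fun y => A y (FiberBundle.extend E Y y)) x X - A x (D (FiberBundle.extend E Y) x X) :=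
    TensorialAt.mkHom_apply_eq_extend ..
  rw [add_apply, e, e, h x _ (A.mdifferentiableAt_apply hY), h x _ hY]
  simp only [FiberBundle.extend_apply_self, map_add, sub_apply, mul_apply_eq_comp]
  abel

/-- A section in the kernel of the Penrose operator of `D + S^α` satisfies a twistor equation with
respect to `D`. -/
lemma AlmostQuaternionicStructure.exists_onEnd_eq [Nontrivial E]
    {Q : AlmostQuaternionicStructure I M}
    {D' D : Connection I M} {α : OneForm I M} (h : Q.IsShift D' D α)
    (hD' : Q.IsQuaternionicConnection D') (A : Q.Sections) (x : M) (hA : hD'.penrose A x = 0)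
    {J : Fin 3 → TangentSpace I x →L[ℝ] TangentSpace I x} (hJ : IsAdmissibleBasis (Q.fiber x) J) :
    ∃ β : TangentSpace I x →L[ℝ] ℝ, ∀ X, D.onEnd A.1 x X =
      (2 * (α x X : ℝ)) • A.1 x + ∑ i, β (J i X) • J i := by
  have : Nontrivial (TangentSpace I x) := inferInstanceAs (Nontrivial E)
  have : T2Space (TangentSpace I x) := inferInstanceAs (T2Space E)
  obtain ⟨β, hβ⟩ := (hJ.mem_partEH_iff _).1 ((Submodule.projectionOnto_apply_eq_zero_iff _).1 hA)
  -- Moving `[S^α_X, A]` to the other side gives `2α(X)A` and `2 ∑ α(A Jᵢ X) Jᵢ`; the latter is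
  -- absorbed by adding `2α ∘ A` to `β`.
  refine ⟨β.toContinuousLinearMap + (2 : ℝ) • ((α x : TangentSpace I x →L[ℝ] ℝ) ∘L A.1 x),
    fun X => ?_⟩
  have h1 := congrArg (fun γ => (γ X : TangentSpace I x →L[ℝ] TangentSpace I x)) hβ
  rw [hJ.coe_embed] at h1
  have h2 : D'.onEnd A.1 x X = ∑ i, β (J i X) • J i := h1
  rw [h.onEnd_eq, Q.S_eq hJ, hJ.sTensor_commutator (A.2 x), ← sub_eq_add_neg,
    sub_eq_iff_eq_add] at h2
  rw [h2]
  simp only [add_apply, smul_apply, ContinuousLinearMap.comp_apply, add_smul,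
    Finset.sum_add_distrib, smul_eq_mul]
  change _ = _ + (∑ i, β (J i X) • J i + _)
  abel

end Transfer

/-! ### Quaternionic-Kähler data and the twistor equation in a chart -/

section ChartData

variable {E : Type*} [NormedAddCommGroup E] [NormedSpace ℝ E] [FiniteDimensional ℝ E]
  {H : Type*} [TopologicalSpace H] {I : ModelWithCorners ℝ E H} [I.Boundaryless]
  {M : Type*} [TopologicalSpace M] [ChartedSpace H M] [IsManifold I ∞ M] {p : M} {x : E}

/-- The coordinate expression of an almost quaternionic structure in the chart at `p`. -/
def quatRep (p : M) (Q : AlmostQuaternionicStructure I M) (x : E) : Submodule ℝ (E →L[ℝ] E) :=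
  (Q.fiber (chartPt I p x)).map (conjL (toCoord I p (chartPt I p x)) (ofCoord I p (chartPt I p x)))

lemma endRep_eq_conjL (A : (y : M) → TangentSpace I y →L[ℝ] TangentSpace I y) :
    endRep p A x =
      conjL (toCoord I p (chartPt I p x)) (ofCoord I p (chartPt I p x)) (A (chartPt I p x)) := rfl

lemma endRep_mem_quatRep {Q : AlmostQuaternionicStructure I M}
    {A : (y : M) → TangentSpace I y →L[ℝ] TangentSpace I y}
    (hA : A (chartPt I p x) ∈ Q.fiber (chartPt I p x)) : endRep p A x ∈ quatRep p Q x :=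
  Submodule.mem_map_of_mem hA

lemma qInner_endRep (hx : x ∈ (extChartAt I p).target)
    (A B : (y : M) → TangentSpace I y →L[ℝ] TangentSpace I y) :
    qInner (endRep p A x) (endRep p B x) = qInner (A (chartPt I p x)) (B (chartPt I p x)) :=
  qInner_conjL (ofCoord_toCoord (chartPt_mem_source hx)) (toCoord_ofCoord (chartPt_mem_source hx))
    _ _

/-- `covEnd` is the coordinate expression of the connection on endomorphisms. -/
lemma covEnd_endRep (D : Connection I M) (hx : x ∈ (extChartAt I p).target)
    (A : EndField I M) (u : E) :
    covEnd (christoffel D p) (endRep p A) x u =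
      conjL (toCoord I p (chartPt I p x)) (ofCoord I p (chartPt I p x))
        (D.onEnd A (chartPt I p x) (ofCoord I p _ u)) := by
  ext w
  rw [conjL_apply, D.toCoord_onEnd hx, toCoord_ofCoord (chartPt_mem_source hx),
    toCoord_ofCoord (chartPt_mem_source hx), covEnd_apply]

lemma eventually_chartPt (hx : x ∈ (extChartAt I p).target) {P : M → Prop}
    (hP : ∀ᶠ y in 𝓝 (chartPt I p x), P y) : ∀ᶠ z in 𝓝 x, P (chartPt I p z) :=
  (contMDiffAt_chartPt hx).continuousAt.eventually hP

variable [T2Space M]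

/-- A quaternionic connection preserves local sections of `Q`. -/
lemma covEnd_endRep_mem {Q : AlmostQuaternionicStructure I M} {D : Connection I M}
    (hD : Q.IsQuaternionicConnection D) (hx : x ∈ (extChartAt I p).target) {s : Set M}
    (hs : s ∈ 𝓝 (chartPt I p x)) {A : (y : M) → TangentSpace I y →L[ℝ] TangentSpace I y}
    (hA : ContMDiffOn I (I.prod 𝓘(ℝ, E →L[ℝ] E)) ∞
        (fun x => TotalSpace.mk' (E →L[ℝ] E)
          (E := fun x : M => TangentSpace I x →L[ℝ] TangentSpace I x) x (A x)) s)
    (hAQ : ∀ y ∈ s, A y ∈ Q.fiber y) (u : E) :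
    covEnd (christoffel D p) (endRep p A) x u ∈ quatRep p Q x := by
  -- Preservation of `Q` is assumed for global sections, so the local section is cut off; the result
  -- lies in `Q` everywhere, being zero off `s`.
  obtain ⟨ψ, hψ, hψ1, hψ0⟩ := exists_section_eventuallyEq
    (V := fun x : M => TangentSpace I x →L[ℝ] TangentSpace I x) hs hA
  let S : EndField I M := ⟨ψ • A, hψ⟩
  have hS (y) : S y ∈ Q.fiber y := by
    change ψ y • A y ∈ _
    by_cases hy : y ∈ s
    · exact Submodule.smul_mem _ _ (hAQ y hy)
    · rw [hψ0 y hy, zero_smul]; exact Submodule.zero_mem _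
  have e : endRep p A =ᶠ[𝓝 x] endRep p S := by
    filter_upwards [eventually_chartPt hx hψ1] with z hz
    have : S (chartPt I p z) = A (chartPt I p z) := by
      change ψ _ • A _ = _
      rw [hz, one_smul]
    rw [endRep_eq_conjL, endRep_eq_conjL, this]
  rw [covEnd_congr e, covEnd_endRep D hx]
  exact Submodule.mem_map_of_mem (hD.preserves ⟨S, hS⟩ _ _)

variable [RiemannianBundle (fun x : M => TangentSpace I x)]
  [IsContMDiffRiemannianBundle I ∞ E (fun x : M => TangentSpace I x)]

/-- The coordinate expression of a quaternionic-Kähler structure near `p`. -/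
theorem exists_isQuaternionicKahlerOn {Q : AlmostQuaternionicStructure I M} {D : Connection I M}
    (hD : Q.IsQuaternionicKahler D) (p : M) :
    ∃ U, extChartAt I p p ∈ U ∧ U ⊆ (extChartAt I p).target ∧
      ∃ J : Fin 3 → (y : M) → (TangentSpace I y →L[ℝ] TangentSpace I y),
        (∀ x ∈ U, IsAdmissibleBasis (Q.fiber (chartPt I p x)) fun i => J i (chartPt I p x)) ∧
        IsQuaternionicKahlerOn U (christoffel D p) (metricRep I p) (quatRep p Q)
          (fun i => endRep p (J i)) := by
  obtain ⟨s, hs, J, hJs, hJ⟩ := Q.exists_frame p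
  have hc : ContinuousOn (chartPt I p) (extChartAt I p).target := continuousOn_extChartAt_symm p
  have hmem (x) (hx : x ∈ (extChartAt I p).target ∩ chartPt I p ⁻¹' interior s) :
      s ∈ 𝓝 (chartPt I p x) := mem_interior_iff_mem_nhds.1 hx.2
  refine ⟨(extChartAt I p).target ∩ chartPt I p ⁻¹' interior s, ⟨mem_extChartAt_target p, ?_⟩,
    Set.inter_subset_left, J, fun x hx => hJ _ (interior_subset hx.2), ?_⟩
  · rw [Set.mem_preimage, chartPt, extChartAt_to_inv]
    exact mem_interior_iff_mem_nhds.2 hs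
  · exact
      { isOpen := hc.isOpen_inter_preimage (isOpen_extChartAt_target p) isOpen_interior
        christoffel_smooth := fun x hx => contDiffAt_christoffel hD.quaternionic.smooth hx.1
        metric_smooth := fun x hx => contDiffAt_metricRep hx.1
        frame_smooth := fun i x hx => contDiffAt_endRep hx.1 ((hJs i).contMDiffAt (hmem x hx))
        symm := fun x hx => christoffel_symm hD.quaternionic.torsionFree hx.1
        metric := fun x hx => fderiv_metricRep hD.leviCivita hx.1
        admissible := fun x hx => (hJ _ (interior_subset hx.2)).map_conjL
          (ofCoord_toCoord (chartPt_mem_source hx.1)) (toCoord_ofCoord (chartPt_mem_source hx.1))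
        covEnd_frame_mem := fun x hx i => covEnd_endRep_mem hD.quaternionic hx.1 (hmem x hx)
          (hJs i) fun y hy => (hJ y hy).mem i
        skew := by
          rintro x hx _ ⟨C, hC, rfl⟩ u v
          have hy := chartPt_mem_source hx.1
          obtain ⟨X, rfl⟩ : ∃ X, toCoord I p (chartPt I p x) X = u := ⟨_, toCoord_ofCoord hy u⟩
          obtain ⟨Y, rfl⟩ : ∃ X, toCoord I p (chartPt I p x) X = v := ⟨_, toCoord_ofCoord hy v⟩
          rw [conjL_apply, conjL_apply, ofCoord_toCoord hy, ofCoord_toCoord hy,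
            metricRep_toCoord hx.1, metricRep_toCoord hx.1, hD.skew _ C hC] }

/-- The coordinate expression of the twistor equation. -/
lemma exists_isTwistorOn_endRep [Nontrivial E] {Q : AlmostQuaternionicStructure I M}
    {D D' : Connection I M} {α : OneForm I M} (h : Q.IsShift D' D α)
    (hD' : Q.IsQuaternionicConnection D') (A : Q.Sections) (hA : ∀ x, hD'.penrose A x = 0)
    {p : M} {U : Set E} (hUt : U ⊆ (extChartAt I p).target)
    {J : Fin 3 → (y : M) → (TangentSpace I y →L[ℝ] TangentSpace I y)}
    (hJ : ∀ x ∈ U, IsAdmissibleBasis (Q.fiber (chartPt I p x)) fun i => J i (chartPt I p x))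
    (hU : IsQuaternionicKahlerOn U (christoffel D p) (metricRep I p) (quatRep p Q)
      (fun i => endRep p (J i))) :
    ∃ β, IsTwistorOn U (christoffel D p) (quatRep p Q) (fun i => endRep p (J i))
      (formRep p fun y => α y) (endRep p A.1) β := by
  refine exists_isTwistorOn hU (fun z hz => contDiffAt_formRep (hUt hz) α)
    (fun z hz => contDiffAt_endRep (hUt hz) A.1.contMDiff.contMDiffAt)
    (fun z hz => endRep_mem_quatRep (A.2 _)) fun z hz => ?_
  obtain ⟨β, hβ⟩ := AlmostQuaternionicStructure.exists_onEnd_eq h hD' A _ (hA _) (hJ z hz)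
  have hy := chartPt_mem_source (hUt hz)
  refine ⟨β ∘L ofCoord I p (chartPt I p z), fun u => ?_⟩
  rw [covEnd_endRep D (hUt hz), hβ, map_add, map_smul, map_sum]
  congr 1
  refine Finset.sum_congr rfl fun i _ => ?_
  rw [map_smul, ContinuousLinearMap.comp_apply]
  congr 2
  exact (ofCoord_toCoord hy _).symm

end ChartData

/-! ### Scalar curvature and codifferential in a coordinate orthonormal frame -/

section OrthonormalFrame

variable {E : Type*} [NormedAddCommGroup E] [NormedSpace ℝ E] [FiniteDimensional ℝ E]
  {H : Type*} [TopologicalSpace H] {I : ModelWithCorners ℝ E H} [I.Boundaryless]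
  {M : Type*} [TopologicalSpace M] [ChartedSpace H M] [IsManifold I ∞ M] {p : M} {x : E}
  [RiemannianBundle (fun x : M => TangentSpace I x)]
  [IsContMDiffRiemannianBundle I ∞ E (fun x : M => TangentSpace I x)]

/-- `toCoord` as a linear isomorphism. -/
def coordEquiv (hx : x ∈ (extChartAt I p).target) : TangentSpace I (chartPt I p x) ≃ₗ[ℝ] E :=
  { (toCoord I p (chartPt I p x) : TangentSpace I (chartPt I p x) →ₗ[ℝ] E) with
    invFun := ofCoord I p (chartPt I p x)
    left_inv := ofCoord_toCoord (chartPt_mem_source hx)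
    right_inv := toCoord_ofCoord (chartPt_mem_source hx) }

/-- The coordinates of the standard orthonormal basis of a tangent space. -/
def coordBasis (hx : x ∈ (extChartAt I p).target) : Module.Basis (Fin (Module.finrank ℝ E)) ℝ E :=
  ((stdOrthonormalBasis ℝ (TangentSpace I (chartPt I p x))).toBasis.map (coordEquiv hx)).reindex
    (finCongr (coordEquiv hx).finrank_eq)

lemma coordBasis_apply (hx : x ∈ (extChartAt I p).target) (i : Fin (Module.finrank ℝ E)) :
    coordBasis hx i = toCoord I p (chartPt I p x)
      (stdOrthonormalBasis ℝ (TangentSpace I (chartPt I p x))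
        ((finCongr (coordEquiv hx).finrank_eq).symm i)) := by
  simp [coordBasis]; rfl

lemma isOrthonormalBasis_coordBasis (hx : x ∈ (extChartAt I p).target) :
    IsOrthonormalBasis (metricRep I p x) (coordBasis hx) where
  symm u v := by rw [metricRep_apply, metricRep_apply, real_inner_comm]
  apply i j := by
    rw [coordBasis_apply, coordBasis_apply, metricRep_toCoord hx,
      (stdOrthonormalBasis ℝ (TangentSpace I (chartPt I p x))).inner_eq_ite]
    simp only [EmbeddingLike.apply_eq_iff_eq]

lemma Connection.scal_eq [T2Space M] {D : Connection I M}
    (hD : CovariantDerivative.ContMDiffCovariantDerivative D ∞) (hD' : D.torsion = 0)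
    (hx : x ∈ (extChartAt I p).target) :
    D.scal (chartPt I p x) = ∑ k, ricciForm (metricRep I p x) (coordBasis hx)
      (coordCurvatureL (christoffel D p) x) (coordBasis hx k) (coordBasis hx k) := by
  unfold Connection.scal Connection.ricci
  rw [← (finCongr (coordEquiv hx).finrank_eq).symm.sum_comp]
  refine Finset.sum_congr rfl fun k _ => ?_
  rw [ricciForm_apply, ← (finCongr (coordEquiv hx).finrank_eq).symm.sum_comp]
  refine Finset.sum_congr rfl fun i _ => ?_
  rw [coordCurvatureL_apply, coordBasis_apply, coordBasis_apply, ← toCoord_curvature hD hD' hx,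
    metricRep_toCoord hx]

lemma Connection.codifferential_eq (D : Connection I M) (α : OneForm I M)
    (hx : x ∈ (extChartAt I p).target) :
    D.codifferential α (chartPt I p x) =
      -∑ i, (fderiv ℝ (formRep p fun y => α y) x (coordBasis hx i) (coordBasis hx i)
        - formRep p (fun y => α y) x (christoffel D p x (coordBasis hx i) (coordBasis hx i))) := by
  unfold Connection.codifferential
  rw [← (finCongr (coordEquiv hx).finrank_eq).symm.sum_comp]
  congr 1
  refine Finset.sum_congr rfl fun k _ => ?_
  rw [D.onForm_eq hx, coordBasis_apply]

end OrthonormalFrame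

/-! ### Uniform ellipticity of orthonormal frames -/

section Ellipticity

set_option synthInstance.maxHeartbeats 400000

variable {E : Type*} [NormedAddCommGroup E] [NormedSpace ℝ E] [FiniteDimensional ℝ E]

lemma eventually_norm_sub_lt {X F : Type*} [TopologicalSpace X] [NormedAddCommGroup F] {g : X → F}
    {x : X} (hg : ContinuousAt g x) {c : ℝ} (hc : 0 < c) : ∀ᶠ z in 𝓝 x, ‖g z - g x‖ < c :=
  (hg.fun_sub continuousAt_const).norm.eventually_lt continuousAt_const (by simpa using hc)

/-- A positive definite form is bounded below, uniformly near a point of continuity. -/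
lemma exists_pos_forall_le_metric {X : Type*} [TopologicalSpace X] {g : X → E →L[ℝ] E →L[ℝ] ℝ}
    {x : X} (hg : ContinuousAt g x) (hpos : ∀ v, v ≠ 0 → 0 < g x v v) :
    ∃ c > 0, ∀ᶠ z in 𝓝 x, ∀ v, c * ‖v‖ ^ 2 ≤ g z v v := by
  obtain ⟨c, hc, hcv⟩ : ∃ c > 0, ∀ v, 2 * c * ‖v‖ ^ 2 ≤ g x v v := by
    rcases (Metric.sphere (0 : E) 1).eq_empty_or_nonempty with h0 | hne
    · refine ⟨1, one_pos, fun v => ?_⟩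
      have hv : v = 0 := by
        by_contra hv
        have : ‖v‖⁻¹ • v ∈ Metric.sphere (0 : E) 1 := by
          simp [norm_smul, norm_ne_zero_iff.2 hv]
        rw [h0] at this; exact this
      simp [hv]
    · obtain ⟨w, hw, hmin⟩ := (isCompact_sphere (0 : E) 1).exists_isMinOn hne
        (f := fun v => g x v v) (by fun_prop)
      have hw0 : w ≠ 0 := by rintro rfl; simp at hw
      refine ⟨g x w w / 2, half_pos (hpos w hw0), fun v => ?_⟩
      by_cases hv : v = 0
      · simp [hv]
      have hn := norm_ne_zero_iff.2 hv
      have : ‖v‖⁻¹ • v ∈ Metric.sphere (0 : E) 1 := by simp [norm_smul, hn]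
      have := hmin this
      simp only [Set.mem_ofPred_eq, map_smul, smul_apply, smul_eq_mul] at this
      calc 2 * (g x w w / 2) * ‖v‖ ^ 2 = g x w w * ‖v‖ ^ 2 := by ring
        _ ≤ (‖v‖⁻¹ * (‖v‖⁻¹ * g x v v)) * ‖v‖ ^ 2 := by gcongr
        _ = _ := by field_simp
  refine ⟨c, hc, ?_⟩
  have hn := eventually_norm_sub_lt (F := E →L[ℝ] E →L[ℝ] ℝ) hg hc
  filter_upwards [hn] with z hz v
  replace hz : ‖g z - g x‖ < c := hz
  have h1 : |(g z - g x) v v| ≤ c * ‖v‖ ^ 2 := by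
    calc |(g z - g x) v v| ≤ ‖g z - g x‖ * ‖v‖ * ‖v‖ := (g z - g x).le_opNorm₂ v v
      _ ≤ c * ‖v‖ * ‖v‖ := by gcongr
      _ = _ := by ring
  have h2 := abs_le.1 h1
  simp only [sub_apply] at h2
  linarith [hcv v, h2.1]

lemma eventually_norm_le {X F : Type*} [TopologicalSpace X] [NormedAddCommGroup F] {g : X → F}
    {x : X} (hg : ContinuousAt g x) : ∀ᶠ z in 𝓝 x, ‖g z‖ ≤ ‖g x‖ + 1 :=
  (hg.norm.eventually_lt continuousAt_const (lt_add_one _)).mono fun _ h => h.le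

variable {ι : Type*} [Fintype ι] [DecidableEq ι] {g : E →L[ℝ] E →L[ℝ] ℝ} {b : Module.Basis ι ℝ E}

lemma IsOrthonormalBasis.norm_sq_le (h : IsOrthonormalBasis g b) {c : ℝ} (hc : 0 < c)
    (hg : ∀ v, c * ‖v‖ ^ 2 ≤ g v v) (i : ι) : ‖b i‖ ^ 2 ≤ c⁻¹ := by
  have := hg (b i)
  rw [h.apply, if_pos rfl] at this
  rw [← one_div, le_div_iff₀ hc]
  linarith

/-- Cauchy–Schwarz applied to `‖v‖² = ∑⟨v, bᵢ⟩ g(v, bᵢ)` gives `‖v‖⁴ ≤ g(v,v) ∑⟨v, bᵢ⟩²`, and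
`g(v,v) ≤ C‖v‖²`. The auxiliary inner product of the chart is unrelated to `g`. -/
lemma IsOrthonormalBasis.elliptic {E : Type*} [NormedAddCommGroup E] [InnerProductSpace ℝ E]
    [FiniteDimensional ℝ E] {g : E →L[ℝ] E →L[ℝ] ℝ} {b : Module.Basis ι ℝ E}
    (h : IsOrthonormalBasis g b) {C : ℝ} (hC : 0 < C) (hg : ‖g‖ ≤ C) (v : E) :
    C⁻¹ * ‖v‖ ^ 2 ≤ ∑ i, inner ℝ v (b i) ^ 2 := by
  have h1 : ‖v‖ ^ 2 = ∑ i, inner ℝ v (b i) * g v (b i) := by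
    rw [← real_inner_self_eq_norm_sq]
    exact (h.sum_mul (innerSL ℝ v : E →ₗ[ℝ] ℝ) v).symm
  have h2 : ∑ i, g v (b i) ^ 2 = g v v := by
    simp_rw [sq]
    exact h.sum_mul (g v : E →ₗ[ℝ] ℝ) v
  have h3 : g v v ≤ C * ‖v‖ ^ 2 := by
    calc g v v ≤ ‖g v v‖ := le_abs_self _
      _ ≤ ‖g‖ * ‖v‖ * ‖v‖ := g.le_opNorm₂ v v
      _ ≤ C * ‖v‖ * ‖v‖ := by gcongr
      _ = _ := by ring
  have h4 := Finset.sum_mul_sq_le_sq_mul_sq Finset.univ (fun i => inner ℝ v (b i))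
    (fun i => g v (b i))
  rw [← h1, h2] at h4
  have hS : 0 ≤ ∑ i, inner ℝ v (b i) ^ 2 := by positivity
  by_cases hv : v = 0
  · simp [hv]
  have hn : 0 < ‖v‖ ^ 2 := by positivity
  have h5 : ‖v‖ ^ 2 * ‖v‖ ^ 2 ≤ (C * ∑ i, inner ℝ v (b i) ^ 2) * ‖v‖ ^ 2 := by
    nlinarith [mul_le_mul_of_nonneg_left h3 hS]
  have h6 := le_of_mul_le_mul_right h5 hn
  rw [inv_mul_le_iff₀ hC]
  exact h6

end Ellipticity

/-! ### The vanishing theorem -/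

section Vanishing

set_option synthInstance.maxHeartbeats 400000
set_option maxHeartbeats 1000000

variable {E : Type*} [NormedAddCommGroup E] [InnerProductSpace ℝ E] [FiniteDimensional ℝ E]
  {H : Type*} [TopologicalSpace H] {I : ModelWithCorners ℝ E H} [I.Boundaryless]
  {M : Type*} [TopologicalSpace M] [T2Space M] [ChartedSpace H M] [IsManifold I ∞ M]
  [RiemannianBundle (fun x : M => TangentSpace I x)]
  [IsContMDiffRiemannianBundle I ∞ E (fun x : M => TangentSpace I x)]
  {Q : AlmostQuaternionicStructure I M} {D D' : Connection I M} {α : OneForm I M}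

lemma contDiffAt_normSq {p : M} {x : E} (hx : x ∈ (extChartAt I p).target) (A : EndField I M) :
    ContDiffAt ℝ ∞ (fun z => qInner (endRep p A z) (endRep p A z)) x :=
  ContDiffAt.qInner (contDiffAt_endRep hx A.contMDiff.contMDiffAt)
    (contDiffAt_endRep hx A.contMDiff.contMDiffAt)

lemma continuous_normSq (A : EndField I M) : Continuous fun y => qInner (A y) (A y) := by
  rw [continuous_iff_continuousAt]
  intro p
  have h1 : ContinuousAt (fun y => qInner (endRep p A (extChartAt I p y))
      (endRep p A (extChartAt I p y))) p :=
    ContinuousAt.comp (contDiffAt_normSq (mem_extChartAt_target p) A).continuousAt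
      (continuousAt_extChartAt p)
  refine h1.congr ?_
  filter_upwards [extChartAt_source_mem_nhds (I := I) p] with y hy
  rw [qInner_endRep ((extChartAt I p).map_source hy), chartPt, (extChartAt I p).left_inv hy]

/-- The Bochner formula in a chart, for a section in the kernel of the Penrose operator. -/
lemma exists_bochner (hE : 4 < Module.finrank ℝ E) (hD : Q.IsQuaternionicKahler D)
    (hD' : Q.IsQuaternionicConnection D') (hshift : Q.IsShift D' D α)
    (hα : ∀ x, D.codifferential α x = 0) (A : Q.Sections) (hA : ∀ x, hD'.penrose A x = 0) (p : M) :
    ∃ U, IsOpen U ∧ extChartAt I p p ∈ U ∧ ∃ hU : U ⊆ (extChartAt I p).target,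
      ∀ x, ∀ hx : x ∈ U, ∀ f : E → ℝ, (f = fun z => qInner (endRep p A.1 z) (endRep p A.1 z)) →
      (Module.finrank ℝ E + 8) * (f x * (∑ i, (fderiv ℝ (fderiv ℝ f) x
          (coordBasis (hU hx) i) (coordBasis (hU hx) i) - fderiv ℝ f x
            (christoffel D p x (coordBasis (hU hx) i) (coordBasis (hU hx) i)))
          + 4 * ∑ i, formRep p (fun y => α y) x (coordBasis (hU hx) i)
            * fderiv ℝ f x (coordBasis (hU hx) i))
        - 8 * (∑ i, formRep p (fun y => α y) x (coordBasis (hU hx) i) ^ 2) * f x ^ 2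
        - 3 / 2 * ∑ i, fderiv ℝ f x (coordBasis (hU hx) i) ^ 2) =
      -4 * D.scal (chartPt I p x) * f x ^ 2 := by
  have : Nontrivial E := Module.nontrivial_of_finrank_pos (R := ℝ) (by omega)
  obtain ⟨U, hpU, hU, J, hJ, hQK⟩ := exists_isQuaternionicKahlerOn hD p
  obtain ⟨β, hβ⟩ := exists_isTwistorOn_endRep hshift hD' A hA hU hJ hQK
  refine ⟨U, hQK.isOpen, hpU, hU, fun x hx f hf => ?_⟩
  rw [Connection.scal_eq hD.quaternionic.smooth hD.quaternionic.torsionFree (hU hx)]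
  refine hβ.bochner hQK hx (isOrthonormalBasis_coordBasis (hU hx)) hE ?_ hf
  have := hα (chartPt I p x)
  rw [Connection.codifferential_eq D α (hU hx), neg_eq_zero] at this
  exact this

/-- The norm of a section in the kernel of the Penrose operator is locally constant near its
maxima. -/
lemma eventually_normSq_eq (hE : 4 < Module.finrank ℝ E) (hD : Q.IsQuaternionicKahler D)
    (hD' : Q.IsQuaternionicConnection D') (hshift : Q.IsShift D' D α)
    (hα : ∀ x, D.codifferential α x = 0) (hscal : ∀ x, D.scal x ≤ 0) (A : Q.Sections)
    (hA : ∀ x, hD'.penrose A x = 0) {m : ℝ} (hm : 0 < m) (hle : ∀ y, qInner (A.1 y) (A.1 y) ≤ m)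
    {p : M} (hp : qInner (A.1 p) (A.1 p) = m) : ∀ᶠ y in 𝓝 p, qInner (A.1 y) (A.1 y) = m := by
  obtain ⟨U, hUo, hpU, hU, hB⟩ := exists_bochner hE hD hD' hshift hα A hA p
  let f : E → ℝ := fun z => qInner (endRep p A.1 z) (endRep p A.1 z)
  have hfe (z) (hz : z ∈ U) : f z = qInner (A.1 (chartPt I p z)) (A.1 (chartPt I p z)) :=
    qInner_endRep (hU hz) _ _
  have hx0 : extChartAt I p p ∈ (extChartAt I p).target := mem_extChartAt_target p
  have hfp : f (extChartAt I p p) = m := by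
    rw [hfe _ hpU, chartPt, extChartAt_to_inv, hp]
  have hfs (z) (hz : z ∈ U) : ContDiffAt ℝ ∞ f z := contDiffAt_normSq (hU hz) A.1
  obtain ⟨c, hc, hcg⟩ := exists_pos_forall_le_metric
    (contDiffAt_metricRep (I := I) hx0).continuousAt (fun v hv => by
      rw [metricRep_apply, real_inner_self_pos]
      intro h0
      refine hv ?_
      have := toCoord_ofCoord (chartPt_mem_source hx0) v
      rw [← this]
      exact (congrArg _ h0).trans (map_zero _))
  have hcG := eventually_norm_le (contDiffAt_metricRep (I := I) hx0).continuousAt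
  have hcΓ := eventually_norm_le (contDiffAt_christoffel hD.quaternionic.smooth hx0).continuousAt
  have hcα := eventually_norm_le (contDiffAt_formRep hx0 α).continuousAt
  have hfpos : ∀ᶠ z in 𝓝 (extChartAt I p p), 0 < f z :=
    (hfs _ hpU).continuousAt.eventually (by rw [hfp]; exact lt_mem_nhds hm)
  obtain ⟨V, hVsub, hVo, hpV⟩ := eventually_nhds_iff.1
    ((hUo.eventually_mem hpU).and (hcg.and (hcG.and (hcΓ.and (hcα.and hfpos)))))
  set G := ‖metricRep I p (extChartAt I p p)‖ + 1 with hG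
  set K := ‖christoffel D p (extChartAt I p p)‖ + 1 with hK
  set L := ‖formRep p (fun y => α y) (extChartAt I p p)‖ + 1 with hL
  have hG0 : 0 < G := by positivity
  set N : ℝ := ((Module.finrank ℝ E : ℕ) : ℝ) with hN
  have key : ∀ᶠ z in 𝓝 (extChartAt I p p), f z = m := by
    refine eventually_eq_of_subsolution (ι := Fin (Module.finrank ℝ E)) (c := G⁻¹)
      -- One constant for all bounds: frame vectors satisfy `‖bᵢ‖² ≤ c⁻¹`, the drift `∑ Γ(bᵢ, bᵢ)`
      -- is at most `N K c⁻¹`, and `4 ∑ α(bᵢ) bᵢ` at most `4 N L c⁻¹`.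
      (C := c⁻¹ + 1 + N * (K * c⁻¹) + 4 * (N * (L * c⁻¹))) hVo hpV
      (fun z hz => (hfs z (hVsub z hz).1).of_le (by simpa using ENat.LEInfty.out))
      (fun z hz => by rw [hfe z (hVsub z hz).1]; exact hle _) hfp (by positivity) (by positivity) ?_
    intro z hz
    obtain ⟨hzU, hzc, hzG, hzK, hzL, hzf⟩ := hVsub z hz
    have hb := isOrthonormalBasis_coordBasis (hU hzU)
    have hbn := hb.norm_sq_le hc hzc
    have hc0 : 0 < c⁻¹ := by positivity
    have hK0 : 0 ≤ K := by positivity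
    have hL0 : 0 ≤ L := by positivity
    have hN0 : 0 ≤ N := by positivity
    -- The second-order part with this drift is `Δf + 4⟨α, df⟩`. The frames need no continuity in
    -- `z`: the maximum principle asks only for uniform bounds.
    refine ⟨coordBasis (hU hzU), -∑ i, christoffel D p z (coordBasis (hU hzU) i)
      (coordBasis (hU hzU) i) + (4 : ℝ) • ∑ i, formRep p (fun y => α y) z (coordBasis (hU hzU) i) •
        coordBasis (hU hzU) i, fun i => ?_, ?_, hb.elliptic hG0 hzG, ?_⟩
    · have h1 : ‖coordBasis (hU hzU) i‖ ≤ c⁻¹ + 1 := by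
        nlinarith [hbn i, sq_nonneg (‖coordBasis (hU hzU) i‖ - 1)]
      have h2 : 0 ≤ N * (K * c⁻¹) := by positivity
      have h3 : 0 ≤ N * (L * c⁻¹) := by positivity
      linarith
    · have h1 : ‖∑ i, christoffel D p z (coordBasis (hU hzU) i) (coordBasis (hU hzU) i)‖ ≤
          N * (K * c⁻¹) := by
        refine (norm_sum_le_of_le (f := fun i => christoffel D p z (coordBasis (hU hzU) i)
          (coordBasis (hU hzU) i)) (n := fun _ => K * c⁻¹) _ fun i _ => ?_).trans (by simp [hN])
        calc _ ≤ ‖christoffel D p z‖ * ‖coordBasis (hU hzU) i‖ * ‖coordBasis (hU hzU) i‖ :=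
              (christoffel D p z).le_opNorm₂ _ _
          _ = ‖christoffel D p z‖ * ‖coordBasis (hU hzU) i‖ ^ 2 := by ring
          _ ≤ K * c⁻¹ := by gcongr; exact hbn i
      have h2 : ‖∑ i, formRep p (fun y => α y) z (coordBasis (hU hzU) i) •
          coordBasis (hU hzU) i‖ ≤ N * (L * c⁻¹) := by
        refine (norm_sum_le_of_le (f := fun i => formRep p (fun y => α y) z
          (coordBasis (hU hzU) i) • coordBasis (hU hzU) i) (n := fun _ => L * c⁻¹) _
          fun i _ => ?_).trans (by simp [hN])
        rw [norm_smul]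
        calc _ ≤ (‖formRep p (fun y => α y) z‖ * ‖coordBasis (hU hzU) i‖) *
              ‖coordBasis (hU hzU) i‖ := by gcongr; exact ContinuousLinearMap.le_opNorm _ _
          _ = ‖formRep p (fun y => α y) z‖ * ‖coordBasis (hU hzU) i‖ ^ 2 := by ring
          _ ≤ L * c⁻¹ := by gcongr; exact hbn i
      refine (norm_add_le _ _).trans ?_
      rw [norm_neg, norm_smul, Real.norm_of_nonneg (by norm_num : (0 : ℝ) ≤ 4)]
      linarith
    · have hb := hB z hzU f rfl
      have hs := hscal (chartPt I p z)
      set T := ∑ i, (fderiv ℝ (fderiv ℝ f) z (coordBasis (hU hzU) i) (coordBasis (hU hzU) i)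
        - fderiv ℝ f z (christoffel D p z (coordBasis (hU hzU) i) (coordBasis (hU hzU) i)))
          + 4 * ∑ i, formRep p (fun y => α y) z (coordBasis (hU hzU) i)
            * fderiv ℝ f z (coordBasis (hU hzU) i) with hT
      have e : ∑ i, fderiv ℝ (fderiv ℝ f) z (coordBasis (hU hzU) i) (coordBasis (hU hzU) i) +
          fderiv ℝ f z (-∑ i, christoffel D p z (coordBasis (hU hzU) i)
            (coordBasis (hU hzU) i) + (4 : ℝ) • ∑ i, formRep p (fun y => α y) z
              (coordBasis (hU hzU) i) • coordBasis (hU hzU) i) = T := by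
        rw [hT, map_add, map_neg, map_smul, map_sum, map_sum, Finset.sum_sub_distrib]
        simp only [map_smul, smul_eq_mul]
        ring
      rw [e]
      set S1 := ∑ i, formRep p (fun y => α y) z (coordBasis (hU hzU) i) ^ 2 with hS1
      set S2 := ∑ i, fderiv ℝ f z (coordBasis (hU hzU) i) ^ 2 with hS2
      have hS1' : 0 ≤ S1 := Finset.sum_nonneg fun i _ => sq_nonneg _
      have hS2' : 0 ≤ S2 := Finset.sum_nonneg fun i _ => sq_nonneg _
      have h1 : 0 ≤ (N + 8) * (f z * T - 8 * S1 * f z ^ 2 - 3 / 2 * S2) := by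
        rw [hb]
        have : 0 ≤ -D.scal (chartPt I p z) * f z ^ 2 := by
          exact mul_nonneg (by linarith) (sq_nonneg _)
        linarith
      have h2 := nonneg_of_mul_nonneg_right h1 (by positivity)
      have h3 : 0 ≤ 8 * S1 * f z ^ 2 := by positivity
      -- The Bochner formula gives only `f T ≥ 0`; positivity of `f` on the neighbourhood allows
      -- division.
      exact nonneg_of_mul_nonneg_right (by linarith : 0 ≤ f z * T) hzf
  have h1 := (continuousAt_extChartAt (I := I) p).eventually (key.and (hUo.eventually_mem hpU))
  filter_upwards [h1, extChartAt_source_mem_nhds (I := I) p] with y hy hys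
  rw [← hy.1, hfe _ hy.2, chartPt, (extChartAt I p).left_inv hys]

/-- On a compact connected quaternionic-Kähler manifold of dimension greater than `4`, the Penrose
operator of `D + S^α`, with `α` co-closed, is injective if the scalar curvature is negative, or if
it vanishes and `α` does not vanish identically. -/
theorem eq_zero_of_penrose_eq_zero [CompactSpace M] [ConnectedSpace M]
    (hE : 4 < Module.finrank ℝ E) (hD : Q.IsQuaternionicKahler D)
    (hD' : Q.IsQuaternionicConnection D') (hshift : Q.IsShift D' D α)
    (hα : ∀ x, D.codifferential α x = 0)
    (hscal : (∀ x, D.scal x < 0) ∨ ((∀ x, D.scal x = 0) ∧ ∃ x, α x ≠ 0)) (A : Q.Sections)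
    (hA : ∀ x, hD'.penrose A x = 0) (x : M) : A.1 x = 0 := by
  have : Nontrivial E := Module.nontrivial_of_finrank_pos (R := ℝ) (by omega)
  have hnt (y : M) : Nontrivial (TangentSpace I y) := inferInstanceAs (Nontrivial E)
  have hscal' (y : M) : D.scal y ≤ 0 := by
    rcases hscal with h | h
    · exact (h y).le
    · exact (h.1 y).le
  obtain ⟨q, -, hq⟩ := isCompact_univ.exists_isMaxOn (Set.univ_nonempty (α := M))
    (continuous_normSq A.1).continuousOn
  set m := qInner (A.1 q) (A.1 q) with hmdef
  have hle (y : M) : qInner (A.1 y) (A.1 y) ≤ m := hq (Set.mem_univ y)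
  have hnn (y : M) : 0 ≤ qInner (A.1 y) (A.1 y) :=
    (Q.basisAt_spec y).qInner_self_nonneg (A.2 y)
  rcases (hnn q).eq_or_lt with hm | hm
  · exact (Q.basisAt_spec x).eq_zero_of_qInner_self (A.2 x)
      (le_antisymm ((hle x).trans hm.ge) (hnn x))
  exfalso
  have hclopen : IsClopen {y | qInner (A.1 y) (A.1 y) = m} := by
    refine ⟨isClosed_eq (continuous_normSq A.1) continuous_const, isOpen_iff_mem_nhds.2 ?_⟩
    exact fun p hp => eventually_normSq_eq hE hD hD' hshift hα hscal' A hA hm hle hp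
  have hconst (y : M) : qInner (A.1 y) (A.1 y) = m := by
    have : y ∈ {y | qInner (A.1 y) (A.1 y) = m} := by
      rw [hclopen.eq_univ ⟨q, rfl⟩]; exact Set.mem_univ y
    exact this
  -- With `f = m` constant all derivatives vanish, and the Bochner formula becomes an equation
  -- between `Scal` and `|α|²` at each point.
  have hpoint (p : M) : 0 ≤ D.scal p ∧ (D.scal p = 0 → α p = 0) := by
    obtain ⟨U, hUo, hpU, hU, hB⟩ := exists_bochner hE hD hD' hshift hα A hA p
    have hb := hB _ hpU _ rfl
    have hfe (z) (hz : z ∈ U) : qInner (endRep p A.1 z) (endRep p A.1 z) = m := by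
      rw [qInner_endRep (hU hz), hconst]
    have e : (fun z => qInner (endRep p A.1 z) (endRep p A.1 z)) =ᶠ[𝓝 (extChartAt I p p)]
        fun _ => m := Filter.mem_of_superset (hUo.mem_nhds hpU) hfe
    have e1 : fderiv ℝ (fun z => qInner (endRep p A.1 z) (endRep p A.1 z))
        =ᶠ[𝓝 (extChartAt I p p)] fun _ => 0 := by
      filter_upwards [e.eventuallyEq_nhds] with z hz
      rw [hz.fderiv_eq, fderiv_fun_const]; rfl
    have e2 : fderiv ℝ (fderiv ℝ fun z => qInner (endRep p A.1 z) (endRep p A.1 z))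
        (extChartAt I p p) = 0 := by
      rw [e1.fderiv_eq, fderiv_fun_const]; rfl
    have hpt : chartPt I p (extChartAt I p p) = p := extChartAt_to_inv p
    simp only [e2, e1.self_of_nhds, hfe _ hpU, zero_apply, sub_zero, Finset.sum_const_zero,
      mul_zero, add_zero, zero_sub, ne_eq, OfNat.ofNat_ne_zero, not_false_eq_true, zero_pow] at hb
    rw [hpt] at hb
    set S1 := ∑ i, formRep p (fun y => α y) (extChartAt I p p) (coordBasis (hU hpU) i) ^ 2
      with hS1
    have hS0 : 0 ≤ S1 := Finset.sum_nonneg fun i _ => sq_nonneg _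
    have hm2 : 0 < m ^ 2 := by positivity
    have hN : (0 : ℝ) < Module.finrank ℝ E + 8 := by positivity
    have hs : D.scal p = 2 * (Module.finrank ℝ E + 8) * S1 := by
      refine mul_right_cancel₀ hm2.ne' ?_
      linear_combination (1 / 4) * hb
    refine ⟨by rw [hs]; positivity, fun h0 => ?_⟩
    have hS : S1 = 0 := by
      rw [hs] at h0
      exact (mul_eq_zero.1 h0).resolve_left (by positivity)
    rw [hS1, Finset.sum_eq_zero_iff_of_nonneg fun i _ => sq_nonneg _] at hS
    have hform : formRep p (fun y => α y) (extChartAt I p p) = 0 := by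
      refine ContinuousLinearMap.coe_injective ((coordBasis (hU hpU)).ext fun i => ?_)
      simpa using hS i (Finset.mem_univ i)
    have h1 (y : M) (hy : y = p) (h : ∀ W : TangentSpace I y, (α y W : ℝ) = 0) : α p = 0 := by
      subst hy; ext W; exact h W
    refine h1 _ hpt fun W => ?_
    rw [← formRep_apply_toCoord (hU hpU) (fun y => α y) W, hform]; rfl
  rcases hscal with h | ⟨h, y, hy⟩
  · exact absurd (hpoint x).1 (not_le.2 (h x))
  · exact hy ((hpoint y).2 (h y))

end Vanishing

end QuatGeom
end

theorem theorem5p4 {n : ℕ} (hn : 2 ≤ n)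
    {M : Type*} [TopologicalSpace M] [T2Space M] [CompactSpace M] [ConnectedSpace M]
    [ChartedSpace (EuclideanSpace ℝ (Fin (4 * n))) M] [IsManifold (𝓡 (4 * n)) ∞ M]
    [RiemannianBundle (fun x : M => TangentSpace (𝓡 (4 * n)) x)]
    [IsContMDiffRiemannianBundle (𝓡 (4 * n)) ∞ (EuclideanSpace ℝ (Fin (4 * n)))
      (fun x : M => TangentSpace (𝓡 (4 * n)) x)]
    (Q : AlmostQuaternionicStructure (𝓡 (4 * n)) M)
    (Dg : Connection (𝓡 (4 * n)) M) (hg : Q.IsQuaternionicKahler Dg)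
    (D : Connection (𝓡 (4 * n)) M) (hD : Q.IsQuaternionicConnection D)
    (α : OneForm (𝓡 (4 * n)) M) (hDα : Q.IsShift D Dg α)
    (hα : ∀ x, Dg.codifferential α x = 0)
    (hscal : (∀ x, Dg.scal x < 0) ∨ ((∀ x, Dg.scal x = 0) ∧ Dense {x | α x ≠ 0}))
    (A : Q.Sections) (hA : ∀ x, hD.penrose A x = 0) :
    ∀ x, A.1 x = 0 := by
  refine eq_zero_of_penrose_eq_zero (by simp; omega) hg hD hDα hα ?_ A hA
  -- A dense subset of the nonempty space `M` contains a point, and one point with `α ≠ 0` suffices.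
  exact hscal.imp_right fun h => ⟨h.1, h.2.nonempty⟩
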